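/- Let $d\ge 2$ be an integer, let $S^d\subset\mathbf R^{d+1}$ be the unit sphere with its surface measure $\mathrm dx$, and let $S^d_+=\{x\in S^d: x_{d+1}>0\}$. Let $$\partial_+S(S^d_+)=\{((x',0),\xi): x'\in S^{d-1},\ \xi\in S^d,\ \xi_{d+1}>0,\ \langle (x',0),\xi\rangle=0\}$$ with the measure $\mathrm d\mu=\xi_{d+1}\,\mathrm dx'\,\mathrm d\xi$, where $\mathrm dx'$ is the surface measure of $S^{d-1}$ and $\mathrm d\xi$ the surface measure of the unit sphere $S^d\cap(x',0)^\perp$ of dimension $d-1$, so that $$\|F\|_{L^2(\partial_+S(S^d_+))}^2=\int_{S^{d-1}}\int_{S^d_+\cap(x',0)^\perp}|F(x',\xi)|^2\,\xi_{d+1}\,\mathrm d\xi\,\mathrm dx'.$$ For $\lambda\ge 0$ and $f\in L^2(S^d_+)$ (complex valued), the attenuated geodesic ray transform is $$T_\lambda^+f(x',\xi)=\int_0^\pi f\big(\cos t\,(x',0)+\sin t\,\xi\big)\,e^{-\lambda t}\,\mathrm dt .$$ Let $H^{1/2}(S^d_+)$ have the norm $$\|\varphi\|_{H^{1/2}(S^d_+)}^2=\int_{S^d_+}|\varphi(x)|^2\,\mathrm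 dx+\int_{S^d_+}\int_{S^d_+}\frac{|\varphi(x)-\varphi(y)|^2}{|x-y|^{d+1}}\,\mathrm dx\,\mathrm dy,$$ and let $H^{-1/2}(S^d_+)$ be the dual of the closure $H^{1/2}_0(S^d_+)$ of $C_c^\infty(S^d_+)$ in $H^{1/2}(S^d_+)$, that is, for $f\in L^2(S^d_+)$, $$\|f\|_{H^{-1/2}(S^d_+)}=\sup\Big\{\Big|\int_{S^d_+}f\varphi\,\mathrm dx\Big| : \varphi\in C_c^\infty(S^d_+),\ \|\varphi\|_{H^{1/2}(S^d_+)}\le 1\Big\}.$$ **Theorem.** Let $\alpha_0\in(0,1)$. There exist constants $\lambda_0>0$ and $C>0$ (depending only on $d$ and $\alpha_0$) such that for all $0\le\lambda\le\lambda_0$ and all $f\in L^2(S^d_+)$ supported in the cap $\{x\in S^d: x_{d+1}>\alpha_0\}$ (that is, vanishing almost everywhere on $S^d_+$ outside it), $$\|f\|_{H^{-1/2}(S^d_+)}\le C\,\|T_\lambda^+f\|_{L^2(\partial_+S(S^d_+))}.$$ -/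

import Mathlib

open MeasureTheory Metric Set
open scoped ENNReal ContDiff

noncomputable section

namespace HemisphereXray

/-- The Euclidean space `ℝⁿ`. -/
abbrev Euc (n : ℕ) : Type := EuclideanSpace ℝ (Fin n)

/-- The surface measure of the unit sphere of a Euclidean space `F`, as a measure on `F`
(concentrated on the unit sphere, total mass the usual area). -/
def sphereMeasure (F : Type*) [NormedAddCommGroup F] [NormedSpace ℝ F] [MeasureSpace F] :
    Measure F :=
  ((volume : Measure F).toSphere).map (fun u : sphere (0 : F) 1 => (u : F))

/-- The last coordinate `x_{d+1}` of a point of `ℝ^{d+1}`. -/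
def height {d : ℕ} (x : Euc (d + 1)) : ℝ := x (Fin.last d)

/-- The surface measure of the open hemisphere `S^d_+ = {x ∈ S^d : x_{d+1} > 0}`.
A function in `L²(S^d_+)` is a function on `ℝ^{d+1}` that is in `L²` for this measure; its values
outside `S^d_+` play no role anywhere. -/
def hemisphereMeasure (d : ℕ) : Measure (Euc (d + 1)) :=
  (sphereMeasure (Euc (d + 1))).restrict {x | 0 < height x}

/-- The point `(x', 0)` of `ℝ^{d+1}`. -/
def equatorPoint {d : ℕ} (x' : Euc d) : Euc (d + 1) :=
  WithLp.toLp 2 (Fin.snoc (α := fun _ => ℝ) (fun i => x' i) 0)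

/-- The half great circle `t ↦ cos t (x', 0) + sin t ξ`. -/
def halfCircle {d : ℕ} (x' : Euc d) (ξ : Euc (d + 1)) (t : ℝ) : Euc (d + 1) :=
  Real.cos t • equatorPoint x' + Real.sin t • ξ

/-- The attenuated geodesic ray transform
`T_a f (x', ξ) = ∫₀^π f(cos t (x', 0) + sin t ξ) e^{-a t} dt`, with attenuation `a`. -/
def attenuatedXray {d : ℕ} (a : ℝ) (f : Euc (d + 1) → ℂ) (x' : Euc d) (ξ : Euc (d + 1)) : ℂ :=
  ∫ t in (0 : ℝ)..Real.pi, f (halfCircle x' ξ t) * (Real.exp (-a * t) : ℂ)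

/-- The surface measure `dξ` of the half sphere `{ξ ∈ S^d : ξ ⟂ (x', 0), ξ_{d+1} > 0}`
of dimension `d - 1`: the inward unit directions at the boundary point `(x', 0)`. -/
def directionMeasure {d : ℕ} (x' : Euc d) : Measure (Euc (d + 1)) :=
  ((sphereMeasure (Submodule.span ℝ {equatorPoint x'})ᗮ).map
    (fun ξ : (Submodule.span ℝ {equatorPoint x'})ᗮ => (ξ : Euc (d + 1)))).restrict
      {ξ | 0 < height ξ}

/-- The norm of `L²(∂₊S(S^d_+))` for the measure `dμ = ξ_{d+1} dξ dx'`. -/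
def boundaryL2Norm {d : ℕ} (F : Euc d → Euc (d + 1) → ℂ) : ℝ≥0∞ :=
  (∫⁻ x' : Euc d, (∫⁻ ξ : Euc (d + 1), ‖F x' ξ‖ₑ ^ 2 * ENNReal.ofReal (height ξ)
    ∂(directionMeasure x')) ∂(sphereMeasure (Euc d))) ^ (1 / 2 : ℝ)

/-- The Sobolev–Slobodeckij norm of `H^{1/2}(S^d_+)`:
`‖φ‖² = ∫ |φ(x)|² dx + ∬ |φ(x) - φ(y)|² / |x - y|^{d+1} dx dy`. -/
def sobolevHalfNorm {d : ℕ} (φ : Euc (d + 1) → ℂ) : ℝ≥0∞ :=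
  ((∫⁻ x, ‖φ x‖ₑ ^ 2 ∂(hemisphereMeasure d)) +
    ∫⁻ x, (∫⁻ y, ‖φ x - φ y‖ₑ ^ 2 / ‖x - y‖ₑ ^ (d + 1) ∂(hemisphereMeasure d))
      ∂(hemisphereMeasure d)) ^ (1 / 2 : ℝ)

/-- The test functions on `S^d_+`, i.e. the smooth functions with compact support in the open
hemisphere. They are the restrictions to the sphere of the smooth functions on `ℝ^{d+1}` with
compact support in the open half space `{x_{d+1} > 0}`. -/
structure IsTestFunction {d : ℕ} (φ : Euc (d + 1) → ℂ) : Prop where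
  smooth : ContDiff ℝ ∞ φ
  compact : HasCompactSupport φ
  support : tsupport φ ⊆ {x | 0 < height x}

/-- The norm of `H^{-1/2}(S^d_+)`, the dual space of `H^{1/2}_0(S^d_+)` (the closure of the test
functions in `H^{1/2}(S^d_+)`), for `f ∈ L²(S^d_+)` acting by `φ ↦ ∫ f φ`. -/
def sobolevNegHalfNorm {d : ℕ} (f : Euc (d + 1) → ℂ) : ℝ≥0∞ :=
  ⨆ (φ : Euc (d + 1) → ℂ) (_ : IsTestFunction φ) (_ : sobolevHalfNorm φ ≤ 1),
    ‖∫ x, f x * φ x ∂(hemisphereMeasure d)‖ₑ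

end HemisphereXray

end

set_option linter.unusedSectionVars false

noncomputable section

namespace HemisphereXray

/-! ### Orthogonal splittings and polar coordinates. -/

section Hyperplane

variable {E F : Type*} [NormedAddCommGroup E] [InnerProductSpace ℝ E] [FiniteDimensional ℝ E]
  [MeasurableSpace E] [BorelSpace E]
  [NormedAddCommGroup F] [InnerProductSpace ℝ F] [FiniteDimensional ℝ F]
  [MeasurableSpace F] [BorelSpace F]

/-! Central projection onto the tangent hyperplane at the pole maps the open hemisphere onto ℝ^d and
half great circles onto lines. Put y = p + sθ with p ⟂ θ and q = √(1+|p|²). The arc parameter is t =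
π/2 − arctan(s/q), with |dt| = q ds/(1+|y|²). With g(y) = f/(1+|y|²) (`planar`) and h(y) =
y/√(1+|y|²) (`horizontal`), the attenuated transform is q e^{-λπ/2} ∫ g(y) e^{λ arcsin⟨h(y),θ⟩} ds
(`attenuatedXray_gnomonic`, `arcsin_inner_horizontal`). The cap becomes a ball of radius R, on which
|h| ≤ ρ < 1 and the Jacobians are comparable to constants.

For λ = 0 this is the Euclidean X-ray transform. Its squared L² norm over the lines of direction θ
is the integral of the autocorrelation of g along ℝθ (`lintegral_xray_sq`). Integrating over θ in
polar coordinates produces the Riesz kernel |z|^{1-d}, whose Fourier transform is a multiple of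
1/|ξ|. So the total energy is c ∫ |ĝ|²/|ξ| (`lintegral_xrayEnergy`), which dominates ∫ |ĝ|²/(1+|ξ|).
Conversely, for g supported in a fixed ball the low frequencies are controlled by the H^{-1/2} norm
(`exists_homogeneous_le_negHalfNorm`), so energy and H^{-1/2} norm are equivalent.

A small λ is a perturbation. The Taylor coefficients of e^{λ arcsin u} of degree k ≥ 1 lie in [0,
λ]. Expanding ⟨h,θ⟩^k as ⟨h^{⊗k}, θ^{⊗k}⟩, with |θ^{⊗k}| = 1, Cauchy–Schwarz reduces the degree k
term to unattenuated transforms of the functions h^J g, which no longer involve θ. These are bounded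
by the multiplier theorem on H^{-1/2} in vector-valued form (`exists_negHalfNorm_multiplier`). The
tensor h^{⊗k} has norm ρ^k and Lipschitz constant of order kρ^{k-1}, without any factor d^k
(`sum_tensorEntry_sub_sq_le`), so the sum over k converges. The error is then O(λ²) times the energy
itself and is absorbed (`exists_xrayEnergy_le_attenuatedEnergy`).

Finally, pairing f with a test function on the hemisphere is pairing g with a Lipschitz cutoff times
that function in the chart, and the H^{1/2} norms compare (`exists_enorm_integral_mul_sq_le`). -/

lemma norm_sq_hyperplane_add (ι : E →ₗᵢ[ℝ] F) {e : F} (he : ‖e‖ = 1)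
    (hι : ∀ p, inner ℝ (ι p) e = 0) (p : E) (s : ℝ) :
    ‖ι p + s • e‖ ^ 2 = ‖p‖ ^ 2 + s ^ 2 := by
  rw [norm_add_sq_real, inner_smul_right, hι, norm_smul, he, ι.norm_map]
  simp

lemma measurePreserving_hyperplane_add (ι : E →ₗᵢ[ℝ] F) {e : F} (he : ‖e‖ = 1)
    (hι : ∀ p, inner ℝ (ι p) e = 0)
    (hdim : Module.finrank ℝ F = Module.finrank ℝ E + 1) :
    MeasurePreserving (fun z : E × ℝ => ι z.1 + z.2 • e) (volume.prod volume) volume := by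
  let L : WithLp 2 (E × ℝ) →ₗᵢ[ℝ] F :=
    { toFun := fun z => ι z.fst + z.snd • e
      map_add' := fun x y => by simp [add_smul]; abel
      map_smul' := fun c x => by simp [mul_smul]
      norm_map' := fun z => by
        have h1 := norm_sq_hyperplane_add ι he hι z.fst z.snd
        have h2 := WithLp.prod_norm_sq_eq_of_L2 z
        have : ‖z.snd‖ ^ 2 = z.snd ^ 2 := by simp
        rw [this] at h2
        exact (sq_eq_sq₀ (norm_nonneg _) (norm_nonneg _)).1 (by simpa using h1.trans h2.symm) }
  have hd : Module.finrank ℝ (WithLp 2 (E × ℝ)) = Module.finrank ℝ F := by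
    rw [hdim, (WithLp.linearEquiv 2 ℝ (E × ℝ)).finrank_eq]; simp
  let L' := L.toLinearIsometryEquiv hd
  exact (L'.measurePreserving).comp (WithLp.volume_preserving_toLp (U := E) (V := ℝ))

/-- Integration in polar coordinates. -/
lemma lintegral_polar [Nontrivial F] {f : F → ℝ≥0∞} (hf : Measurable f) :
    ∫⁻ x, f x = ∫⁻ ξ, (∫⁻ r in Ioi (0 : ℝ),
      ENNReal.ofReal (r ^ (Module.finrank ℝ F - 1)) * f (r • ξ)) ∂(sphereMeasure F) := by
  have h1 := (volume : Measure F).measurePreserving_homeomorphUnitSphereProd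
  have h2 : ∫⁻ x, f x = ∫⁻ x : ({0}ᶜ : Set F), f x ∂(volume.comap Subtype.val) := by
    rw [lintegral_subtype_comap (measurableSet_singleton _).compl, restrict_compl_singleton]
  have h3 : Measurable fun z : sphere (0 : F) 1 × Ioi (0 : ℝ) => f (z.2.1 • z.1.1) := by
    fun_prop
  have h4 := h1.lintegral_comp h3
  have h5 : ∀ x : ({0}ᶜ : Set F), (homeomorphUnitSphereProd F x).2.1 •
      (homeomorphUnitSphereProd F x).1.1 = x.1 := by
    intro x
    have : ‖(x : F)‖ ≠ 0 := norm_ne_zero_iff.2 x.2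
    simp [smul_smul, this]
  simp only [h5] at h4
  rw [h2, h4, lintegral_prod _ h3.aemeasurable, sphereMeasure, lintegral_map]
  · refine lintegral_congr fun ξ => ?_
    rw [Measure.volumeIoiPow, lintegral_withDensity_eq_lintegral_mul]
    · rw [← lintegral_subtype_comap measurableSet_Ioi]; rfl
    · fun_prop
    · fun_prop
  · refine Measurable.lintegral_prod_right' (f := fun z : F × ℝ =>
      ENNReal.ofReal (z.2 ^ (Module.finrank ℝ F - 1)) * f (z.2 • z.1)) ?_
    fun_prop
  · exact measurable_subtype_coe

end Hyperplane

/-! ### Surface measure in the gnomonic chart. -/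

section Gnomonic

variable {E F : Type*} [NormedAddCommGroup E] [InnerProductSpace ℝ E] [FiniteDimensional ℝ E]
  [MeasurableSpace E] [BorelSpace E]
  [NormedAddCommGroup F] [InnerProductSpace ℝ F] [FiniteDimensional ℝ F]
  [MeasurableSpace F] [BorelSpace F]

lemma lintegral_comp_smul_pos {f : E → ℝ≥0∞} (hf : Measurable f) {s : ℝ} (hs : 0 < s) :
    ∫⁻ x, f x = ENNReal.ofReal (s ^ Module.finrank ℝ E) * ∫⁻ x, f (s • x) := by
  have h := Measure.map_addHaar_smul (volume : Measure E) hs.ne'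
  have h1 : ∫⁻ x, f (s • x) = ∫⁻ x, f x ∂(Measure.map (s • ·) volume) := by
    rw [lintegral_map hf (by fun_prop)]
  rw [h1, h, lintegral_smul_measure, smul_eq_mul, ← mul_assoc, ← ENNReal.ofReal_mul (by positivity),
    abs_of_pos (by positivity), mul_inv_cancel₀ (by positivity), ENNReal.ofReal_one, one_mul]

lemma setLIntegral_Ioo_pow (n : ℕ) {b : ℝ} (hb : 0 ≤ b) :
    ∫⁻ r in Ioo 0 b, ENNReal.ofReal (r ^ n) = ENNReal.ofReal (b ^ (n + 1) / (n + 1)) := by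
  rw [← ofReal_integral_eq_lintegral_ofReal, ← integral_Ioc_eq_integral_Ioo,
    ← intervalIntegral.integral_of_le hb, integral_pow]
  · simp
  · exact ((continuous_pow n).integrableOn_Icc).mono_set Ioo_subset_Icc_self
  · exact (ae_restrict_iff' measurableSet_Ioo).2 (ae_of_all _ fun r hr => pow_nonneg hr.1.le _)

lemma one_le_sqrt_one_add (p : E) : 1 ≤ √(1 + ‖p‖ ^ 2) := by
  rw [Real.one_le_sqrt]; nlinarith [sq_nonneg ‖p‖]

lemma norm_graph (ι : E →ₗᵢ[ℝ] F) {e : F} (he : ‖e‖ = 1)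
    (hι : ∀ p, inner ℝ (ι p) e = 0) (p : E) : ‖ι p + e‖ = √(1 + ‖p‖ ^ 2) := by
  have := norm_sq_hyperplane_add ι he hι p 1
  rw [one_smul] at this
  rw [eq_comm, Real.sqrt_eq_iff_eq_sq (by positivity) (norm_nonneg _), this]; ring

lemma ae_norm_eq_one_sphereMeasure : ∀ᵐ ξ ∂(sphereMeasure F), ‖ξ‖ = 1 := by
  rw [sphereMeasure, ae_map_iff (by fun_prop) (by measurability)]
  exact ae_of_all _ fun u => by simp

/-- The surface measure of a half sphere in the gnomonic chart. -/
lemma lintegral_halfSphere_gnomonic (ι : E →ₗᵢ[ℝ] F) {e : F} (he : ‖e‖ = 1)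
    (hι : ∀ p, inner ℝ (ι p) e = 0)
    (hdim : Module.finrank ℝ F = Module.finrank ℝ E + 1)
    {Φ : F → ℝ≥0∞} (hΦ : Measurable Φ) :
    ∫⁻ ξ in {ξ | 0 < inner ℝ ξ e}, Φ ξ ∂(sphereMeasure F) =
      ∫⁻ p : E, ENNReal.ofReal ((√(1 + ‖p‖ ^ 2))⁻¹ ^ (Module.finrank ℝ E + 1)) *
        Φ ((√(1 + ‖p‖ ^ 2))⁻¹ • (ι p + e)) := by
  set n := Module.finrank ℝ E with hn
  have : Nontrivial F := Module.nontrivial_of_finrank_pos (R := ℝ) (by omega)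
  have hmE : MeasurableSet {ξ : F | 0 < inner ℝ ξ e} := measurableSet_lt (by fun_prop) (by fun_prop)
  -- The formula comes from computing the integral of Φ(v/|v|) over the unit half ball twice. Polar
  -- coordinates give the spherical integral times c = 1/(n+1). Slicing by the hyperplanes ⟨v,e⟩ = s
  -- and scaling p by s gives the chart integral times the same c.
  set A : F → ℝ≥0∞ := fun v => {ξ : F | 0 < inner ℝ ξ e}.indicator 1 v *
    ((Iio (1 : ℝ)).indicator 1 ‖v‖ * Φ (‖v‖⁻¹ • v)) with hA
  have hAm : Measurable A := by
    refine Measurable.mul (measurable_one.indicator hmE) (Measurable.mul ?_ (by fun_prop))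
    exact (measurable_one.indicator measurableSet_Iio).comp measurable_norm
  set c : ℝ≥0∞ := ENNReal.ofReal (1 ^ (n + 1) / (n + 1)) with hc
  have hc0 : c ≠ 0 := by rw [hc]; simp; positivity
  have hct : c ≠ ⊤ := ENNReal.ofReal_ne_top
  have key1 : ∫⁻ v, A v = c * ∫⁻ ξ in {ξ | 0 < inner ℝ ξ e}, Φ ξ ∂(sphereMeasure F) := by
    rw [lintegral_polar hAm, ← lintegral_indicator hmE, ← lintegral_const_mul _ (hΦ.indicator hmE)]
    refine lintegral_congr_ae ?_
    filter_upwards [ae_norm_eq_one_sphereMeasure] with ξ hξ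
    have h1 : ∀ r ∈ Ioi (0 : ℝ), ENNReal.ofReal (r ^ (Module.finrank ℝ F - 1)) * A (r • ξ) =
        (Iio (1 : ℝ)).indicator (fun r => ENNReal.ofReal (r ^ n)) r *
          {ξ | 0 < inner ℝ ξ e}.indicator Φ ξ := by
      intro r hr
      have hr : 0 < r := hr
      have h2 : (0 < inner ℝ (r • ξ) e) ↔ 0 < inner ℝ ξ e := by
        rw [real_inner_smul_left]; exact mul_pos_iff_of_pos_left hr
      have h3 : r⁻¹ • r • ξ = ξ := by rw [smul_smul, inv_mul_cancel₀ hr.ne', one_smul]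
      simp only [hA, indicator, mem_ofPred_eq, h2, norm_smul, hξ, mul_one, Real.norm_of_nonneg hr.le,
        mem_Iio, hdim, Nat.add_sub_cancel, h3]
      split_ifs <;> simp
    rw [setLIntegral_congr_fun measurableSet_Ioi h1, lintegral_mul_const, setLIntegral_indicator measurableSet_Iio,
      Set.inter_comm, Ioi_inter_Iio, setLIntegral_Ioo_pow n zero_le_one]
    exact Measurable.indicator (by fun_prop) measurableSet_Iio
  have key2 : ∫⁻ v, A v = c * ∫⁻ p : E, ENNReal.ofReal ((√(1 + ‖p‖ ^ 2))⁻¹ ^ (n + 1)) *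
        Φ ((√(1 + ‖p‖ ^ 2))⁻¹ • (ι p + e)) := by
    have hmp := measurePreserving_hyperplane_add ι he hι hdim
    have hinner : ∀ (p : E) (s : ℝ), inner ℝ (ι p + s • e) e = s := by
      intro p s
      rw [inner_add_left, hι, real_inner_smul_left, real_inner_self_eq_norm_sq, he]; simp
    have hιm : Measurable ι := ι.continuous.measurable
    have hA2 : Measurable fun z : E × ℝ => A (ι z.1 + z.2 • e) := hAm.comp hmp.measurable
    rw [← hmp.lintegral_comp hAm, lintegral_prod_symm' _ hA2]
    have hz : ∀ s, s ∉ Ioi (0 : ℝ) → ∫⁻ p : E, A (ι p + s • e) = 0 := by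
      intro s hs
      refine (lintegral_congr fun p => ?_).trans lintegral_zero
      simp only [hA, indicator, mem_ofPred_eq, hinner]
      rw [if_neg (by simpa using hs), zero_mul]
    have h0 : ∫⁻ s : ℝ, ∫⁻ p : E, A (ι p + s • e) = ∫⁻ s in Ioi (0 : ℝ), ∫⁻ p : E, A (ι p + s • e) := by
      rw [← lintegral_indicator measurableSet_Ioi]
      refine lintegral_congr fun s => ?_
      by_cases hs : s ∈ Ioi (0 : ℝ)
      · rw [indicator_of_mem hs]
      · rw [indicator_of_notMem hs, hz s hs]
    rw [h0]
    have h1 : ∀ s ∈ Ioi (0 : ℝ), ∫⁻ p : E, A (ι p + s • e) =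
        ∫⁻ p : E, ENNReal.ofReal (s ^ n) * ((Iio (1 : ℝ)).indicator 1 (s * √(1 + ‖p‖ ^ 2)) *
          Φ ((√(1 + ‖p‖ ^ 2))⁻¹ • (ι p + e))) := by
      intro s hs
      have hs : 0 < s := hs
      rw [lintegral_comp_smul_pos (by fun_prop) hs, ← lintegral_const_mul _ (by fun_prop)]
      refine lintegral_congr fun p => ?_
      have hp := norm_graph ι he hι p
      have hq : 0 < √(1 + ‖p‖ ^ 2) := zero_lt_one.trans_le (one_le_sqrt_one_add p)
      have h3 : ι (s • p) + s • e = s • (ι p + e) := by simp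
      have h4 : inner ℝ (s • (ι p + e)) e = s := by rw [← h3, hinner]
      simp only [hA, h3]
      rw [indicator_of_mem (show s • (ι p + e) ∈ {ξ : F | 0 < inner ℝ ξ e} by
        rw [mem_ofPred_eq, h4]; exact hs)]
      rw [norm_smul, hp, Real.norm_of_nonneg hs.le, smul_smul]
      have : (s * √(1 + ‖p‖ ^ 2))⁻¹ * s = (√(1 + ‖p‖ ^ 2))⁻¹ := by field_simp
      rw [this]; simp [← hn]
    rw [setLIntegral_congr_fun measurableSet_Ioi h1, lintegral_lintegral_swap,
      ← lintegral_const_mul _ (by fun_prop)]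
    · refine lintegral_congr fun p => ?_
      have hq : 0 < √(1 + ‖p‖ ^ 2) := zero_lt_one.trans_le (one_le_sqrt_one_add p)
      have h5 : ∀ s : ℝ, ENNReal.ofReal (s ^ n) * ((Iio (1 : ℝ)).indicator 1 (s * √(1 + ‖p‖ ^ 2)) *
          Φ ((√(1 + ‖p‖ ^ 2))⁻¹ • (ι p + e))) =
          (Iio (√(1 + ‖p‖ ^ 2))⁻¹).indicator (fun s => ENNReal.ofReal (s ^ n)) s *
            Φ ((√(1 + ‖p‖ ^ 2))⁻¹ • (ι p + e)) := by
        intro s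
        -- The ray through ι p + e leaves the unit ball at height s = 1/√(1+|p|²). Integrating s^n
        -- up to there yields the Jacobian.
        have : s < (√(1 + ‖p‖ ^ 2))⁻¹ ↔ s * √(1 + ‖p‖ ^ 2) < 1 := by
          rw [← one_div, lt_div_iff₀ hq]
        simp only [indicator, mem_Iio, this]
        split_ifs <;> simp
      simp only [h5]
      rw [lintegral_mul_const, setLIntegral_indicator measurableSet_Iio,
        Set.inter_comm, Ioi_inter_Iio, setLIntegral_Ioo_pow n (by positivity), hc,
        ← mul_assoc, ← ENNReal.ofReal_mul (by positivity)]
      · congr 2; ring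
      · exact Measurable.indicator (by fun_prop) measurableSet_Iio
    · refine Measurable.aemeasurable ?_
      have : Measurable fun z : ℝ × E => (Iio (1 : ℝ)).indicator (1 : ℝ → ℝ≥0∞) (z.1 * √(1 + ‖z.2‖ ^ 2)) :=
        (measurable_one.indicator measurableSet_Iio).comp (by fun_prop)
      simp only [Function.uncurry_def]
      fun_prop
  exact (ENNReal.mul_right_inj hc0 hct).1 (key1.symm.trans key2)

end Gnomonic

/-! ### The L² Fourier transform and translations. -/

section PlaneWaves

open FourierTransform SchwartzMap

variable {V : Type*} [NormedAddCommGroup V] [InnerProductSpace ℝ V] [FiniteDimensional ℝ V]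
  [MeasurableSpace V] [BorelSpace V]

/-- The L² transform agrees with that of tempered distributions, which acts by duality on Schwartz
functions. Pointwise identities for it are obtained by testing through this one. -/
lemma integral_mul_fourier_Lp (f : Lp ℂ 2 (volume : Measure V)) (φ : 𝓢(V, ℂ)) :
    ∫ x, φ x * (𝓕 f : Lp ℂ 2 (volume : Measure V)) x = ∫ x, 𝓕 (φ : V → ℂ) x * f x := by
  have h := Lp.fourier_toTemperedDistribution_eq f
  have h2 := congrArg (fun T => T φ) h
  simp only [TemperedDistribution.fourier_apply, Lp.toTemperedDistribution_apply, smul_eq_mul] at h2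
  rw [← h2]; rfl

lemma locallyIntegrable_Lp (f : Lp ℂ 2 (volume : Measure V)) : LocallyIntegrable f volume :=
  (Lp.memLp f).locallyIntegrable one_le_two

lemma ae_eq_of_integral_schwartz {f g : V → ℂ} (hf : LocallyIntegrable f) (hg : LocallyIntegrable g)
    (h : ∀ φ : V → ℂ, ContDiff ℝ ∞ φ → HasCompactSupport φ →
      ∫ x, φ x * f x = ∫ x, φ x * g x) : f =ᵐ[volume] g := by
  refine ae_eq_of_integral_contDiff_smul_eq hf hg fun φ hφ hφc => ?_
  have := h (fun x => (φ x : ℂ)) (Complex.ofRealCLM.contDiff.comp hφ)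
    (hφc.comp_left (g := Complex.ofReal) rfl)
  simpa [Complex.real_smul] using this

lemma continuous_fourier_of_integrable {f : V → ℂ} (hf : Integrable f) : Continuous (𝓕 f) :=
  VectorFourier.fourierIntegral_continuous Real.continuous_fourierChar continuous_inner hf

/-- The Fourier transform in `L²` extends the Fourier integral. -/
lemma fourier_toLp_ae_eq {f : V → ℂ} (hf : Integrable f) (hf2 : MemLp f 2) :
    ((𝓕 (hf2.toLp f) : Lp ℂ 2 (volume : Measure V)) : V → ℂ) =ᵐ[volume] 𝓕 f := by
  refine ae_eq_of_integral_schwartz (locallyIntegrable_Lp _)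
    (continuous_fourier_of_integrable hf).locallyIntegrable fun φ hφ hφc => ?_
  have h1 := integral_mul_fourier_Lp (hf2.toLp f) (hφc.toSchwartzMap hφ)
  have h2 : ∀ x, (hφc.toSchwartzMap hφ) x = φ x := fun x => rfl
  simp only [h2] at h1
  rw [h1]
  have h3 : ∫ ξ, 𝓕 φ ξ • f ξ = ∫ x, φ x • 𝓕 f x := by
    simpa using! VectorFourier.integral_fourierIntegral_smul_eq_flip (L := innerₗ V)
      Real.continuous_fourierChar continuous_inner
      (hφc.toSchwartzMap hφ).integrable hf
  simp only [smul_eq_mul] at h3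
  rw [← h3]
  refine integral_congr_ae ?_
  filter_upwards [hf2.coeFn_toLp] with x hx
  rw [hx]; rfl

/-- The plane wave `x ↦ e^{2πi⟨h, x⟩}`. -/
def planeWave (h x : V) : ℂ := (Real.fourierChar (inner ℝ h x) : ℂ)

lemma planeWave_eq (h x : V) :
    planeWave h x = Complex.exp (2 * Real.pi * inner ℝ h x * Complex.I) := by
  rw [planeWave, Real.fourierChar_apply]; push_cast; rfl

@[simp] lemma norm_planeWave (h x : V) : ‖planeWave h x‖ = 1 := by
  exact Circle.norm_coe _

lemma contDiff_planeWave (h : V) : ContDiff ℝ ∞ (planeWave h) := by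
  have : planeWave h = fun x => Complex.exp (2 * Real.pi * Complex.ofRealCLM (inner ℝ h x) * Complex.I) := by
    ext x; rw [planeWave_eq]; rfl
  rw [this]
  have h1 : ContDiff ℝ ∞ fun x : V => Complex.ofRealCLM (inner ℝ h x) :=
    Complex.ofRealCLM.contDiff.comp (contDiff_const.inner ℝ contDiff_id)
  exact ((contDiff_const.mul h1).mul contDiff_const).cexp

lemma continuous_planeWave : Continuous fun z : V × V => planeWave z.1 z.2 := by
  have : (fun z : V × V => planeWave z.1 z.2) = fun z =>
      Complex.exp (2 * Real.pi * (inner ℝ z.1 z.2 : ℝ) * Complex.I) := by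
    ext x; rw [planeWave_eq]
  rw [this]; fun_prop

lemma fourier_eq_integral_planeWave (f : V → ℂ) (ξ : V) :
    𝓕 f ξ = ∫ x, planeWave (-ξ) x * f x := by
  rw [Real.fourier_eq]
  refine integral_congr_ae (ae_of_all _ fun x => ?_)
  simp only [planeWave, inner_neg_left, real_inner_comm, Circle.smul_def, smul_eq_mul]

lemma memLp_translate_sub (f : Lp ℂ 2 (volume : Measure V)) (h : V) :
    MemLp (fun x => f (x + h) - f x) 2 := by
  refine MemLp.sub ?_ (Lp.memLp f)
  exact (Lp.memLp f).comp_measurePreserving (measurePreserving_add_right volume h)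

lemma memLp_wave_mul {f : V → ℂ} (hf : MemLp f 2) (h : V) :
    MemLp (fun x => planeWave h x * f x) 2 := by
  refine MemLp.of_le hf ?_ (ae_of_all _ fun x => by simp)
  exact (contDiff_planeWave h).continuous.aestronglyMeasurable.mul hf.1

/-- Translation becomes modulation. After testing against φ, the translation is moved onto φ̂, and a
translate of φ̂ is the transform of a plane wave times φ, which is again smooth with compact
support. -/
lemma fourier_translate_sub (f : Lp ℂ 2 (volume : Measure V)) (h : V) :
    ((𝓕 ((memLp_translate_sub f h).toLp _) : Lp ℂ 2 (volume : Measure V)) : V → ℂ) =ᵐ[volume]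
      fun ξ => (planeWave h ξ - 1) * (𝓕 f : Lp ℂ 2 (volume : Measure V)) ξ := by
  set F := (𝓕 f : Lp ℂ 2 (volume : Measure V)) with hF
  have hFl := Lp.memLp F
  have hloc : LocallyIntegrable (fun ξ => (planeWave h ξ - 1) * F ξ) := by
    simp only [sub_mul, one_mul]
    exact ((memLp_wave_mul hFl h).sub hFl).locallyIntegrable one_le_two
  refine ae_eq_of_integral_schwartz (locallyIntegrable_Lp _) hloc fun φ hφ hφc => ?_
  set Φ := hφc.toSchwartzMap hφ with hΦ
  have hcw : HasCompactSupport fun x => planeWave h x * φ x := hφc.mul_left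
  have hdw : ContDiff ℝ ∞ fun x => planeWave h x * φ x := (contDiff_planeWave h).mul hφ
  set Ψ := hcw.toSchwartzMap hdw with hΨ
  have hΦv : ∀ x, Φ x = φ x := fun x => rfl
  have hΨv : ∀ x, Ψ x = planeWave h x * φ x := fun x => rfl
  have hint : ∀ (A : 𝓢(V, ℂ)) {g : V → ℂ}, MemLp g 2 → Integrable fun x => A x * g x :=
    fun A g hg => (A.memLp 2).integrable_mul hg
  have hint' : ∀ (A : 𝓢(V, ℂ)) {g : V → ℂ}, MemLp g 2 →
      Integrable fun x => 𝓕 (A : V → ℂ) x * g x :=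
    fun A g hg => by
      rw [← SchwartzMap.fourier_coe]; exact hint _ hg
  have h1 := integral_mul_fourier_Lp ((memLp_translate_sub f h).toLp _) Φ
  simp only [hΦv] at h1
  rw [h1]
  have hLp := Lp.memLp f
  have hτ : MemLp (fun x => f (x + h)) 2 :=
    hLp.comp_measurePreserving (measurePreserving_add_right volume h)
  have h2 : ∫ x, 𝓕 (Φ : V → ℂ) x * ((memLp_translate_sub f h).toLp _ : Lp ℂ 2 volume) x =
      (∫ x, 𝓕 (Φ : V → ℂ) x * f (x + h)) - ∫ x, 𝓕 (Φ : V → ℂ) x * f x := by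
    rw [← integral_sub (hint' Φ hτ) (hint' Φ hLp)]
    refine integral_congr_ae ?_
    filter_upwards [(memLp_translate_sub f h).coeFn_toLp] with x hx
    rw [hx]; ring
  have h3 : ∫ x, 𝓕 (Φ : V → ℂ) x * f (x + h) = ∫ x, 𝓕 (Ψ : V → ℂ) x * f x := by
    rw [← integral_add_right_eq_self (fun x => 𝓕 (Ψ : V → ℂ) x * f x) h]
    refine integral_congr_ae (ae_of_all _ fun x => ?_)
    simp only
    congr 1
    rw [fourier_eq_integral_planeWave, fourier_eq_integral_planeWave]
    refine integral_congr_ae (ae_of_all _ fun y => ?_)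
    simp only [hΦv, hΨv, ← mul_assoc]
    congr 1
    simp only [planeWave_eq, ← Complex.exp_add, inner_neg_left, inner_add_left]
    congr 1; push_cast; ring
  rw [h2, h3, ← integral_mul_fourier_Lp, ← integral_mul_fourier_Lp, ← integral_sub (hint Ψ hFl) (hint Φ hFl)]
  refine integral_congr_ae (ae_of_all _ fun x => ?_)
  simp only [hΦv, hΨv]; ring

lemma lintegral_enorm_sq_Lp (f : Lp ℂ 2 (volume : Measure V)) :
    ∫⁻ x, ‖f x‖ₑ ^ 2 = ‖f‖ₑ ^ 2 := by
  rw [Lp.enorm_def, eLpNorm_eq_lintegral_rpow_enorm_toReal (by simp) (by simp)]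
  simp only [ENNReal.toReal_ofNat, ENNReal.rpow_ofNat]
  rw [← ENNReal.rpow_natCast, ← ENNReal.rpow_mul]; simp

lemma lintegral_enorm_sq_fourier (f : Lp ℂ 2 (volume : Measure V)) :
    ∫⁻ ξ, ‖(𝓕 f : Lp ℂ 2 (volume : Measure V)) ξ‖ₑ ^ 2 = ∫⁻ x, ‖f x‖ₑ ^ 2 := by
  rw [lintegral_enorm_sq_Lp, lintegral_enorm_sq_Lp, ← ofReal_norm, ← ofReal_norm,
    Lp.norm_fourier_eq]

lemma lintegral_translate_sub (f : Lp ℂ 2 (volume : Measure V)) (h : V) :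
    ∫⁻ x, ‖f (x + h) - f x‖ₑ ^ 2 =
      ∫⁻ ξ, ‖planeWave h ξ - 1‖ₑ ^ 2 * ‖(𝓕 f : Lp ℂ 2 (volume : Measure V)) ξ‖ₑ ^ 2 := by
  have h1 := lintegral_enorm_sq_fourier ((memLp_translate_sub f h).toLp _)
  have h2 : ∫⁻ x, ‖((memLp_translate_sub f h).toLp _ : Lp ℂ 2 volume) x‖ₑ ^ 2 =
      ∫⁻ x, ‖f (x + h) - f x‖ₑ ^ 2 := by
    refine lintegral_congr_ae ?_
    filter_upwards [(memLp_translate_sub f h).coeFn_toLp] with x hx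
    rw [hx]
  rw [← h2, ← h1]
  refine lintegral_congr_ae ?_
  filter_upwards [fourier_translate_sub f h] with x hx
  rw [hx, enorm_mul, mul_pow]

end PlaneWaves

/-! ### The Slobodeckij seminorm of order 1/2 has symbol c|ξ|. -/

section SlobodeckijSymbol

open FourierTransform SchwartzMap

variable {V : Type*} [NormedAddCommGroup V] [InnerProductSpace ℝ V] [FiniteDimensional ℝ V]
  [MeasurableSpace V] [BorelSpace V]

instance : IsFiniteMeasure (sphereMeasure V) := by
  unfold sphereMeasure; infer_instance

/-- Radial integrals. -/
lemma lintegral_radial [Nontrivial V] {k : ℝ → ℝ≥0∞} (hk : Measurable k) :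
    ∫⁻ x : V, k ‖x‖ = sphereMeasure V univ *
      ∫⁻ r in Ioi (0 : ℝ), ENNReal.ofReal (r ^ (Module.finrank ℝ V - 1)) * k r := by
  rw [lintegral_polar (f := fun x : V => k ‖x‖) (hk.comp measurable_norm), mul_comm, ← lintegral_const]
  refine lintegral_congr_ae ?_
  filter_upwards [ae_norm_eq_one_sphereMeasure] with ξ hξ
  refine setLIntegral_congr_fun measurableSet_Ioi fun r hr => ?_
  simp only [norm_smul, hξ, Real.norm_of_nonneg (le_of_lt (mem_Ioi.1 hr)), mul_one]

/-- The mass of the kernel `min 1 |h|² / |h|^{n+1}`. -/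
def truncatedKernelMass (V : Type*) [NormedAddCommGroup V] [InnerProductSpace ℝ V]
    [FiniteDimensional ℝ V] [MeasurableSpace V] [BorelSpace V] : ℝ≥0∞ :=
  ∫⁻ h : V, ENNReal.ofReal (min 1 (‖h‖ ^ 2)) / ‖h‖ₑ ^ (Module.finrank ℝ V + 1)

/-- In polar coordinates the radial density is min(1, r²)/r², bounded near 0 and integrable at
infinity. -/
lemma truncatedKernelMass_ne_top [Nontrivial V] : truncatedKernelMass V ≠ ⊤ := by
  have hn : 0 < Module.finrank ℝ V := Module.finrank_pos
  have h1 := lintegral_radial (V := V) (k := fun r =>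
    ENNReal.ofReal (min 1 (r ^ 2)) / ENNReal.ofReal r ^ (Module.finrank ℝ V + 1)) (by fun_prop)
  simp only [ofReal_norm] at h1
  rw [truncatedKernelMass, h1]
  refine ENNReal.mul_ne_top (measure_ne_top _ _) ?_
  have h2 : ∀ r ∈ Ioi (0 : ℝ), ENNReal.ofReal (r ^ (Module.finrank ℝ V - 1)) *
      (ENNReal.ofReal (min 1 (r ^ 2)) / ENNReal.ofReal r ^ (Module.finrank ℝ V + 1)) =
      ENNReal.ofReal (min 1 (r ^ 2) / r ^ 2) := by
    intro r hr
    have hr : 0 < r := hr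
    rw [← ENNReal.ofReal_pow hr.le, ← ENNReal.ofReal_div_of_pos (by positivity),
      ← ENNReal.ofReal_mul (by positivity)]
    congr 1
    have : r ^ (Module.finrank ℝ V + 1) = r ^ (Module.finrank ℝ V - 1) * r ^ 2 := by
      rw [← pow_add]; congr 1; omega
    rw [this]; field_simp
  rw [setLIntegral_congr_fun measurableSet_Ioi h2, ← Ioc_union_Ioi_eq_Ioi zero_le_one,
    lintegral_union measurableSet_Ioi Ioc_disjoint_Ioi_same]
  refine ENNReal.add_ne_top.2 ⟨?_, ?_⟩
  · refine ne_top_of_le_ne_top (b := ∫⁻ r in Ioc (0 : ℝ) 1, 1) (by simp) ?_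
    refine setLIntegral_mono measurable_const fun r hr => ?_
    rw [ENNReal.ofReal_le_one, div_le_one (pow_pos hr.1 2)]
    exact min_le_right _ _
  · have h3 := (integrableOn_Ioi_rpow_of_lt (a := -2) (by norm_num) zero_lt_one).lintegral_lt_top
    refine ne_top_of_le_ne_top h3.ne ?_
    refine setLIntegral_mono (by fun_prop) fun r hr => ENNReal.ofReal_le_ofReal ?_
    have hr : 1 < r := hr
    rw [Real.rpow_neg (by linarith), ← one_div, Real.rpow_ofNat]
    gcongr
    exact min_le_left _ _

/-- The Fourier symbol of the Slobodeckij seminorm. -/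
def slobodeckijSymbol (ξ : V) : ℝ≥0∞ :=
  ∫⁻ h : V, ‖planeWave h ξ - 1‖ₑ ^ 2 / ‖h‖ₑ ^ (Module.finrank ℝ V + 1)

lemma enorm_sq_eq_ofReal (z : ℂ) : ‖z‖ₑ ^ 2 = ENNReal.ofReal (‖z‖ ^ 2) := by
  rw [← ofReal_norm, ENNReal.ofReal_pow (norm_nonneg _)]

lemma norm_planeWave_sub_one_sq_le (h ξ : V) (hξ : ‖ξ‖ ≤ 1) :
    ‖planeWave h ξ - 1‖ ^ 2 ≤ (4 * Real.pi ^ 2) * min 1 (‖h‖ ^ 2) := by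
  have hpi := Real.pi_gt_three
  have h1 : ‖planeWave h ξ - 1‖ ≤ 2 := by
    refine (norm_sub_le _ _).trans ?_
    rw [norm_planeWave]; norm_num
  have h2 : ‖planeWave h ξ - 1‖ ≤ 2 * Real.pi * ‖h‖ := by
    have h3 : planeWave h ξ = Complex.exp (Complex.I * ((2 * Real.pi * inner ℝ h ξ : ℝ) : ℂ)) := by
      rw [planeWave_eq]; congr 1; push_cast; ring
    rw [h3]
    refine (Real.norm_exp_I_mul_ofReal_sub_one_le).trans ?_
    rw [norm_mul, Real.norm_of_nonneg (by positivity)]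
    gcongr
    refine (norm_inner_le_norm h ξ).trans ?_
    nlinarith [norm_nonneg h]
  rw [mul_min_of_nonneg _ _ (by positivity), le_min_iff]
  have h0 := norm_nonneg (planeWave h ξ - 1)
  constructor <;> nlinarith [norm_nonneg h]

lemma measurable_planeWave_left (ξ : V) : Measurable fun h : V => planeWave h ξ :=
  (continuous_planeWave.comp (by fun_prop : Continuous fun h : V => (h, ξ))).measurable

lemma measurable_slobodeckijSymbol_integrand (ξ : V) : Measurable fun h : V =>
    ‖planeWave h ξ - 1‖ₑ ^ 2 / ‖h‖ₑ ^ (Module.finrank ℝ V + 1) := by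
  have := measurable_planeWave_left ξ
  fun_prop

lemma slobodeckijSymbol_ne_top [Nontrivial V] {ξ : V} (hξ : ‖ξ‖ ≤ 1) : slobodeckijSymbol ξ ≠ ⊤ := by
  refine ne_top_of_le_ne_top (b := ENNReal.ofReal (4 * Real.pi ^ 2) * truncatedKernelMass V)
    (ENNReal.mul_ne_top ENNReal.ofReal_ne_top truncatedKernelMass_ne_top) ?_
  rw [truncatedKernelMass, ← lintegral_const_mul _ (by fun_prop)]
  refine lintegral_mono fun h => ?_
  simp only
  rw [← mul_div_assoc, ← ENNReal.ofReal_mul (by positivity), enorm_sq_eq_ofReal]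
  gcongr
  exact norm_planeWave_sub_one_sq_le h ξ hξ

lemma slobodeckijSymbol_ne_zero {ξ : V} (hξ : ξ ≠ 0) : slobodeckijSymbol ξ ≠ 0 := by
  intro h0
  rw [slobodeckijSymbol, lintegral_eq_zero_iff (measurable_slobodeckijSymbol_integrand ξ)] at h0
  -- If the symbol vanished, ⟨h,ξ⟩ would be an integer for almost every h, but the open slab 0 <
  -- ⟨h,ξ⟩ < 1 has positive measure.
  have hopen : IsOpen {h : V | 0 < inner ℝ h ξ ∧ inner ℝ h ξ < 1} :=
    IsOpen.and (isOpen_lt continuous_const (by fun_prop)) (isOpen_lt (by fun_prop) continuous_const)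
  have hpos : 0 < ‖ξ‖ ^ 2 := by positivity
  have hne : {h : V | 0 < inner ℝ h ξ ∧ inner ℝ h ξ < 1}.Nonempty := by
    refine ⟨(1 / (2 * ‖ξ‖ ^ 2)) • ξ, ?_⟩
    have : inner ℝ ((1 / (2 * ‖ξ‖ ^ 2)) • ξ) ξ = 1 / 2 := by
      rw [real_inner_smul_left, real_inner_self_eq_norm_sq]; field_simp
    rw [mem_ofPred_eq, this]; norm_num
  have hm := hopen.measure_pos (volume : Measure V) hne
  have h1 : ∀ᵐ h : V, ¬ (0 < inner ℝ h ξ ∧ inner ℝ h ξ < 1) := by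
    filter_upwards [h0] with h hh ⟨hh1, hh2⟩
    simp only [Pi.zero_apply, ENNReal.div_eq_zero_iff, pow_eq_zero_iff two_ne_zero, enorm_eq_zero,
      ENNReal.pow_eq_top_iff, enorm_ne_top, false_and, or_false] at hh
    rw [sub_eq_zero, planeWave_eq, Complex.exp_eq_one_iff] at hh
    obtain ⟨n, hn⟩ := hh
    have hπ : (2 * Real.pi * Complex.I : ℂ) ≠ 0 := Complex.two_pi_I_ne_zero
    have h2 : ((inner ℝ h ξ : ℝ) : ℂ) = ((n : ℝ) : ℂ) := by
      apply mul_right_cancel₀ hπ; push_cast; rw [← hn]; ring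
    have h3 : inner ℝ h ξ = (n : ℝ) := by exact_mod_cast h2
    rw [h3] at hh1 hh2
    have : 0 < n := by exact_mod_cast hh1
    have : n < 1 := by exact_mod_cast hh2
    omega
  rw [ae_iff] at h1
  simp only [not_not] at h1
  exact hm.ne' h1

lemma slobodeckijSymbol_isometry (A : V ≃ₗᵢ[ℝ] V) (ξ : V) :
    slobodeckijSymbol (A ξ) = slobodeckijSymbol ξ := by
  unfold slobodeckijSymbol
  rw [← A.measurePreserving.lintegral_comp (measurable_slobodeckijSymbol_integrand (A ξ))]
  refine lintegral_congr fun h => ?_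
  have : planeWave (A h) (A ξ) = planeWave h ξ := by
    rw [planeWave_eq, planeWave_eq, A.inner_map_map]
  rw [this, A.enorm_map]

lemma slobodeckijSymbol_smul {t : ℝ} (ht : 0 < t) (ξ : V) :
    slobodeckijSymbol (t • ξ) = ENNReal.ofReal t * slobodeckijSymbol ξ := by
  unfold slobodeckijSymbol
  set n := Module.finrank ℝ V with hn
  rw [lintegral_comp_smul_pos (measurable_slobodeckijSymbol_integrand ξ) ht, ← mul_assoc,
    ← ENNReal.ofReal_mul ht.le, ← pow_succ', ← lintegral_const_mul]
  swap
  · exact (measurable_slobodeckijSymbol_integrand ξ).comp (measurable_const_smul t)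
  refine lintegral_congr fun h => ?_
  have h1 : planeWave (t • h) ξ = planeWave h (t • ξ) := by
    rw [planeWave_eq, planeWave_eq, real_inner_smul_left, real_inner_smul_right]
  have h2 : ‖t • h‖ₑ = ENNReal.ofReal t * ‖h‖ₑ := by
    rw [enorm_smul, Real.enorm_of_nonneg ht.le]
  rw [h1, h2, ENNReal.ofReal_pow ht.le, mul_pow]
  have h3 : ENNReal.ofReal t ^ (n + 1) ≠ 0 := by simp [ht]
  rw [← mul_div_assoc, ENNReal.mul_div_mul_left _ _ h3 (by finiteness)]

lemma slobodeckijSymbol_zero : slobodeckijSymbol (0 : V) = 0 := by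
  simp [slobodeckijSymbol, planeWave_eq]

/-- The symbol is invariant under isometries and homogeneous of degree one, so it is determined by
its value at one unit vector, which is finite and nonzero. -/
lemma exists_slobodeckijSymbol_eq (V : Type*) [NormedAddCommGroup V] [InnerProductSpace ℝ V]
    [FiniteDimensional ℝ V] [MeasurableSpace V] [BorelSpace V] [Nontrivial V] : ∃ c : ℝ≥0∞, c ≠ 0 ∧ c ≠ ⊤ ∧
    ∀ ξ : V, slobodeckijSymbol ξ = c * ‖ξ‖ₑ := by
  obtain ⟨v, hv⟩ := exists_ne (0 : V)
  obtain ⟨e, he⟩ : ∃ e : V, ‖e‖ = 1 := ⟨‖v‖⁻¹ • v, norm_smul_inv_norm (𝕜 := ℝ) hv⟩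
  refine ⟨slobodeckijSymbol e, slobodeckijSymbol_ne_zero (by rintro rfl; simp at he),
    slobodeckijSymbol_ne_top he.le, fun ξ => ?_⟩
  rcases eq_or_ne ξ 0 with rfl | hξ
  · simp [slobodeckijSymbol_zero]
  have hξ' : 0 < ‖ξ‖ := norm_pos_iff.2 hξ
  have h1 : ‖e‖ = ‖‖ξ‖⁻¹ • ξ‖ := he.trans (norm_smul_inv_norm (𝕜 := ℝ) hξ).symm
  -- The reflection exchanging the unit vectors e and ξ/|ξ| replaces a rotation.
  have h2 := slobodeckijSymbol_isometry (Submodule.reflection (ℝ ∙ (e - ‖ξ‖⁻¹ • ξ))ᗮ) e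
  rw [Submodule.reflection_sub h1] at h2
  have h3 := slobodeckijSymbol_smul hξ' (‖ξ‖⁻¹ • ξ)
  rw [smul_smul, mul_inv_cancel₀ hξ'.ne', one_smul] at h3
  rw [h3, h2, ofReal_norm, mul_comm]

end SlobodeckijSymbol

/-! ### H^{1/2} norms and multipliers. -/

section SobolevNorms

open FourierTransform SchwartzMap

variable {V : Type*} [NormedAddCommGroup V] [InnerProductSpace ℝ V] [FiniteDimensional ℝ V]
  [MeasurableSpace V] [BorelSpace V]

/-- The squared Slobodeckij seminorm of order `1/2`. -/
def slobodeckij (φ : V → ℂ) : ℝ≥0∞ :=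
  ∫⁻ x, ∫⁻ y, ‖φ x - φ y‖ₑ ^ 2 / ‖x - y‖ₑ ^ (Module.finrank ℝ V + 1)

/-- The squared norm of `H^{1/2}` on the whole space, in physical space. -/
def halfNormSq (φ : V → ℂ) : ℝ≥0∞ := (∫⁻ x, ‖φ x‖ₑ ^ 2) + slobodeckij φ

lemma slobodeckij_congr {φ ψ : V → ℂ} (h : φ =ᵐ[volume] ψ) : slobodeckij φ = slobodeckij ψ := by
  refine lintegral_congr_ae ?_
  filter_upwards [h] with x hx
  refine lintegral_congr_ae ?_
  filter_upwards [h] with y hy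
  rw [hx, hy]

lemma halfNormSq_congr {φ ψ : V → ℂ} (h : φ =ᵐ[volume] ψ) : halfNormSq φ = halfNormSq ψ := by
  rw [halfNormSq, halfNormSq, slobodeckij_congr h]
  congr 1
  refine lintegral_congr_ae ?_
  filter_upwards [h] with x hx
  rw [hx]

lemma slobodeckij_eq_translate {φ : V → ℂ} (hφ : Measurable φ) :
    slobodeckij φ = ∫⁻ h : V, (∫⁻ x, ‖φ (x + h) - φ x‖ₑ ^ 2) / ‖h‖ₑ ^ (Module.finrank ℝ V + 1) := by
  unfold slobodeckij
  have h1 : ∀ x, ∫⁻ y, ‖φ x - φ y‖ₑ ^ 2 / ‖x - y‖ₑ ^ (Module.finrank ℝ V + 1) =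
      ∫⁻ h, ‖φ (x + h) - φ x‖ₑ ^ 2 / ‖h‖ₑ ^ (Module.finrank ℝ V + 1) := by
    intro x
    rw [← lintegral_add_left_eq_self _ x]
    refine lintegral_congr fun h => ?_
    rw [enorm_sub_rev, enorm_sub_rev x]; simp
  simp only [h1]
  rw [lintegral_lintegral_swap]
  · refine lintegral_congr fun h => ?_
    simp only [div_eq_mul_inv]
    rw [lintegral_mul_const]
    fun_prop
  · refine Measurable.aemeasurable ?_
    simp only [Function.uncurry_def]
    fun_prop

/-- `∫ (1 + |ξ|) |φ̂(ξ)|² dξ`. -/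
def fourierHalfNormSq (f : Lp ℂ 2 (volume : Measure V)) : ℝ≥0∞ :=
  ∫⁻ ξ, ‖(𝓕 f : Lp ℂ 2 (volume : Measure V)) ξ‖ₑ ^ 2 * (1 + ‖ξ‖ₑ)

/-- `∫ (1 + |ξ|)⁻¹ |φ̂(ξ)|² dξ`. -/
def fourierNegHalfNormSq (f : Lp ℂ 2 (volume : Measure V)) : ℝ≥0∞ :=
  ∫⁻ ξ, ‖(𝓕 f : Lp ℂ 2 (volume : Measure V)) ξ‖ₑ ^ 2 / (1 + ‖ξ‖ₑ)

lemma measurable_Lp (f : Lp ℂ 2 (volume : Measure V)) : Measurable f :=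
  (Lp.stronglyMeasurable f).measurable

lemma slobodeckij_eq_symbol (f : Lp ℂ 2 (volume : Measure V)) :
    slobodeckij f = ∫⁻ ξ, slobodeckijSymbol ξ * ‖(𝓕 f : Lp ℂ 2 (volume : Measure V)) ξ‖ₑ ^ 2 := by
  have hm := measurable_Lp (𝓕 f : Lp ℂ 2 (volume : Measure V))
  have hw := (continuous_planeWave (V := V)).measurable
  rw [slobodeckij_eq_translate (measurable_Lp f)]
  simp only [lintegral_translate_sub, div_eq_mul_inv]
  have h1 : ∀ h : V, (∫⁻ ξ, ‖planeWave h ξ - 1‖ₑ ^ 2 *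
      ‖(𝓕 f : Lp ℂ 2 (volume : Measure V)) ξ‖ₑ ^ 2) * (‖h‖ₑ ^ (Module.finrank ℝ V + 1))⁻¹ =
      ∫⁻ ξ, ‖planeWave h ξ - 1‖ₑ ^ 2 / ‖h‖ₑ ^ (Module.finrank ℝ V + 1) *
        ‖(𝓕 f : Lp ℂ 2 (volume : Measure V)) ξ‖ₑ ^ 2 := by
    intro h
    rw [← lintegral_mul_const]
    · refine lintegral_congr fun ξ => ?_
      rw [div_eq_mul_inv]; ring
    · have := (hw.comp (measurable_prodMk_left (x := h)))
      simp only [Function.comp_def] at this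
      fun_prop
  simp only [h1]
  rw [lintegral_lintegral_swap]
  · refine lintegral_congr fun ξ => ?_
    rw [lintegral_mul_const _ (measurable_slobodeckijSymbol_integrand ξ), slobodeckijSymbol]
  · refine Measurable.aemeasurable ?_
    simp only [Function.uncurry_def]
    fun_prop

/-- The physical and the Fourier `H^{1/2}` norms are equivalent. -/
lemma exists_halfNormSq_equiv (V : Type*) [NormedAddCommGroup V] [InnerProductSpace ℝ V]
    [FiniteDimensional ℝ V] [MeasurableSpace V] [BorelSpace V] [Nontrivial V] :
    ∃ K : ℝ≥0∞, K ≠ ⊤ ∧ ∀ f : Lp ℂ 2 (volume : Measure V),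
      fourierHalfNormSq f ≤ K * halfNormSq f ∧ halfNormSq f ≤ K * fourierHalfNormSq f := by
  obtain ⟨c, hc0, hct, hc⟩ := exists_slobodeckijSymbol_eq V
  refine ⟨1 + c + c⁻¹, by finiteness, fun f => ?_⟩
  have hm := measurable_Lp (𝓕 f : Lp ℂ 2 (volume : Measure V))
  set N := ∫⁻ ξ, ‖(𝓕 f : Lp ℂ 2 (volume : Measure V)) ξ‖ₑ ^ 2 with hN
  set S := ∫⁻ ξ, ‖(𝓕 f : Lp ℂ 2 (volume : Measure V)) ξ‖ₑ ^ 2 * ‖ξ‖ₑ with hS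
  have h1 : fourierHalfNormSq f = N + S := by
    rw [fourierHalfNormSq, hN, hS, ← lintegral_add_left (by fun_prop)]
    refine lintegral_congr fun ξ => by ring
  have h2 : halfNormSq f = N + c * S := by
    rw [halfNormSq, hN, lintegral_enorm_sq_fourier, slobodeckij_eq_symbol, hS,
      ← lintegral_const_mul _ (by fun_prop)]
    congr 1
    refine lintegral_congr fun ξ => ?_
    rw [hc]; ring
  rw [h1, h2]
  constructor
  · calc N + S = N + c⁻¹ * (c * S) := by rw [← mul_assoc, ENNReal.inv_mul_cancel hc0 hct, one_mul]
      _ ≤ (1 + c + c⁻¹) * N + (1 + c + c⁻¹) * (c * S) := by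
        gcongr
        · exact le_mul_of_one_le_left' (by rw [add_assoc]; exact le_self_add)
        · exact le_add_self
      _ = _ := by ring
  · calc N + c * S ≤ (1 + c + c⁻¹) * N + (1 + c + c⁻¹) * S := by
          gcongr
          · exact le_mul_of_one_le_left' (by rw [add_assoc]; exact le_self_add)
          · rw [add_right_comm]; exact le_add_self
      _ = _ := by ring

section Multiplier

variable {ι : Type*} [Fintype ι]

lemma norm_sum_mul_sq_le (a b : ι → ℂ) :
    ‖∑ j, a j * b j‖ ^ 2 ≤ (∑ j, ‖a j‖ ^ 2) * ∑ j, ‖b j‖ ^ 2 := by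
  refine le_trans ?_ (Finset.sum_mul_sq_le_sq_mul_sq _ _ _)
  gcongr
  refine (norm_sum_le _ _).trans (Finset.sum_le_sum fun j _ => ?_)
  rw [norm_mul]

/-- Product rule ab − a'b' = a(b − b') + (a − a')b', with Cauchy–Schwarz over the index. Keeping
sums of squares makes the constants independent of the number of indices, which is d^k in the
application. -/
lemma norm_sub_mul_sq_le (a a' b b' : ι → ℂ) :
    ‖∑ j, a j * b j - ∑ j, a' j * b' j‖ ^ 2 ≤
      2 * ((∑ j, ‖a j‖ ^ 2) * ∑ j, ‖b j - b' j‖ ^ 2) +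
        2 * ((∑ j, ‖a j - a' j‖ ^ 2) * ∑ j, ‖b' j‖ ^ 2) := by
  have h : ∑ j, a j * b j - ∑ j, a' j * b' j =
      ∑ j, a j * (b j - b' j) + ∑ j, (a j - a' j) * b' j := by
    rw [← Finset.sum_sub_distrib, ← Finset.sum_add_distrib]
    exact Finset.sum_congr rfl fun j _ => by ring
  have h1 := norm_sum_mul_sq_le a (fun j => b j - b' j)
  have h2 := norm_sum_mul_sq_le (fun j => a j - a' j) b'
  rw [h]
  have h3 := norm_add_le (∑ j, a j * (b j - b' j)) (∑ j, (a j - a' j) * b' j)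
  have h4 := norm_nonneg (∑ j, a j * (b j - b' j) + ∑ j, (a j - a' j) * b' j)
  nlinarith [sq_nonneg (‖∑ j, a j * (b j - b' j)‖ - ‖∑ j, (a j - a' j) * b' j‖)]

/-- Bounded Lipschitz functions are multipliers of `H^{1/2}`. -/
lemma halfNormSq_sum_mul_le {A L : ℝ} {a φ : ι → V → ℂ} (hφ : ∀ j, Measurable (φ j))
    (hA : ∀ x, ∑ j, ‖a j x‖ ^ 2 ≤ A ^ 2)
    (hL : ∀ x y, ∑ j, ‖a j x - a j y‖ ^ 2 ≤ L ^ 2 * ‖x - y‖ ^ 2) :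
    halfNormSq (fun x => ∑ j, a j x * φ j x) ≤
      (2 + 8 * truncatedKernelMass V) * ENNReal.ofReal (A ^ 2 + L ^ 2) * ∑ j, halfNormSq (φ j) := by
  set M := truncatedKernelMass V with hM
  set n := Module.finrank ℝ V with hn
  set B := ENNReal.ofReal (A ^ 2 + L ^ 2) with hB
  have hsum : ∀ b : ι → ℂ, ENNReal.ofReal (∑ j, ‖b j‖ ^ 2) = ∑ j, ‖b j‖ₑ ^ 2 := by
    intro b
    rw [ENNReal.ofReal_sum_of_nonneg fun j _ => by positivity]
    simp only [enorm_sq_eq_ofReal]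
  have hN : ∫⁻ x, ‖∑ j, a j x * φ j x‖ₑ ^ 2 ≤ B * ∑ j, ∫⁻ x, ‖φ j x‖ₑ ^ 2 := by
    rw [← lintegral_finsetSum _ (fun j _ => by fun_prop),
      ← lintegral_const_mul _ (by fun_prop)]
    refine lintegral_mono fun x => ?_
    simp only
    rw [enorm_sq_eq_ofReal, ← hsum, hB, ← ENNReal.ofReal_mul (by positivity)]
    refine ENNReal.ofReal_le_ofReal ((norm_sum_mul_sq_le _ _).trans ?_)
    gcongr
    exact (hA x).trans (by nlinarith [sq_nonneg L])
  -- Boundedness serves for distant points and the Lipschitz bound for close ones. The minimum of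
  -- the two is integrable against the kernel, with total mass M.
  have hdiff : ∀ x y, ∑ j, ‖a j x - a j y‖ ^ 2 ≤ 4 * (A ^ 2 + L ^ 2) * min 1 (‖x - y‖ ^ 2) := by
    intro x y
    have h1 : ∑ j, ‖a j x - a j y‖ ^ 2 ≤ 4 * A ^ 2 := by
      have h2 : ∀ j, ‖a j x - a j y‖ ^ 2 ≤ 2 * ‖a j x‖ ^ 2 + 2 * ‖a j y‖ ^ 2 := fun j => by
        have := norm_sub_le (a j x) (a j y)
        nlinarith [sq_nonneg (‖a j x‖ - ‖a j y‖), norm_nonneg (a j x - a j y)]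
      have h3 := Finset.sum_le_sum fun j (_ : j ∈ Finset.univ) => h2 j
      rw [Finset.sum_add_distrib, ← Finset.mul_sum, ← Finset.mul_sum] at h3
      linarith [hA x, hA y]
    rw [mul_min_of_nonneg _ _ (by positivity), le_min_iff]
    refine ⟨h1.trans (by nlinarith [sq_nonneg L]), (hL x y).trans ?_⟩
    gcongr
    nlinarith [sq_nonneg L, sq_nonneg A]
  have hS : slobodeckij (fun x => ∑ j, a j x * φ j x) ≤
      2 * B * ∑ j, slobodeckij (φ j) + 8 * B * M * ∑ j, ∫⁻ x, ‖φ j x‖ₑ ^ 2 := by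
    have hpt : ∀ x y, ‖∑ j, a j x * φ j x - ∑ j, a j y * φ j y‖ₑ ^ 2 / ‖x - y‖ₑ ^ (n + 1) ≤
        2 * B * ∑ j, ‖φ j x - φ j y‖ₑ ^ 2 / ‖x - y‖ₑ ^ (n + 1) +
        8 * B * ((ENNReal.ofReal (min 1 (‖x - y‖ ^ 2)) / ‖x - y‖ₑ ^ (n + 1)) *
          ∑ j, ‖φ j y‖ₑ ^ 2) := by
      intro x y
      have h1 : ‖∑ j, a j x * φ j x - ∑ j, a j y * φ j y‖ₑ ^ 2 ≤
          2 * B * ∑ j, ‖φ j x - φ j y‖ₑ ^ 2 +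
          8 * B * (ENNReal.ofReal (min 1 (‖x - y‖ ^ 2)) * ∑ j, ‖φ j y‖ₑ ^ 2) := by
        have e2 : (2 : ℝ≥0∞) = ENNReal.ofReal 2 := by simp
        have e8 : (8 : ℝ≥0∞) = ENNReal.ofReal 8 := by simp
        rw [enorm_sq_eq_ofReal, ← hsum, ← hsum, hB, e2, e8, ← ENNReal.ofReal_mul (by positivity),
          ← ENNReal.ofReal_mul (by positivity), ← ENNReal.ofReal_mul (by positivity),
          ← ENNReal.ofReal_mul (by positivity), ← ENNReal.ofReal_mul (by positivity),
          ← ENNReal.ofReal_add (by positivity) (by positivity)]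
        refine ENNReal.ofReal_le_ofReal ((norm_sub_mul_sq_le _ _ _ _).trans ?_)
        have h2 : (∑ j, ‖a j x‖ ^ 2) * ∑ j, ‖φ j x - φ j y‖ ^ 2 ≤
            (A ^ 2 + L ^ 2) * ∑ j, ‖φ j x - φ j y‖ ^ 2 := by
          gcongr
          exact (hA x).trans (by nlinarith [sq_nonneg L])
        have h3 : (∑ j, ‖a j x - a j y‖ ^ 2) * ∑ j, ‖φ j y‖ ^ 2 ≤
            (4 * (A ^ 2 + L ^ 2) * min 1 (‖x - y‖ ^ 2)) * ∑ j, ‖φ j y‖ ^ 2 := by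
          gcongr
          exact hdiff x y
        linarith
      refine (ENNReal.div_le_div_right h1 _).trans (le_of_eq ?_)
      simp only [div_eq_mul_inv, ← Finset.sum_mul]
      ring
    calc slobodeckij (fun x => ∑ j, a j x * φ j x)
        ≤ ∫⁻ x, ∫⁻ y, (2 * B * ∑ j, ‖φ j x - φ j y‖ₑ ^ 2 / ‖x - y‖ₑ ^ (n + 1) +
          8 * B * ((ENNReal.ofReal (min 1 (‖x - y‖ ^ 2)) / ‖x - y‖ₑ ^ (n + 1)) *
            ∑ j, ‖φ j y‖ₑ ^ 2)) := lintegral_mono fun x => lintegral_mono fun y => hpt x y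
      _ = ∫⁻ x, (2 * B * ∑ j, (∫⁻ y, ‖φ j x - φ j y‖ₑ ^ 2 / ‖x - y‖ₑ ^ (n + 1)) +
          8 * B * ∫⁻ y, ((ENNReal.ofReal (min 1 (‖x - y‖ ^ 2)) / ‖x - y‖ₑ ^ (n + 1)) *
            ∑ j, ‖φ j y‖ₑ ^ 2)) := by
        refine lintegral_congr fun x => ?_
        rw [lintegral_add_left (by fun_prop), lintegral_const_mul _ (by fun_prop),
          lintegral_const_mul _ (by fun_prop), lintegral_finsetSum _ (fun j _ => by fun_prop)]
      _ = 2 * B * ∑ j, slobodeckij (φ j) + 8 * B * ∫⁻ x, ∫⁻ y,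
          ((ENNReal.ofReal (min 1 (‖x - y‖ ^ 2)) / ‖x - y‖ₑ ^ (n + 1)) *
            ∑ j, ‖φ j y‖ₑ ^ 2) := by
        have hm : ∀ j, Measurable fun x => ∫⁻ y, ‖φ j x - φ j y‖ₑ ^ 2 / ‖x - y‖ₑ ^ (n + 1) :=
          fun j => Measurable.lintegral_prod_right' (f := fun z : V × V =>
            ‖φ j z.1 - φ j z.2‖ₑ ^ 2 / ‖z.1 - z.2‖ₑ ^ (n + 1)) (by fun_prop)
        have hm2 : Measurable fun x => ∫⁻ y,
          ((ENNReal.ofReal (min 1 (‖x - y‖ ^ 2)) / ‖x - y‖ₑ ^ (n + 1)) *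
            ∑ j, ‖φ j y‖ₑ ^ 2) := Measurable.lintegral_prod_right' (f := fun z : V × V =>
            ((ENNReal.ofReal (min 1 (‖z.1 - z.2‖ ^ 2)) / ‖z.1 - z.2‖ₑ ^ (n + 1)) *
            ∑ j, ‖φ j z.2‖ₑ ^ 2)) (by fun_prop)
        rw [lintegral_add_left (by fun_prop), lintegral_const_mul _ (by fun_prop),
          lintegral_const_mul _ (by fun_prop), lintegral_finsetSum _ (fun j _ => by fun_prop)]
        rfl
      _ = 2 * B * ∑ j, slobodeckij (φ j) + 8 * B * M * ∑ j, ∫⁻ x, ‖φ j x‖ₑ ^ 2 := by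
        congr 1
        rw [mul_assoc (8 * B)]
        congr 1
        rw [lintegral_lintegral_swap]
        · rw [← lintegral_finsetSum _ (fun j _ => by fun_prop), ← lintegral_const_mul _ (by fun_prop)]
          refine lintegral_congr fun y => ?_
          rw [lintegral_mul_const _ (by fun_prop)]
          congr 1
          exact lintegral_sub_right_eq_self (μ := (volume : Measure V))
            (fun h => ENNReal.ofReal (min 1 (‖h‖ ^ 2)) / ‖h‖ₑ ^ (n + 1)) y
        · refine Measurable.aemeasurable ?_
          simp only [Function.uncurry_def]
          fun_prop
  simp only [halfNormSq, Finset.sum_add_distrib]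
  calc _ ≤ B * ∑ j, (∫⁻ x, ‖φ j x‖ₑ ^ 2) + (2 * B * ∑ j, slobodeckij (φ j) +
        8 * B * M * ∑ j, ∫⁻ x, ‖φ j x‖ₑ ^ 2) := add_le_add hN hS
    _ = (1 + 8 * M) * B * ∑ j, (∫⁻ x, ‖φ j x‖ₑ ^ 2) + 2 * B * ∑ j, slobodeckij (φ j) := by ring
    _ ≤ (2 + 8 * M) * B * ∑ j, (∫⁻ x, ‖φ j x‖ₑ ^ 2) + (2 + 8 * M) * B * ∑ j, slobodeckij (φ j) := by
        gcongr
        · exact one_le_two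
        · exact le_self_add
    _ = _ := by ring

end Multiplier

end SobolevNorms

/-! ### Duality of H^{1/2} and H^{-1/2}, multipliers of H^{-1/2}. -/

section Duality

open FourierTransform SchwartzMap

variable {V : Type*} [NormedAddCommGroup V] [InnerProductSpace ℝ V] [FiniteDimensional ℝ V]
  [MeasurableSpace V] [BorelSpace V]

lemma lintegral_mul_sq_le {α : Type*} [MeasurableSpace α] {μ : Measure α} {f g : α → ℝ≥0∞}
    (hf : AEMeasurable f μ) (hg : AEMeasurable g μ) :
    (∫⁻ x, f x * g x ∂μ) ^ 2 ≤ (∫⁻ x, f x ^ 2 ∂μ) * ∫⁻ x, g x ^ 2 ∂μ := by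
  have h := ENNReal.lintegral_mul_le_Lp_mul_Lq μ (Real.HolderConjugate.two_two) hf hg
  simp only [Pi.mul_apply, ENNReal.rpow_two] at h
  refine (pow_le_pow_left' h 2).trans (le_of_eq ?_)
  rw [mul_pow, ← ENNReal.rpow_natCast, ← ENNReal.rpow_natCast, ← ENNReal.rpow_mul,
    ← ENNReal.rpow_mul]
  simp

/-- Plancherel and Cauchy–Schwarz with the weights (1+|ξ|)^{±1/2}. -/
lemma enorm_inner_sq_le (ψ g : Lp ℂ 2 (volume : Measure V)) :
    ‖inner ℂ ψ g‖ₑ ^ 2 ≤ fourierNegHalfNormSq g * fourierHalfNormSq ψ := by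
  have hm := measurable_Lp (𝓕 g : Lp ℂ 2 (volume : Measure V))
  have hm' := measurable_Lp (𝓕 ψ : Lp ℂ 2 (volume : Measure V))
  set G := (𝓕 g : Lp ℂ 2 (volume : Measure V))
  set Ψ := (𝓕 ψ : Lp ℂ 2 (volume : Measure V))
  have h1 : ‖inner ℂ ψ g‖ₑ ≤ ∫⁻ ξ, (‖G ξ‖ₑ * ((1 + ‖ξ‖ₑ)⁻¹) ^ (1 / 2 : ℝ)) *
      (‖Ψ ξ‖ₑ * (1 + ‖ξ‖ₑ) ^ (1 / 2 : ℝ)) := by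
    rw [← Lp.inner_fourier_eq, L2.inner_def]
    refine (enorm_integral_le_lintegral_enorm _).trans (lintegral_mono fun ξ => ?_)
    have h2 : ((1 + ‖ξ‖ₑ)⁻¹) ^ (1 / 2 : ℝ) * (1 + ‖ξ‖ₑ) ^ (1 / 2 : ℝ) = 1 := by
      rw [← ENNReal.mul_rpow_of_nonneg _ _ (by norm_num),
        ENNReal.inv_mul_cancel (by simp) (by finiteness), ENNReal.one_rpow]
    calc ‖inner ℂ (Ψ ξ) (G ξ)‖ₑ ≤ ‖Ψ ξ‖ₑ * ‖G ξ‖ₑ := by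
          rw [← ofReal_norm, ← ofReal_norm, ← ofReal_norm, ← ENNReal.ofReal_mul (norm_nonneg _)]
          exact ENNReal.ofReal_le_ofReal (norm_inner_le_norm _ _)
      _ = ‖Ψ ξ‖ₑ * ‖G ξ‖ₑ * (((1 + ‖ξ‖ₑ)⁻¹) ^ (1 / 2 : ℝ) * (1 + ‖ξ‖ₑ) ^ (1 / 2 : ℝ)) := by
          rw [h2, mul_one]
      _ ≤ _ := le_of_eq (by ring)
  refine (pow_le_pow_left' h1 2).trans ((lintegral_mul_sq_le (by fun_prop) (by fun_prop)).trans ?_)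
  have h3 : ∀ x : ℝ≥0∞, (x ^ (1 / 2 : ℝ)) ^ 2 = x := fun x => by
    rw [← ENNReal.rpow_natCast, ← ENNReal.rpow_mul]; simp
  simp only [mul_pow, h3]
  simp only [fourierNegHalfNormSq, fourierHalfNormSq, div_eq_mul_inv]
  exact le_rfl

lemma fourierNegHalfNormSq_ne_top (g : Lp ℂ 2 (volume : Measure V)) :
    fourierNegHalfNormSq g ≠ ⊤ := by
  have h1 : ∫⁻ ξ, ‖(𝓕 g : Lp ℂ 2 (volume : Measure V)) ξ‖ₑ ^ 2 ≠ ⊤ := by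
    rw [lintegral_enorm_sq_Lp]; finiteness
  refine ne_top_of_le_ne_top h1 (lintegral_mono fun ξ => ?_)
  exact ENNReal.div_le_of_le_mul (le_mul_of_one_le_right' le_self_add)

/-- The `L²` function whose Fourier transform is `(1 + |ξ|)⁻¹ ĝ(ξ)`. -/
lemma exists_riesz (g : Lp ℂ 2 (volume : Measure V)) : ∃ φ : Lp ℂ 2 (volume : Measure V),
    fourierHalfNormSq φ = fourierNegHalfNormSq g ∧
      inner ℂ φ g = ((fourierNegHalfNormSq g).toReal : ℂ) := by
  set G := (𝓕 g : Lp ℂ 2 (volume : Measure V)) with hG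
  have hm := measurable_Lp G
  have hmem : MemLp (fun ξ => ((1 + ‖ξ‖)⁻¹ : ℝ) • G ξ) 2 := by
    refine MemLp.of_le (Lp.memLp G) (by fun_prop) (ae_of_all _ fun ξ => ?_)
    rw [norm_smul, Real.norm_of_nonneg (by positivity)]
    refine mul_le_of_le_one_left (norm_nonneg _) (inv_le_one_of_one_le₀ ?_)
    linarith [norm_nonneg ξ]
  have hF : (𝓕 (𝓕⁻ (hmem.toLp _) : Lp ℂ 2 (volume : Measure V)) : Lp ℂ 2 (volume : Measure V)) =
      hmem.toLp _ := FourierTransform.fourier_fourierInv_eq _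
  have hone : ∀ ξ : V, (1 : ℝ≥0∞) + ‖ξ‖ₑ = ENNReal.ofReal (1 + ‖ξ‖) := fun ξ => by
    rw [ENNReal.ofReal_add zero_le_one (norm_nonneg _), ofReal_norm, ENNReal.ofReal_one]
  refine ⟨𝓕⁻ (hmem.toLp _), ?_, ?_⟩
  · rw [fourierHalfNormSq, fourierNegHalfNormSq, hF]
    refine lintegral_congr_ae ?_
    filter_upwards [hmem.coeFn_toLp] with ξ hξ
    have hpos : 0 < 1 + ‖ξ‖ := by positivity
    rw [hξ, enorm_smul, hone, Real.enorm_of_nonneg (by positivity), mul_pow,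
      ENNReal.ofReal_inv_of_pos hpos, div_eq_mul_inv]
    set t := ENNReal.ofReal (1 + ‖ξ‖)
    have ht0 : t ≠ 0 := by simp [t, hpos]
    calc t⁻¹ ^ 2 * ‖G ξ‖ₑ ^ 2 * t = ‖G ξ‖ₑ ^ 2 * t⁻¹ * (t⁻¹ * t) := by ring
      _ = _ := by rw [ENNReal.inv_mul_cancel ht0 ENNReal.ofReal_ne_top, mul_one]
  · rw [← Lp.inner_fourier_eq, hF, L2.inner_def]
    have h1 : ∀ᵐ ξ : V, inner ℂ ((hmem.toLp _ : Lp ℂ 2 volume) ξ) (G ξ) =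
        (((1 + ‖ξ‖)⁻¹ * ‖G ξ‖ ^ 2 : ℝ) : ℂ) := by
      filter_upwards [hmem.coeFn_toLp] with ξ hξ
      rw [hξ, inner_smul_left_eq_smul, inner_self_eq_norm_sq_to_K, Complex.real_smul]
      push_cast; rfl
    rw [integral_congr_ae h1, integral_complex_ofReal, integral_eq_lintegral_of_nonneg_ae
      (ae_of_all _ fun ξ => by positivity) (by fun_prop)]
    congr 2
    refine lintegral_congr fun ξ => ?_
    have hpos : 0 < 1 + ‖ξ‖ := by positivity
    rw [ENNReal.ofReal_mul (by positivity), ENNReal.ofReal_inv_of_pos hpos, hone,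
      enorm_sq_eq_ofReal, mul_comm, div_eq_mul_inv]

/-- Bounded Lipschitz functions are multipliers of `H^{-1/2}`. -/
lemma exists_negHalfNorm_multiplier (V : Type*) [NormedAddCommGroup V] [InnerProductSpace ℝ V]
    [FiniteDimensional ℝ V] [MeasurableSpace V] [BorelSpace V] [Nontrivial V] :
    ∃ K : ℝ≥0∞, K ≠ ⊤ ∧ ∀ {ι : Type} [Fintype ι] (a : ι → V → ℂ) (A L : ℝ),
      (∀ j, Measurable (a j)) → (∀ x, ∑ j, ‖a j x‖ ^ 2 ≤ A ^ 2) →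
      (∀ x y, ∑ j, ‖a j x - a j y‖ ^ 2 ≤ L ^ 2 * ‖x - y‖ ^ 2) →
      ∀ (g : Lp ℂ 2 (volume : Measure V)) (G : ι → Lp ℂ 2 (volume : Measure V)),
        (∀ j, G j =ᵐ[volume] fun x => a j x * g x) →
        ∑ j, fourierNegHalfNormSq (G j) ≤
          K * ENNReal.ofReal (A ^ 2 + L ^ 2) * fourierNegHalfNormSq g := by
  obtain ⟨K, hK, hequiv⟩ := exists_halfNormSq_equiv V
  refine ⟨K * (2 + 8 * truncatedKernelMass V) * K, ?_, ?_⟩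
  · have := truncatedKernelMass_ne_top (V := V)
    finiteness
  intro ι _ a A L ham hA hL g G hG
  -- Let φ_j represent G_j = a_j g and let ψ be the sum of conj(a_j) φ_j. Then ⟨ψ, g⟩ is the sum of
  -- ⟨φ_j, G_j⟩, that is S. Duality and the H^{1/2} multiplier bound for ψ give S² ≤ C‖g‖²S, and S
  -- is finite, so one factor S cancels.
  choose φ hφ1 hφ2 using fun j => exists_riesz (G j)
  set S := ∑ j, fourierNegHalfNormSq (G j) with hS
  have hSt : S ≠ ⊤ := ENNReal.sum_ne_top.2 fun j _ => fourierNegHalfNormSq_ne_top _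
  have hbd : ∀ j x, ‖a j x‖ ≤ |A| := fun j x => by
    rw [← Real.sqrt_sq_eq_abs]
    refine Real.le_sqrt_of_sq_le ((Finset.single_le_sum (f := fun j => ‖a j x‖ ^ 2)
      (fun i _ => by positivity) (Finset.mem_univ j)).trans (hA x))
  have hterm : ∀ j, MemLp (fun x => (starRingEnd ℂ) (a j x) * φ j x) 2 := fun j => by
    refine MemLp.of_le_mul (Lp.memLp (φ j)) (c := |A|) ?_ (ae_of_all _ fun x => ?_)
    · exact ((Complex.continuous_conj.measurable.comp (ham j)).mul
        (measurable_Lp _)).aestronglyMeasurable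
    · rw [norm_mul, RCLike.norm_conj]
      gcongr
      exact hbd j x
  have hmem : MemLp (fun x => ∑ j, (starRingEnd ℂ) (a j x) * φ j x) 2 :=
    memLp_finsetSum _ fun j _ => hterm j
  set ψ := hmem.toLp _ with hψ
  have hinner : inner ℂ ψ g = (S.toReal : ℂ) := by
    have h1 : inner ℂ ψ g = ∑ j, inner ℂ (φ j) (G j) := by
      simp only [L2.inner_def]
      rw [← integral_finsetSum _ fun j _ => L2.integrable_inner _ _]
      refine integral_congr_ae ?_
      filter_upwards [hmem.coeFn_toLp, ae_all_iff.2 hG] with x hx hx2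
      rw [hx]
      simp only [hx2, RCLike.inner_apply, map_sum, map_mul, RCLike.conj_conj, Finset.mul_sum]
      exact Finset.sum_congr rfl fun j _ => by ring
    rw [h1, hS, ENNReal.toReal_sum fun j _ => fourierNegHalfNormSq_ne_top _]
    push_cast
    exact Finset.sum_congr rfl fun j _ => hφ2 j
  have h2 := enorm_inner_sq_le ψ g
  have h3 : ‖inner ℂ ψ g‖ₑ = S := by
    rw [hinner, ← ofReal_norm, Complex.norm_real, Real.norm_of_nonneg ENNReal.toReal_nonneg,
      ENNReal.ofReal_toReal hSt]
  rw [h3] at h2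
  have h4 : fourierHalfNormSq ψ ≤ K * ((2 + 8 * truncatedKernelMass V) *
      ENNReal.ofReal (A ^ 2 + L ^ 2) * (K * S)) := by
    refine (hequiv ψ).1.trans ?_
    gcongr
    rw [halfNormSq_congr hmem.coeFn_toLp]
    refine (halfNormSq_sum_mul_le (A := A) (L := L) (fun j => measurable_Lp _) ?_ ?_).trans ?_
    · simpa using hA
    · intro x y
      have : ∀ j, ‖(starRingEnd ℂ) (a j x) - (starRingEnd ℂ) (a j y)‖ = ‖a j x - a j y‖ := fun j => by
        rw [← map_sub, RCLike.norm_conj]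
      simpa only [this] using hL x y
    · gcongr
      rw [hS, Finset.mul_sum]
      refine Finset.sum_le_sum fun j _ => ?_
      rw [← hφ1 j]
      exact (hequiv (φ j)).2
  rcases eq_or_ne S 0 with h0 | h0
  · rw [h0]; exact zero_le
  have h5 : S * S ≤ S * (K * (2 + 8 * truncatedKernelMass V) * K * ENNReal.ofReal (A ^ 2 + L ^ 2) *
      fourierNegHalfNormSq g) := by
    calc S * S = S ^ 2 := by ring
      _ ≤ _ := h2
      _ ≤ fourierNegHalfNormSq g * (K * ((2 + 8 * truncatedKernelMass V) *
          ENNReal.ofReal (A ^ 2 + L ^ 2) * (K * S))) := by gcongr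
      _ = _ := by ring
  exact (ENNReal.mul_le_mul_iff_right h0 hSt).1 h5

end Duality

/-! ### Low frequencies of functions with bounded support. -/

section NegativeNorm

open FourierTransform SchwartzMap

variable {V : Type*} [NormedAddCommGroup V] [InnerProductSpace ℝ V] [FiniteDimensional ℝ V]
  [MeasurableSpace V] [BorelSpace V]

/-- The Jacobian r^{n-1} absorbs r⁻¹ once n ≥ 2. So a bounded Fourier transform is square integrable
against 1/|ξ| near the origin. -/
lemma lintegral_inv_enorm_closedBall_ne_top (hV : 2 ≤ Module.finrank ℝ V) :
    ∫⁻ ξ in closedBall (0 : V) 1, (‖ξ‖ₑ)⁻¹ ≠ ⊤ := by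
  have : Nontrivial V := Module.nontrivial_of_finrank_pos (R := ℝ) (by omega)
  have h1 := lintegral_radial (V := V) (k := (Iic (1 : ℝ)).indicator fun r => (ENNReal.ofReal r)⁻¹)
    (Measurable.indicator (by fun_prop) measurableSet_Iic)
  have h2 : ∫⁻ ξ in closedBall (0 : V) 1, (‖ξ‖ₑ)⁻¹ =
      ∫⁻ ξ : V, (Iic (1 : ℝ)).indicator (fun r => (ENNReal.ofReal r)⁻¹) ‖ξ‖ := by
    rw [← lintegral_indicator measurableSet_closedBall]
    refine lintegral_congr fun ξ => ?_
    simp only [indicator, mem_closedBall_zero_iff, mem_Iic, ofReal_norm]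
  rw [h2, h1]
  refine ENNReal.mul_ne_top (measure_ne_top _ _) ?_
  refine ne_top_of_le_ne_top (b := ∫⁻ r in Ioc (0 : ℝ) 1, 1) (by simp) ?_
  rw [← lintegral_indicator measurableSet_Ioi, ← lintegral_indicator measurableSet_Ioc]
  refine lintegral_mono fun r => ?_
  by_cases h0 : 0 < r
  · by_cases h3 : r ≤ 1
    · rw [indicator_of_mem (mem_Ioi.2 h0), indicator_of_mem (mem_Ioc.2 ⟨h0, h3⟩),
        indicator_of_mem (mem_Iic.2 h3), ← ENNReal.ofReal_inv_of_pos h0,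
        ← ENNReal.ofReal_mul (by positivity), ENNReal.ofReal_le_one]
      obtain ⟨m, hm⟩ : ∃ m, Module.finrank ℝ V - 1 = m + 1 := ⟨Module.finrank ℝ V - 2, by omega⟩
      rw [hm, pow_succ, mul_assoc, mul_inv_cancel₀ h0.ne', mul_one]
      exact pow_le_one₀ h0.le h3
    · rw [indicator_of_mem (mem_Ioi.2 h0), indicator_of_notMem (s := Iic 1) (by simpa using h3)]
      simp
  · rw [indicator_of_notMem (by simpa using h0)]; exact zero_le

lemma fourierHalfNormSq_schwartz_ne_top (s : 𝓢(V, ℂ)) :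
    fourierHalfNormSq (s.toLp 2) ≠ ⊤ := by
  have h1 := (𝓕 s).toBoundedContinuousFunction.norm_coe_le_norm
  set C := ‖(𝓕 s).toBoundedContinuousFunction‖
  have hint : Integrable (fun ξ => C * (‖ξ‖ ^ 0 * ‖(𝓕 s) ξ‖ + ‖ξ‖ ^ 1 * ‖(𝓕 s) ξ‖)) :=
    (((𝓕 s).integrable_pow_mul volume 0).add ((𝓕 s).integrable_pow_mul volume 1)).const_mul C
  refine ne_top_of_le_ne_top hint.lintegral_lt_top.ne ?_
  rw [fourierHalfNormSq, SchwartzMap.toLp_fourier_eq]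
  refine lintegral_mono_ae ?_
  filter_upwards [(𝓕 s).coeFn_toLp 2 volume] with ξ hξ
  rw [hξ, enorm_sq_eq_ofReal, ← ofReal_norm, ← ENNReal.ofReal_one,
    ← ENNReal.ofReal_add zero_le_one (norm_nonneg _), ← ENNReal.ofReal_mul (by positivity)]
  refine ENNReal.ofReal_le_ofReal ?_
  have h2 : ‖(𝓕 s) ξ‖ ≤ C := h1 ξ
  have h3 := norm_nonneg ((𝓕 s) ξ)
  calc ‖(𝓕 s) ξ‖ ^ 2 * (1 + ‖ξ‖) = ‖(𝓕 s) ξ‖ * (‖(𝓕 s) ξ‖ * (1 + ‖ξ‖)) := by ring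
    _ ≤ C * (‖(𝓕 s) ξ‖ * (1 + ‖ξ‖)) := by gcongr
    _ = _ := by ring

lemma norm_planeWave_sub_sq_le {ξ : V} (hξ : ‖ξ‖ ≤ 1) (x y : V) :
    ‖planeWave ξ x - planeWave ξ y‖ ^ 2 ≤ (2 * Real.pi) ^ 2 * ‖x - y‖ ^ 2 := by
  have h1 : planeWave ξ x - planeWave ξ y = planeWave ξ y * (planeWave (x - y) ξ - 1) := by
    simp only [planeWave_eq, mul_sub, ← Complex.exp_add, mul_one]
    congr 2
    rw [inner_sub_left, real_inner_comm ξ x, real_inner_comm ξ y]; push_cast; ring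
  rw [h1, norm_mul, norm_planeWave, one_mul]
  refine (norm_planeWave_sub_one_sq_le _ _ hξ).trans ?_
  have := min_le_right 1 (‖x - y‖ ^ 2)
  nlinarith [sq_nonneg Real.pi]

lemma integrable_of_ae_eq_zero_outside {g : V → ℂ} (hg : MemLp g 2) {R : ℝ}
    (h : ∀ᵐ x, R < ‖x‖ → g x = 0) : Integrable g := by
  have : IsFiniteMeasure ((volume : Measure V).restrict (closedBall 0 R)) :=
    ⟨by simpa using measure_closedBall_lt_top⟩
  have h1 : IntegrableOn g (closedBall 0 R) :=
    (hg.restrict _).integrable one_le_two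
  refine (integrable_indicator_iff measurableSet_closedBall |>.2 h1).congr ?_
  filter_upwards [h] with x hx
  by_cases hxR : R < ‖x‖
  · rw [indicator_of_notMem (by simpa using hxR), hx hxR]
  · rw [indicator_of_mem (by simpa using hxR)]

/-- For functions supported in a fixed ball, low frequencies are controlled by `H^{-1/2}`. -/
lemma exists_homogeneous_le_negHalfNorm (V : Type*) [NormedAddCommGroup V] [InnerProductSpace ℝ V]
    [FiniteDimensional ℝ V] [MeasurableSpace V] [BorelSpace V] (hV : 2 ≤ Module.finrank ℝ V)
    (R : ℝ) : ∃ C : ℝ≥0∞, C ≠ ⊤ ∧ ∀ g : Lp ℂ 2 (volume : Measure V),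
      (∀ᵐ x, R < ‖x‖ → g x = 0) →
      ∫⁻ ξ, ‖(𝓕 g : Lp ℂ 2 (volume : Measure V)) ξ‖ₑ ^ 2 / ‖ξ‖ₑ ≤ C * fourierNegHalfNormSq g := by
  have : Nontrivial V := Module.nontrivial_of_finrank_pos (R := ℝ) (by omega)
  obtain ⟨K, hK, hequiv⟩ := exists_halfNormSq_equiv V
  -- The bump equals 1 where g is supported, so ĝ(ξ) is the pairing of g with a plane wave times the
  -- bump.
  let b : ContDiffBump (0 : V) := ⟨|R| + 1, |R| + 2, by positivity, by linarith⟩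
  have hbs : HasCompactSupport fun x => (b x : ℂ) := b.hasCompactSupport.comp_left (g := Complex.ofReal) rfl
  have hbd : ContDiff ℝ ∞ fun x => (b x : ℂ) := Complex.ofRealCLM.contDiff.comp b.contDiff
  set χ : 𝓢(V, ℂ) := hbs.toSchwartzMap hbd with hχ
  have hχv : ∀ x, χ x = b x := fun x => rfl
  set H := K * ((2 + 8 * truncatedKernelMass V) * ENNReal.ofReal (1 ^ 2 + (2 * Real.pi) ^ 2) *
    (K * fourierHalfNormSq (χ.toLp 2))) with hH
  set I := ∫⁻ ξ in closedBall (0 : V) 1, (‖ξ‖ₑ)⁻¹ with hI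
  have hHt : H ≠ ⊤ := by
    have h1 := fourierHalfNormSq_schwartz_ne_top χ
    have h2 := truncatedKernelMass_ne_top (V := V)
    rw [hH]
    finiteness
  have hIt := lintegral_inv_enorm_closedBall_ne_top hV
  refine ⟨H * I + 2, by finiteness, fun g hg => ?_⟩
  have hgi := integrable_of_ae_eq_zero_outside (Lp.memLp g) hg
  have hFg : (𝓕 g : Lp ℂ 2 (volume : Measure V)) =ᵐ[volume] 𝓕 (g : V → ℂ) := by
    have := fourier_toLp_ae_eq hgi (Lp.memLp g)
    rwa [Lp.toLp_coeFn] at this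
  -- For |ξ| ≤ 1 the plane waves have modulus 1 and Lipschitz constant at most 2π, so their products
  -- with χ are bounded in H^{1/2} uniformly in ξ. Duality then bounds ĝ(ξ) pointwise. For |ξ| > 1
  -- the inequality 1/|ξ| ≤ 2/(1+|ξ|) is enough.
  have hlow : ∀ ξ : V, ‖ξ‖ ≤ 1 → ‖𝓕 (g : V → ℂ) ξ‖ₑ ^ 2 ≤ H * fourierNegHalfNormSq g := by
    intro ξ hξ
    have hmem := memLp_wave_mul (χ.memLp 2) ξ
    have h1 : 𝓕 (g : V → ℂ) ξ = inner ℂ (hmem.toLp _) g := by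
      rw [fourier_eq_integral_planeWave, L2.inner_def]
      refine integral_congr_ae ?_
      filter_upwards [hmem.coeFn_toLp, hg] with x hx hx0
      rw [hx, RCLike.inner_apply, map_mul, hχv]
      have h2 : (starRingEnd ℂ) (planeWave ξ x) = planeWave (-ξ) x := by
        rw [planeWave_eq, planeWave_eq, ← Complex.exp_conj, inner_neg_left]
        simp [Complex.conj_ofNat]
      rw [h2]
      by_cases hxR : R < ‖x‖
      · rw [hx0 hxR]; simp
      · have : b x = 1 := b.one_of_mem_closedBall (by
          rw [mem_closedBall_zero_iff]
          change ‖x‖ ≤ |R| + 1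
          linarith [le_abs_self R])
        rw [this]; simp [mul_comm]
    rw [h1, mul_comm]
    refine (enorm_inner_sq_le _ g).trans ?_
    gcongr
    refine (hequiv _).1.trans ?_
    rw [hH]
    gcongr
    rw [halfNormSq_congr hmem.coeFn_toLp]
    have h3 := halfNormSq_sum_mul_le (ι := Unit) (A := 1) (L := 2 * Real.pi)
      (a := fun _ => planeWave ξ) (φ := fun _ => χ) (fun _ => χ.continuous.measurable)
      (fun x => by simp) (fun x y => by simpa using norm_planeWave_sub_sq_le hξ x y)
    simp only [Finset.univ_unique, Finset.sum_const, Finset.card_singleton, one_smul] at h3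
    refine h3.trans ?_
    gcongr
    rw [← halfNormSq_congr (χ.coeFn_toLp 2 volume)]
    exact (hequiv _).2
  have hm := measurable_Lp (𝓕 g : Lp ℂ 2 (volume : Measure V))
  calc ∫⁻ ξ, ‖(𝓕 g : Lp ℂ 2 (volume : Measure V)) ξ‖ₑ ^ 2 / ‖ξ‖ₑ
      ≤ ∫⁻ ξ, ((closedBall (0 : V) 1).indicator (fun ξ => (‖ξ‖ₑ)⁻¹) ξ *
          (H * fourierNegHalfNormSq g) +
        2 * (‖(𝓕 g : Lp ℂ 2 (volume : Measure V)) ξ‖ₑ ^ 2 / (1 + ‖ξ‖ₑ))) := by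
        refine lintegral_mono_ae ?_
        filter_upwards [hFg] with ξ hξ
        by_cases h1 : ‖ξ‖ ≤ 1
        · rw [indicator_of_mem (by simpa using h1), hξ, div_eq_mul_inv, mul_comm]
          refine le_trans ?_ le_self_add
          gcongr
          exact hlow ξ h1
        · refine le_trans ?_ le_add_self
          have h2 : 1 ≤ ‖ξ‖ₑ := by
            rw [← ofReal_norm, ENNReal.one_le_ofReal]; linarith
          rw [div_eq_mul_inv, div_eq_mul_inv, mul_left_comm]
          gcongr
          rw [← div_eq_mul_inv, ENNReal.le_div_iff_mul_le (by simp) (by simp), mul_comm, ← div_eq_mul_inv]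
          refine ENNReal.div_le_of_le_mul ?_
          rw [two_mul]
          gcongr
    _ = I * (H * fourierNegHalfNormSq g) + 2 * fourierNegHalfNormSq g := by
        have hm2 : Measurable ((closedBall (0 : V) 1).indicator (fun ξ => (‖ξ‖ₑ)⁻¹)) :=
          Measurable.indicator (by fun_prop) measurableSet_closedBall
        rw [lintegral_add_left (by fun_prop), lintegral_mul_const _ hm2,
          lintegral_indicator measurableSet_closedBall, lintegral_const_mul _ (by fun_prop)]
        rfl
    _ = _ := by ring

end NegativeNorm

/-! ### Autocorrelation as the Fourier transform of |ĝ|². -/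

section Autocorrelation

open FourierTransform SchwartzMap

variable {V : Type*} [NormedAddCommGroup V] [InnerProductSpace ℝ V] [FiniteDimensional ℝ V]
  [MeasurableSpace V] [BorelSpace V]

/-- The autocorrelation `z ↦ ∫ conj (g y) g (y + z) dy`. -/
def autocorrelation (g : V → ℂ) (z : V) : ℂ := ∫ y, (starRingEnd ℂ) (g y) * g (y + z)

lemma integrable_norm_fourier_sq {g : V → ℂ} (hg : Integrable g) (hg2 : MemLp g 2) :
    Integrable fun ξ => ‖𝓕 g ξ‖ ^ 2 := by
  have h1 : MemLp (𝓕 g) 2 :=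
    (memLp_congr_ae (fourier_toLp_ae_eq hg hg2)).1 (Lp.memLp _)
  exact h1.integrable_norm_pow two_ne_zero

/-- Plancherel for the pairing of g with its translate. Since `fourier_translate_sub` concerns
translate minus identity, Plancherel is applied to the difference, and the pairing of g with itself
is then cancelled on both sides. -/
lemma autocorrelation_eq {g : V → ℂ} (hg : Integrable g) (hg2 : MemLp g 2) (z : V) :
    autocorrelation g z = ∫ ξ, planeWave z ξ * ((‖𝓕 g ξ‖ ^ 2 : ℝ) : ℂ) := by
  set G := hg2.toLp g with hG
  have hGg := hg2.coeFn_toLp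
  have hF := fourier_toLp_ae_eq hg hg2
  have hw : Integrable fun ξ => ((‖𝓕 g ξ‖ ^ 2 : ℝ) : ℂ) := (integrable_norm_fourier_sq hg hg2).ofReal
  have hwave : Integrable fun ξ => planeWave z ξ * ((‖𝓕 g ξ‖ ^ 2 : ℝ) : ℂ) := by
    refine hw.bdd_mul (c := 1) (contDiff_planeWave z).continuous.aestronglyMeasurable ?_
    exact ae_of_all _ fun ξ => (norm_planeWave z ξ).le
  have hτ : MemLp (fun x => g (x + z)) 2 :=
    hg2.comp_measurePreserving (measurePreserving_add_right volume z)
  have hi1 : Integrable fun y => (starRingEnd ℂ) (g y) * g (y + z) := by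
    have := hg2.star.integrable_mul hτ
    exact this
  have hi2 : Integrable fun y => (starRingEnd ℂ) (g y) * g y := hg2.star.integrable_mul hg2
  have e1 : inner ℂ G ((memLp_translate_sub G z).toLp _) =
      autocorrelation g z - ∫ y, (starRingEnd ℂ) (g y) * g y := by
    rw [autocorrelation, ← integral_sub hi1 hi2, L2.inner_def]
    refine integral_congr_ae ?_
    have hGg' := (measurePreserving_add_right (volume : Measure V) z).quasiMeasurePreserving.ae_eq_comp hGg
    filter_upwards [hGg, (memLp_translate_sub G z).coeFn_toLp, hGg'] with x h1 h2 h3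
    simp only [Function.comp_apply] at h3
    rw [h2, RCLike.inner_apply, h1, h3]; ring
  have e2 : inner ℂ G ((memLp_translate_sub G z).toLp _) =
      (∫ ξ, planeWave z ξ * ((‖𝓕 g ξ‖ ^ 2 : ℝ) : ℂ)) - ∫ ξ, ((‖𝓕 g ξ‖ ^ 2 : ℝ) : ℂ) := by
    rw [← Lp.inner_fourier_eq, L2.inner_def, ← integral_sub hwave hw]
    refine integral_congr_ae ?_
    filter_upwards [hF, fourier_translate_sub G z] with ξ h1 h2
    rw [h2, RCLike.inner_apply, h1, mul_assoc, Complex.mul_conj, Complex.normSq_eq_norm_sq]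
    push_cast; ring
  have e3 : ∫ y, (starRingEnd ℂ) (g y) * g y = ∫ ξ, ((‖𝓕 g ξ‖ ^ 2 : ℝ) : ℂ) := by
    have h1 : inner ℂ G G = ∫ y, (starRingEnd ℂ) (g y) * g y := by
      rw [L2.inner_def]
      refine integral_congr_ae ?_
      filter_upwards [hGg] with x h1
      rw [h1, RCLike.inner_apply, mul_comm]
    rw [← h1, ← Lp.inner_fourier_eq, L2.inner_def]
    refine integral_congr_ae ?_
    filter_upwards [hF] with ξ h1
    rw [RCLike.inner_apply, h1, Complex.mul_conj, Complex.normSq_eq_norm_sq]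
  rw [e1, e3] at e2
  exact sub_left_injective e2

lemma autocorrelation_eq_fourier {g : V → ℂ} (hg : Integrable g) (hg2 : MemLp g 2) (z : V) :
    autocorrelation g z = 𝓕 (fun ξ => ((‖𝓕 g ξ‖ ^ 2 : ℝ) : ℂ)) (-z) := by
  rw [autocorrelation_eq hg hg2, fourier_eq_integral_planeWave, neg_neg]

lemma continuous_autocorrelation {g : V → ℂ} (hg : Integrable g) (hg2 : MemLp g 2) :
    Continuous (autocorrelation g) := by
  have h := continuous_fourier_of_integrable ((integrable_norm_fourier_sq hg hg2).ofReal (𝕜 := ℂ))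
  rw [show autocorrelation g = _ from funext (autocorrelation_eq_fourier hg hg2)]
  exact h.comp continuous_neg

lemma norm_autocorrelation_le {g : V → ℂ} (hg : Integrable g) (hg2 : MemLp g 2) (z : V) :
    ‖autocorrelation g z‖ ≤ ∫ ξ, ‖𝓕 g ξ‖ ^ 2 := by
  rw [autocorrelation_eq hg hg2]
  refine (norm_integral_le_integral_norm _).trans (le_of_eq ?_)
  refine integral_congr_ae (ae_of_all _ fun ξ => ?_)
  simp

lemma autocorrelation_neg (g : V → ℂ) (z : V) :
    autocorrelation g (-z) = (starRingEnd ℂ) (autocorrelation g z) := by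
  rw [autocorrelation, autocorrelation, ← integral_conj,
    ← integral_add_right_eq_self (fun y => (starRingEnd ℂ) (g y) * g (y + -z)) z]
  refine integral_congr_ae (ae_of_all _ fun y => ?_)
  simp [mul_comm]

lemma autocorrelation_eq_zero {g : V → ℂ} {R : ℝ} (h : ∀ x, R < ‖x‖ → g x = 0) {z : V}
    (hz : 2 * R < ‖z‖) : autocorrelation g z = 0 := by
  rw [autocorrelation]
  refine integral_eq_zero_of_ae (ae_of_all _ fun y => ?_)
  by_cases hy : R < ‖y‖
  · simp [h y hy]
  · have : R < ‖y + z‖ := by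
      have := norm_sub_le (y + z) y
      rw [add_sub_cancel_left] at this
      linarith
    simp [h _ this]

/-- The autocorrelation at −z is the Fourier transform of |ĝ|² at z, so the self-adjointness of the
transform moves it onto the Gaussian. -/
lemma integral_autocorrelation_gaussian {g : V → ℂ} (hg : Integrable g) (hg2 : MemLp g 2)
    {s : ℝ} (hs : 0 < s) :
    ∫ z, autocorrelation g z * ((Real.exp (-(Real.pi * s) * ‖z‖ ^ 2) : ℝ) : ℂ) =
      ((s ^ (-(Module.finrank ℝ V : ℝ) / 2) *
        ∫ ξ, ‖𝓕 g ξ‖ ^ 2 * Real.exp (-Real.pi * ‖ξ‖ ^ 2 / s) : ℝ) : ℂ) := by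
  have hπ := Real.pi_pos
  have hb : 0 < ((Real.pi * s : ℝ) : ℂ).re := by simpa using by positivity
  set w : V → ℂ := fun ξ => ((‖𝓕 g ξ‖ ^ 2 : ℝ) : ℂ) with hw
  have hwi : Integrable w := (integrable_norm_fourier_sq hg hg2).ofReal
  set G : V → ℂ := fun v => Complex.exp (-((Real.pi * s : ℝ) : ℂ) * ‖v‖ ^ 2) with hG
  have hGe : ∀ z, ((Real.exp (-(Real.pi * s) * ‖z‖ ^ 2) : ℝ) : ℂ) = G z := fun z => by
    rw [hG]; push_cast; rfl
  have hGi : Integrable G := by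
    have := GaussianFourier.integrable_cexp_neg_mul_sq_norm_add (V := V) hb 0 0
    simpa [hG] using this
  have h1 : ∫ z, autocorrelation g z * ((Real.exp (-(Real.pi * s) * ‖z‖ ^ 2) : ℝ) : ℂ) =
      ∫ z, 𝓕 w z * G z := by
    rw [← integral_neg_eq_self]
    refine integral_congr_ae (ae_of_all _ fun z => ?_)
    simp only
    rw [autocorrelation_eq_fourier hg hg2, neg_neg, norm_neg, hGe]
  have h2 : ∫ ξ, 𝓕 w ξ • G ξ = ∫ x, w x • 𝓕 G x := by
    simpa using! VectorFourier.integral_fourierIntegral_smul_eq_flip (L := innerₗ V)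
      Real.continuous_fourierChar continuous_inner hwi hGi
  simp only [smul_eq_mul] at h2
  rw [h1, h2, ← integral_const_mul, ← integral_complex_ofReal]
  refine integral_congr_ae (ae_of_all _ fun ξ => ?_)
  simp only [hG, hw]
  rw [fourier_gaussian_innerProductSpace hb]
  have h3 : ((Real.pi : ℂ) / ((Real.pi * s : ℝ) : ℂ)) ^ ((Module.finrank ℝ V : ℂ) / 2) =
      ((s ^ (-(Module.finrank ℝ V : ℝ) / 2) : ℝ) : ℂ) := by
    have e : (Real.pi : ℂ) / ((Real.pi * s : ℝ) : ℂ) = ((s⁻¹ : ℝ) : ℂ) := by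
      rw [← Complex.ofReal_div]; congr 1; field_simp
    have e2 : ((Module.finrank ℝ V : ℂ) / 2) = (((Module.finrank ℝ V : ℝ) / 2 : ℝ) : ℂ) := by
      push_cast; rfl
    rw [e, e2, ← Complex.ofReal_cpow (by positivity), neg_div, Real.rpow_neg hs.le,
      Real.inv_rpow hs.le]
  have h4 : Complex.exp (-(Real.pi : ℂ) ^ 2 * ‖ξ‖ ^ 2 / ((Real.pi * s : ℝ) : ℂ)) =
      ((Real.exp (-Real.pi * ‖ξ‖ ^ 2 / s) : ℝ) : ℂ) := by
    push_cast
    congr 1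
    have : (Real.pi : ℂ) ≠ 0 := by exact_mod_cast hπ.ne'
    have : (s : ℂ) ≠ 0 := by exact_mod_cast hs.ne'
    field_simp
  rw [h3, h4]; push_cast; ring

/-- The substitution t = 1/s turns this into the integral for Γ(1/2) = √π. The exponent −3/2 is what
remains of (n−1)/2 − 1 after the factor s^{-n/2} of the transformed Gaussian, for every n. -/
lemma lintegral_rpow_mul_exp_neg_div {r : ℝ} (hr : 0 < r) :
    ∫⁻ s in Ioi (0 : ℝ), ENNReal.ofReal (s ^ (-(3 / 2) : ℝ) * Real.exp (-Real.pi * r ^ 2 / s)) =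
      ENNReal.ofReal r⁻¹ := by
  have hπ := Real.pi_pos
  have himg : (fun t : ℝ => t⁻¹) '' Ioi 0 = Ioi 0 := by
    ext x
    simp only [mem_image, mem_Ioi]
    exact ⟨by rintro ⟨t, ht, rfl⟩; positivity, fun hx => ⟨x⁻¹, by positivity, inv_inv x⟩⟩
  have h1 := lintegral_image_eq_lintegral_abs_deriv_mul (f := fun t : ℝ => t⁻¹)
    (f' := fun t => -(t ^ 2)⁻¹) measurableSet_Ioi
    (fun x hx => (hasDerivAt_inv (ne_of_gt hx)).hasDerivWithinAt) (inv_injective.injOn)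
    (fun s => ENNReal.ofReal (s ^ (-(3 / 2) : ℝ) * Real.exp (-Real.pi * r ^ 2 / s)))
  rw [himg] at h1
  rw [h1]
  have h2 : ∀ t ∈ Ioi (0 : ℝ), ENNReal.ofReal |-(t ^ 2)⁻¹| *
      ENNReal.ofReal ((t⁻¹) ^ (-(3 / 2) : ℝ) * Real.exp (-Real.pi * r ^ 2 / t⁻¹)) =
      ENNReal.ofReal (t ^ ((1 / 2 : ℝ) - 1) * Real.exp (-(Real.pi * r ^ 2 * t))) := by
    intro t ht
    have ht : 0 < t := ht
    rw [← ENNReal.ofReal_mul (by positivity), abs_neg, abs_of_pos (by positivity), ← mul_assoc]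
    congr 2
    · rw [Real.inv_rpow ht.le, Real.rpow_neg ht.le, inv_inv, ← Real.rpow_natCast,
        ← Real.rpow_neg ht.le, ← Real.rpow_add ht]
      norm_num
    · congr 1; field_simp
  rw [setLIntegral_congr_fun measurableSet_Ioi h2, ← ofReal_integral_eq_lintegral_ofReal]
  · rw [Real.integral_rpow_mul_exp_neg_mul_Ioi (by norm_num) (by positivity), Real.Gamma_one_half_eq,
      ← Real.sqrt_eq_rpow, ← Real.sqrt_mul (by positivity)]
    congr 1
    rw [show 1 / (Real.pi * r ^ 2) * Real.pi = (r⁻¹) ^ 2 by field_simp]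
    exact Real.sqrt_sq (by positivity)
  · have := integrableOn_rpow_mul_exp_neg_mul_rpow (s := (1 / 2 : ℝ) - 1) (p := 1) (b := Real.pi * r ^ 2)
      (by norm_num) (by norm_num) (by positivity)
    simpa [IntegrableOn] using this
  · refine (ae_restrict_iff' measurableSet_Ioi).2 (ae_of_all _ fun t ht => ?_)
    have ht : 0 < t := ht
    simp only [Pi.zero_apply]
    positivity

end Autocorrelation

/-! ### The Fourier transform of the Riesz kernel. -/

section RieszKernel

open FourierTransform SchwartzMap

variable {V : Type*} [NormedAddCommGroup V] [InnerProductSpace ℝ V] [FiniteDimensional ℝ V]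
  [MeasurableSpace V] [BorelSpace V]

/-- Integration in polar coordinates. -/
lemma integral_polar [Nontrivial V] {f : V → ℝ} (hfi : Integrable f) :
    Integrable (fun θ => ∫ r in Ioi (0 : ℝ), r ^ (Module.finrank ℝ V - 1) * f (r • θ))
        (sphereMeasure V) ∧
      ∫ x, f x = ∫ θ, (∫ r in Ioi (0 : ℝ), r ^ (Module.finrank ℝ V - 1) * f (r • θ))
        ∂(sphereMeasure V) := by
  set n := Module.finrank ℝ V - 1 with hn
  have h1 := (volume : Measure V).measurePreserving_homeomorphUnitSphereProd
  rw [← hn] at h1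
  have hemb := (homeomorphUnitSphereProd V).measurableEmbedding
  set k : sphere (0 : V) 1 × Ioi (0 : ℝ) → ℝ := fun z => f (z.2.1 • z.1.1) with hk
  have h5 : ∀ x : ({0}ᶜ : Set V), k (homeomorphUnitSphereProd V x) = f x := by
    intro x
    have : ‖(x : V)‖ ≠ 0 := norm_ne_zero_iff.2 x.2
    simp [hk, smul_smul, this]
  have hc : MeasurableSet ({0}ᶜ : Set V) := (measurableSet_singleton _).compl
  have hki : Integrable k ((volume : Measure V).toSphere.prod (Measure.volumeIoiPow n)) := by
    rw [← h1.integrable_comp_emb hemb]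
    have : k ∘ homeomorphUnitSphereProd V = fun x : ({0}ᶜ : Set V) => f x := funext h5
    rw [this]
    exact (integrableOn_iff_comap_subtypeVal hc).1 (hfi.integrableOn)
  have hint : ∫ x, f x = ∫ z, k z ∂((volume : Measure V).toSphere.prod (Measure.volumeIoiPow n)) := by
    rw [← h1.integral_comp hemb]
    simp only [h5]
    rw [integral_subtype_comap hc, restrict_compl_singleton]
  have hinner : ∀ θ : sphere (0 : V) 1, ∫ r, k (θ, r) ∂(Measure.volumeIoiPow n) =
      ∫ r in Ioi (0 : ℝ), r ^ n * f (r • (θ : V)) := by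
    intro θ
    rw [← integral_subtype_comap measurableSet_Ioi (fun r => r ^ n * f (r • (θ : V))),
      Measure.volumeIoiPow, integral_withDensity_eq_integral_toReal_smul (by fun_prop)
        (ae_of_all _ fun _ => ENNReal.ofReal_lt_top)]
    refine integral_congr_ae (ae_of_all _ fun r => ?_)
    simp only [hk, smul_eq_mul]
    rw [ENNReal.toReal_ofReal (pow_nonneg (le_of_lt r.2) _)]
  have hemb2 : MeasurableEmbedding (fun u : sphere (0 : V) 1 => (u : V)) :=
    MeasurableEmbedding.subtype_coe isClosed_sphere.measurableSet
  constructor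
  · rw [sphereMeasure, hemb2.integrable_map_iff]
    exact hki.integral_prod_left.congr (ae_of_all _ hinner)
  · rw [hint, integral_prod _ hki, sphereMeasure, hemb2.integral_map]
    exact integral_congr_ae (ae_of_all _ hinner)

/-- The kernel |z|^{1-n} is exactly cancelled by the polar Jacobian, so boundedness of A and of its
support suffices. -/
lemma integrable_bounded_mul_rieszKernel (hV : 2 ≤ Module.finrank ℝ V) {A : V → ℂ}
    (hA : Continuous A) {M R : ℝ} (hM : ∀ z, ‖A z‖ ≤ M) (hR : ∀ z, R < ‖z‖ → A z = 0) :
    Integrable fun z => ‖A z‖ * (‖z‖ ^ (Module.finrank ℝ V - 1))⁻¹ := by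
  have : Nontrivial V := Module.nontrivial_of_finrank_pos (R := ℝ) (by omega)
  have hM0 : 0 ≤ M := (norm_nonneg _).trans (hM 0)
  set n := Module.finrank ℝ V - 1 with hn
  refine ⟨by fun_prop, ?_⟩
  have h1 := lintegral_radial (V := V) (k := (Iic R).indicator fun r =>
    ENNReal.ofReal M * ENNReal.ofReal (r ^ n)⁻¹) (Measurable.indicator (by fun_prop) measurableSet_Iic)
  refine lt_of_le_of_lt (lintegral_mono (g := fun x : V => (Iic R).indicator (fun r =>
    ENNReal.ofReal M * ENNReal.ofReal (r ^ n)⁻¹) ‖x‖) fun z => ?_) ?_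
  · rw [Real.enorm_of_nonneg (by positivity)]
    change ENNReal.ofReal (‖A z‖ * (‖z‖ ^ n)⁻¹) ≤ (Iic R).indicator (fun r =>
      ENNReal.ofReal M * ENNReal.ofReal (r ^ n)⁻¹) ‖z‖
    by_cases hz : R < ‖z‖
    · simp [hR z hz]
    · rw [indicator_of_mem (by simpa using hz), ← ENNReal.ofReal_mul hM0]
      exact ENNReal.ofReal_le_ofReal (by gcongr; exact hM z)
  · rw [h1]
    refine ENNReal.mul_lt_top (measure_lt_top _ _) ?_
    refine lt_of_le_of_lt (b := ∫⁻ r in Ioc (0 : ℝ) R, ENNReal.ofReal M) ?_ (by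
      rw [setLIntegral_const]; exact ENNReal.mul_lt_top ENNReal.ofReal_lt_top (by simp))
    rw [← lintegral_indicator measurableSet_Ioi, ← lintegral_indicator measurableSet_Ioc]
    refine lintegral_mono fun r => ?_
    by_cases h0 : 0 < r
    · by_cases h3 : r ≤ R
      · rw [indicator_of_mem (mem_Ioi.2 h0), indicator_of_mem (mem_Ioc.2 ⟨h0, h3⟩),
          indicator_of_mem (mem_Iic.2 h3), ← ENNReal.ofReal_mul hM0,
          ← ENNReal.ofReal_mul (by positivity)]
        refine ENNReal.ofReal_le_ofReal (le_of_eq ?_)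
        rw [← hn]; field_simp
      · rw [indicator_of_mem (mem_Ioi.2 h0), indicator_of_notMem (s := Iic R) (by simpa using h3)]
        simp
    · rw [indicator_of_notMem (by simpa using h0)]; exact zero_le

/-- The constant of the Riesz kernel. -/
def rieszConst (n : ℕ) : ℝ :=
  (1 / Real.pi) ^ (((n : ℝ) - 1) / 2) * Real.Gamma (((n : ℝ) - 1) / 2)

lemma rieszConst_pos {n : ℕ} (hn : 2 ≤ n) : 0 < rieszConst n := by
  have : (2 : ℝ) ≤ n := by exact_mod_cast hn
  have h1 := Real.pi_pos
  exact mul_pos (by positivity) (Real.Gamma_pos_of_pos (by linarith))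

/-- Gamma integral of exponent (n−1)/2. It writes the Riesz kernel |z|^{1-n} as a superposition of
Gaussians, to which Parseval can be applied one by one. -/
lemma integral_rpow_mul_gaussian {n : ℕ} (hn : 2 ≤ n) {r : ℝ} (hr : 0 < r) :
    IntegrableOn (fun s : ℝ => s ^ (((n : ℝ) - 1) / 2 - 1) * Real.exp (-(Real.pi * s) * r ^ 2)) (Ioi 0) ∧
    ∫ s in Ioi (0 : ℝ), s ^ (((n : ℝ) - 1) / 2 - 1) * Real.exp (-(Real.pi * s) * r ^ 2) =
      rieszConst n * (r ^ (n - 1))⁻¹ := by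
  have h2 : (2 : ℝ) ≤ n := by exact_mod_cast hn
  have hπ := Real.pi_pos
  have e : ∀ s : ℝ, Real.exp (-(Real.pi * s) * r ^ 2) = Real.exp (-((Real.pi * r ^ 2) * s)) :=
    fun s => by congr 1; ring
  simp only [e]
  constructor
  · have := integrableOn_rpow_mul_exp_neg_mul_rpow (s := ((n : ℝ) - 1) / 2 - 1) (p := 1)
      (b := Real.pi * r ^ 2) (by linarith) (by norm_num) (by positivity)
    simpa using this
  · rw [Real.integral_rpow_mul_exp_neg_mul_Ioi (by linarith) (by positivity), rieszConst]
    have h3 : (1 / (Real.pi * r ^ 2)) ^ (((n : ℝ) - 1) / 2) =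
        (1 / Real.pi) ^ (((n : ℝ) - 1) / 2) * (r ^ (n - 1))⁻¹ := by
      rw [show 1 / (Real.pi * r ^ 2) = (1 / Real.pi) * (r ^ 2)⁻¹ by field_simp,
        Real.mul_rpow (by positivity) (by positivity), Real.inv_rpow (by positivity),
        ← Real.rpow_natCast r 2, ← Real.rpow_mul hr.le, ← Real.rpow_natCast r (n - 1)]
      congr 3
      push_cast [Nat.cast_sub (show 1 ≤ n by omega)]; ring
    rw [h3]; ring

/-- The Riesz kernel `|z|^{1-n}` has Fourier transform a multiple of `|ξ|⁻¹`. -/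
lemma integral_autocorrelation_riesz (hV : 2 ≤ Module.finrank ℝ V) {g : V → ℂ} (hg2 : MemLp g 2)
    {R : ℝ} (hR : ∀ x, R < ‖x‖ → g x = 0) :
    ENNReal.ofReal (rieszConst (Module.finrank ℝ V) *
      ∫ z, (autocorrelation g z).re * (‖z‖ ^ (Module.finrank ℝ V - 1))⁻¹) =
        ∫⁻ ξ, ‖𝓕 g ξ‖ₑ ^ 2 / ‖ξ‖ₑ := by
  have : Nontrivial V := Module.nontrivial_of_finrank_pos (R := ℝ) (by omega)
  have hg := integrable_of_ae_eq_zero_outside hg2 (ae_of_all _ hR)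
  set n := Module.finrank ℝ V with hn
  have h2n : (2 : ℝ) ≤ n := by exact_mod_cast hV
  have hπ := Real.pi_pos
  set A := autocorrelation g with hA
  have hAc : Continuous A := continuous_autocorrelation hg hg2
  have hAk := integrable_bounded_mul_rieszKernel hV hAc (norm_autocorrelation_le hg hg2)
    (fun z hz => autocorrelation_eq_zero hR hz)
  rw [← hn] at hAk
  have hz0 : ∀ᵐ z : V, z ≠ 0 := by
    simp [ae_iff, measure_singleton]
  set a : ℝ := ((n : ℝ) - 1) / 2 with ha
  -- Integrating D in s first gives the Riesz kernel against A. Integrating in z first gives the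
  -- Gaussian averages J of |ĝ|².
  set D : ℝ × V → ℂ := fun p => A p.2 * ((p.1 ^ (a - 1) * Real.exp (-(Real.pi * p.1) * ‖p.2‖ ^ 2) : ℝ) : ℂ) with hD
  have hDm : Measurable D := by
    have := hAc.measurable
    fun_prop
  have hDnorm : ∀ z, ∀ s ∈ Ioi (0 : ℝ), ‖D (s, z)‖ =
      ‖A z‖ * (s ^ (a - 1) * Real.exp (-(Real.pi * s) * ‖z‖ ^ 2)) := by
    intro z s hs
    have hs : 0 < s := hs
    rw [hD, norm_mul, Complex.norm_real, Real.norm_of_nonneg (by positivity)]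
  have hDi : Integrable D ((volume.restrict (Ioi 0)).prod volume) := by
    rw [integrable_prod_iff' hDm.aestronglyMeasurable]
    constructor
    · filter_upwards [hz0] with z hz
      have h := ((integral_rpow_mul_gaussian hV (norm_pos_iff.2 hz)).1.ofReal (𝕜 := ℂ)).const_mul (A z)
      exact h
    · refine (hAk.const_mul (rieszConst n)).congr ?_
      filter_upwards [hz0] with z hz
      rw [setIntegral_congr_fun measurableSet_Ioi (hDnorm z), integral_const_mul,
        (integral_rpow_mul_gaussian hV (norm_pos_iff.2 hz)).2]
      ring
  set J : ℝ → ℝ := fun s => s ^ (a - 1) * (s ^ (-(n : ℝ) / 2) *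
    ∫ ξ, ‖𝓕 g ξ‖ ^ 2 * Real.exp (-Real.pi * ‖ξ‖ ^ 2 / s)) with hJ
  have hDJ : ∀ s ∈ Ioi (0 : ℝ), ∫ z, D (s, z) = (J s : ℂ) := by
    intro s hs
    have h := integral_autocorrelation_gaussian hg hg2 (mem_Ioi.1 hs)
    simp only [hD, hJ]
    rw [Complex.ofReal_mul, ← h, ← integral_const_mul]
    refine integral_congr_ae (ae_of_all _ fun z => ?_)
    push_cast; ring
  -- The autocorrelation has no sign, so the first exchange needs Fubini with absolute convergence.
  -- On the Fourier side everything is nonnegative and Tonelli is enough for the second exchange.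
  have hJi : IntegrableOn J (Ioi 0) := by
    have h := hDi.integral_prod_left
    have h3 : Integrable (fun s => (J s : ℂ)) (volume.restrict (Ioi 0)) :=
      h.congr ((ae_restrict_iff' measurableSet_Ioi).2 (ae_of_all _ hDJ))
    exact h3.re
  have hreal : rieszConst n * ∫ z, (A z).re * (‖z‖ ^ (n - 1))⁻¹ = ∫ s in Ioi (0 : ℝ), J s := by
    have h4 : ∫ z, ∫ s in Ioi (0 : ℝ), D (s, z) = ∫ s in Ioi (0 : ℝ), ∫ z, D (s, z) :=
      (integral_integral_swap (f := fun s z => D (s, z)) hDi).symm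
    rw [setIntegral_congr_fun measurableSet_Ioi hDJ, integral_complex_ofReal] at h4
    have h5 : ∫ z, ∫ s in Ioi (0 : ℝ), D (s, z) =
        ∫ z, (rieszConst n : ℂ) * (A z * (((‖z‖ ^ (n - 1))⁻¹ : ℝ) : ℂ)) := by
      refine integral_congr_ae ?_
      filter_upwards [hz0] with z hz
      simp only [hD]
      rw [integral_const_mul, integral_complex_ofReal,
        (integral_rpow_mul_gaussian hV (norm_pos_iff.2 hz)).2]
      push_cast; ring
    rw [h5, integral_const_mul] at h4
    have hAki : Integrable fun z => A z * (((‖z‖ ^ (n - 1))⁻¹ : ℝ) : ℂ) := by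
      refine hAk.mono' (by have := hAc.measurable; fun_prop) (ae_of_all _ fun z => ?_)
      rw [norm_mul, Complex.norm_real, Real.norm_of_nonneg (by positivity)]
    have h6 := congrArg Complex.re h4
    rw [Complex.re_ofReal_mul, Complex.ofReal_re] at h6
    rw [← h6]
    congr 1
    have h7 := integral_re hAki
    simp only [RCLike.re_to_complex, Complex.re_mul_ofReal] at h7
    exact h7
  have hJ0 : ∀ s ∈ Ioi (0 : ℝ), 0 ≤ J s := by
    intro s hs
    have hs : 0 < s := hs
    have : 0 ≤ ∫ ξ, ‖𝓕 g ξ‖ ^ 2 * Real.exp (-Real.pi * ‖ξ‖ ^ 2 / s) :=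
      integral_nonneg fun ξ => by positivity
    simp only [hJ]
    positivity
  have hFc := continuous_fourier_of_integrable hg
  have hFm : Measurable (𝓕 g) := hFc.measurable
  rw [hreal, ofReal_integral_eq_lintegral_ofReal hJi
    ((ae_restrict_iff' measurableSet_Ioi).2 (ae_of_all _ hJ0))]
  have hJl : ∀ s ∈ Ioi (0 : ℝ), ENNReal.ofReal (J s) = ∫⁻ ξ, ‖𝓕 g ξ‖ₑ ^ 2 *
      ENNReal.ofReal (s ^ (-(3 / 2) : ℝ) * Real.exp (-Real.pi * ‖ξ‖ ^ 2 / s)) := by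
    intro s hs
    have hs : 0 < s := hs
    have hi : Integrable fun ξ => ‖𝓕 g ξ‖ ^ 2 * Real.exp (-Real.pi * ‖ξ‖ ^ 2 / s) := by
      refine (integrable_norm_fourier_sq hg hg2).mul_bdd (c := 1) (by fun_prop) (ae_of_all _ fun ξ => ?_)
      rw [Real.norm_of_nonneg (Real.exp_pos _).le, Real.exp_le_one_iff]
      have : 0 ≤ Real.pi * ‖ξ‖ ^ 2 / s := by positivity
      rw [neg_mul, neg_div]; linarith
    have h8 : s ^ (a - 1) * s ^ (-(n : ℝ) / 2) = s ^ (-(3 / 2) : ℝ) := by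
      rw [← Real.rpow_add hs]; congr 1; rw [ha]; ring
    simp only [hJ]
    rw [← mul_assoc, h8, ← integral_const_mul, ofReal_integral_eq_lintegral_ofReal (hi.const_mul _)
      (ae_of_all _ fun ξ => by simp only [Pi.zero_apply]; positivity)]
    refine lintegral_congr fun ξ => ?_
    rw [enorm_sq_eq_ofReal, ← ENNReal.ofReal_mul (by positivity)]
    congr 1; ring
  rw [setLIntegral_congr_fun measurableSet_Ioi hJl, lintegral_lintegral_swap]
  · refine lintegral_congr_ae ?_
    filter_upwards [hz0] with ξ hξ
    rw [lintegral_const_mul _ (by fun_prop), lintegral_rpow_mul_exp_neg_div (norm_pos_iff.2 hξ),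
      ENNReal.ofReal_inv_of_pos (norm_pos_iff.2 hξ), ofReal_norm, div_eq_mul_inv]
  · refine Measurable.aemeasurable ?_
    simp only [Function.uncurry_def]
    fun_prop

end RieszKernel

/-! ### The Euclidean X-ray transform and its energy identity. -/

section XrayTransform

open FourierTransform SchwartzMap

variable {V : Type*} [NormedAddCommGroup V] [InnerProductSpace ℝ V] [FiniteDimensional ℝ V]
  [MeasurableSpace V] [BorelSpace V]

lemma inner_orthogonal_singleton (θ : V) (p : (Submodule.span ℝ {θ})ᗮ) :
    inner ℝ (p : V) θ = 0 := by
  rw [real_inner_comm]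
  exact Submodule.mem_orthogonal_singleton_iff_inner_right.1 p.2

lemma finrank_orthogonal_unit {θ : V} (hθ : ‖θ‖ = 1) :
    Module.finrank ℝ V = Module.finrank ℝ (Submodule.span ℝ {θ})ᗮ + 1 := by
  have h0 : θ ≠ 0 := by rintro rfl; simp at hθ
  have h1 := (Submodule.span ℝ {θ}).finrank_add_finrank_orthogonal
  rw [finrank_span_singleton h0] at h1
  omega

lemma measurePreserving_line_add {θ : V} (hθ : ‖θ‖ = 1) :
    MeasurePreserving (fun z : (Submodule.span ℝ {θ})ᗮ × ℝ => (z.1 : V) + z.2 • θ)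
      (volume.prod volume) volume :=
  measurePreserving_hyperplane_add (Submodule.span ℝ {θ})ᗮ.subtypeₗᵢ hθ
    (inner_orthogonal_singleton θ) (finrank_orthogonal_unit hθ)

/-- The squared `L²` norm of the X-ray transform of `g` over the lines of direction `θ`, expressed
by the autocorrelation of `g`. -/
def xrayEnergy (g : V → ℂ) (θ : V) : ℝ≥0∞ :=
  ENNReal.ofReal (∫ τ : ℝ, autocorrelation g (τ • θ)).re

/-- The product vanishes for |τ| > 2R because both points cannot lie in the ball. For the other τ,
Cauchy–Schwarz bounds the integral over V by the squared L² norm. -/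
lemma integrable_mul_translate_line {g : V → ℂ} (hgm : Measurable g) (hg2 : MemLp g 2)
    {R : ℝ} (hR : ∀ x, R < ‖x‖ → g x = 0) {θ : V} (hθ : ‖θ‖ = 1) :
    Integrable (fun z : V × ℝ => (starRingEnd ℂ) (g z.1) * g (z.1 + z.2 • θ))
      (volume.prod volume) := by
  have hm : Measurable fun z : V × ℝ => (starRingEnd ℂ) (g z.1) * g (z.1 + z.2 • θ) :=
    (Complex.continuous_conj.measurable.comp (hgm.comp measurable_fst)).mul (by fun_prop)
  refine ⟨hm.aestronglyMeasurable, ?_⟩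
  rw [HasFiniteIntegral, lintegral_prod_symm' _ (by fun_prop)]
  set N := ∫⁻ x, ‖g x‖ₑ ^ 2 with hN
  have hNt : N < ⊤ := by
    have := (hg2.integrable_norm_pow two_ne_zero).lintegral_lt_top
    simpa only [hN, enorm_sq_eq_ofReal] using this
  refine lt_of_le_of_lt (b := ∫⁻ τ in Icc (-(2 * R)) (2 * R), N) ?_ (by
    rw [setLIntegral_const]; exact ENNReal.mul_lt_top hNt (by simp))
  rw [← lintegral_indicator measurableSet_Icc]
  refine lintegral_mono fun τ => ?_
  by_cases hτ : τ ∈ Icc (-(2 * R)) (2 * R)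
  · rw [indicator_of_mem hτ]
    have h1 : ∫⁻ y, ‖g (y + τ • θ)‖ₑ ^ 2 = N :=
      lintegral_add_right_eq_self (fun y => ‖g y‖ₑ ^ 2) (τ • θ)
    have h2 := lintegral_mul_sq_le (μ := (volume : Measure V)) (f := fun y => ‖g y‖ₑ)
      (g := fun y => ‖g (y + τ • θ)‖ₑ) (by fun_prop) (by fun_prop)
    rw [h1, ← hN, ← sq] at h2
    have h3 := (ENNReal.pow_le_pow_left_iff two_ne_zero).1 h2
    refine le_trans (le_of_eq ?_) h3
    refine lintegral_congr fun y => ?_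
    rw [enorm_mul]
    congr 1
    rw [← ofReal_norm, ← ofReal_norm, RCLike.norm_conj]
  · rw [indicator_of_notMem hτ]
    refine le_of_eq ((lintegral_congr fun y => ?_).trans lintegral_zero)
    have habs : 2 * R < |τ| := by
      by_contra h
      push Not at h
      exact hτ (abs_le.1 h)
    by_cases hy : R < ‖y‖
    · simp [hR y hy]
    · have : R < ‖y + τ • θ‖ := by
        have := norm_sub_le (y + τ • θ) y
        rw [add_sub_cancel_left, norm_smul, hθ, mul_one, Real.norm_eq_abs] at this
        linarith
      simp [hR _ this]

/-- The squared line integral is a double integral of conj g(p + sθ) g(p + (s+τ)θ). Integrating over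
p and s recombines to an integral over V, leaving the autocorrelation at τθ. The nonnegativity shows
that the truncation by `ENNReal.ofReal` in `xrayEnergy` loses nothing. -/
lemma lintegral_xray_sq {g : V → ℂ} (hgm : Measurable g) (hg2 : MemLp g 2)
    {R : ℝ} (hR : ∀ x, R < ‖x‖ → g x = 0) {θ : V} (hθ : ‖θ‖ = 1) :
    0 ≤ (∫ τ : ℝ, autocorrelation g (τ • θ)).re ∧
    ∫⁻ p : (Submodule.span ℝ {θ})ᗮ, ‖∫ s : ℝ, g (p + s • θ)‖ₑ ^ 2 = xrayEnergy g θ := by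
  have hmp := measurePreserving_line_add hθ
  set E := (Submodule.span ℝ {θ})ᗮ with hE
  have hH := integrable_mul_translate_line hgm hg2 hR hθ
  have hmp2 : MeasurePreserving
      (fun w : (E × ℝ) × ℝ => (((w.1.1 : V) + w.1.2 • θ, w.2) : V × ℝ))
      ((volume.prod volume).prod volume) (volume.prod volume) :=
    hmp.prod (MeasurePreserving.id volume)
  have hH2 : Integrable (fun w : (E × ℝ) × ℝ => (starRingEnd ℂ) (g ((w.1.1 : V) + w.1.2 • θ)) *
      g ((w.1.1 : V) + w.1.2 • θ + w.2 • θ)) ((volume.prod volume).prod volume) :=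
    hmp2.integrable_comp_of_integrable hH
  have hX : ∀ p : E, ∫ s : ℝ, ∫ τ : ℝ, (starRingEnd ℂ) (g ((p : V) + s • θ)) *
      g ((p : V) + s • θ + τ • θ) = ((‖∫ s : ℝ, g (p + s • θ)‖ ^ 2 : ℝ) : ℂ) := by
    intro p
    have h1 : ∀ s : ℝ, ∫ τ : ℝ, (starRingEnd ℂ) (g ((p : V) + s • θ)) *
        g ((p : V) + s • θ + τ • θ) =
        (starRingEnd ℂ) (g ((p : V) + s • θ)) * ∫ s : ℝ, g (p + s • θ) := by
      intro s
      rw [integral_const_mul, ← integral_add_left_eq_self (fun s : ℝ => g ((p : V) + s • θ)) s]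
      simp only [add_smul, add_assoc]
    simp only [h1]
    rw [integral_mul_const, integral_conj, ← Complex.normSq_eq_norm_sq, ← Complex.mul_conj, mul_comm]
  have hint := hH2.integral_prod_left
  have hpi : Integrable fun p : E => ((‖∫ s : ℝ, g (p + s • θ)‖ ^ 2 : ℝ) : ℂ) :=
    hint.integral_prod_left.congr (ae_of_all _ hX)
  have hval : ((∫ p : E, ‖∫ s : ℝ, g (p + s • θ)‖ ^ 2 : ℝ) : ℂ) =
      ∫ τ : ℝ, autocorrelation g (τ • θ) := by
    rw [← integral_complex_ofReal, ← integral_congr_ae (ae_of_all _ hX)]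
    rw [← integral_prod (fun w : E × ℝ => ∫ τ : ℝ, (starRingEnd ℂ) (g ((w.1 : V) + w.2 • θ)) *
      g ((w.1 : V) + w.2 • θ + τ • θ)) hint]
    rw [← integral_prod (fun w : (E × ℝ) × ℝ => (starRingEnd ℂ) (g ((w.1.1 : V) + w.1.2 • θ)) *
      g ((w.1.1 : V) + w.1.2 • θ + w.2 • θ)) hH2]
    have h2 : ∫ w : (E × ℝ) × ℝ, (starRingEnd ℂ) (g ((w.1.1 : V) + w.1.2 • θ)) *
        g ((w.1.1 : V) + w.1.2 • θ + w.2 • θ) ∂((volume.prod volume).prod volume) =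
        ∫ z : V × ℝ, (starRingEnd ℂ) (g z.1) * g (z.1 + z.2 • θ) ∂(volume.prod volume) := by
      rw [← hmp2.map_eq, integral_map hmp2.aemeasurable]
      rw [hmp2.map_eq]
      exact hH.1
    rw [h2, integral_prod_symm _ hH]
    rfl
  have hre : (∫ τ : ℝ, autocorrelation g (τ • θ)).re = ∫ p : E, ‖∫ s : ℝ, g (p + s • θ)‖ ^ 2 := by
    rw [← hval, Complex.ofReal_re]
  refine ⟨hre ▸ integral_nonneg fun p => by positivity, ?_⟩
  have hpi' : Integrable fun p : E => ‖∫ s : ℝ, g (p + s • θ)‖ ^ 2 := hpi.re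
  rw [xrayEnergy, hre, ofReal_integral_eq_lintegral_ofReal hpi' (ae_of_all _ fun p => by
    simp only [Pi.zero_apply]; positivity)]
  exact lintegral_congr fun p => enorm_sq_eq_ofReal _

lemma measurable_xrayEnergy {g : V → ℂ} (hg2 : MemLp g 2)
    {R : ℝ} (hR : ∀ x, R < ‖x‖ → g x = 0) : Measurable (xrayEnergy g) := by
  have hg := integrable_of_ae_eq_zero_outside hg2 (ae_of_all _ hR)
  have hc := continuous_autocorrelation hg hg2
  refine ENNReal.measurable_ofReal.comp (Complex.measurable_re.comp ?_)
  have : StronglyMeasurable fun z : V × ℝ => autocorrelation g (z.2 • z.1) :=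
    (hc.comp (by fun_prop)).stronglyMeasurable
  exact this.integral_prod_right.measurable

/-- The X-ray transform is, up to a constant, an isometry from `Ḣ^{-1/2}` to `L²`. -/
lemma lintegral_xrayEnergy (hV : 2 ≤ Module.finrank ℝ V) {g : V → ℂ} (hgm : Measurable g)
    (hg2 : MemLp g 2) {R : ℝ} (hR : ∀ x, R < ‖x‖ → g x = 0) :
    ∫⁻ θ, xrayEnergy g θ ∂(sphereMeasure V) =
      ENNReal.ofReal (2 / rieszConst (Module.finrank ℝ V)) * ∫⁻ ξ, ‖𝓕 g ξ‖ₑ ^ 2 / ‖ξ‖ₑ := by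
  have : Nontrivial V := Module.nontrivial_of_finrank_pos (R := ℝ) (by omega)
  have hg := integrable_of_ae_eq_zero_outside hg2 (ae_of_all _ hR)
  have hc := continuous_autocorrelation hg hg2
  have hcpos := rieszConst_pos hV
  set n := Module.finrank ℝ V with hn
  rw [← integral_autocorrelation_riesz hV hg2 hR, ← hn, ← ENNReal.ofReal_mul (by positivity),
    ← mul_assoc, div_mul_cancel₀ _ hcpos.ne']
  have hAk := integrable_bounded_mul_rieszKernel hV hc (norm_autocorrelation_le hg hg2)
    (fun z hz => autocorrelation_eq_zero hR hz)
  rw [← hn] at hAk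
  have hfi : Integrable fun z => (autocorrelation g z).re * (‖z‖ ^ (n - 1))⁻¹ := by
    have hm := hc.measurable
    refine hAk.mono' (by fun_prop) (ae_of_all _ fun z => ?_)
    rw [norm_mul, Real.norm_of_nonneg (r := (‖z‖ ^ (n - 1))⁻¹) (by positivity)]
    gcongr
    exact Complex.abs_re_le_norm _
  obtain ⟨h1, h2⟩ := integral_polar hfi
  rw [← hn] at h1 h2
  -- The real part of the autocorrelation is even, so the integral over the whole line is twice that
  -- over the half line. This is the 2 in the constant. The Riesz kernel cancels r^{n-1}.
  have hline : ∀ᵐ θ ∂(sphereMeasure V), (∫ τ : ℝ, autocorrelation g (τ • θ)).re =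
      2 * ∫ r in Ioi (0 : ℝ), r ^ (n - 1) * ((autocorrelation g (r • θ)).re *
        (‖r • θ‖ ^ (n - 1))⁻¹) := by
    filter_upwards [ae_norm_eq_one_sphereMeasure] with θ hθ
    have h3 : ∀ r ∈ Ioi (0 : ℝ), r ^ (n - 1) * ((autocorrelation g (r • θ)).re *
        (‖r • θ‖ ^ (n - 1))⁻¹) = (autocorrelation g (r • θ)).re := by
      intro r hr
      have hr : 0 < r := hr
      rw [norm_smul, hθ, mul_one, Real.norm_of_nonneg hr.le]
      field_simp
    rw [setIntegral_congr_fun measurableSet_Ioi h3, ← integral_comp_abs]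
    have h4 : Integrable fun τ : ℝ => autocorrelation g (τ • θ) :=
      (integrable_mul_translate_line hgm hg2 hR hθ).integral_prod_right
    have h5 := integral_re h4
    simp only [RCLike.re_to_complex] at h5
    rw [← h5]
    refine integral_congr_ae (ae_of_all _ fun τ => ?_)
    simp only
    rcases abs_cases τ with ⟨h, _⟩ | ⟨h, _⟩
    · rw [h]
    · rw [h, neg_smul, autocorrelation_neg, Complex.conj_re]
  rw [h2, ← integral_const_mul, ofReal_integral_eq_lintegral_ofReal (h1.const_mul 2)]
  · refine lintegral_congr_ae ?_
    filter_upwards [hline] with θ hθ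
    rw [xrayEnergy, hθ]
  · filter_upwards [hline, ae_norm_eq_one_sphereMeasure] with θ hθ hθ1
    rw [Pi.zero_apply, ← hθ]
    exact (lintegral_xray_sq hgm hg2 hR hθ1).1

end XrayTransform

/-! ### The power series of exp(λ arcsin u). -/

section ExpArcsin

lemma summable_succ_pow_mul_geometric (p : ℕ) {r : ℝ} (h0 : 0 < r) (h1 : r < 1) :
    Summable fun k : ℕ => ((k : ℝ) + 1) ^ p * r ^ k := by
  have h := summable_pow_mul_geometric_of_norm_lt_one p (r := r) (by rwa [Real.norm_of_nonneg h0.le])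
  have h2 := ((summable_nat_add_iff 1).2 h).mul_right r⁻¹
  refine h2.congr fun k => ?_
  push_cast
  rw [pow_succ]
  field_simp

lemma hasDerivAt_tsum_powers {b : ℕ → ℝ} {M : ℝ} {m : ℕ} (hb : ∀ k, |b k| ≤ M * ((k : ℝ) + 1) ^ m)
    {u : ℝ} (hu : |u| < 1) :
    HasDerivAt (fun x => ∑' k, b k * x ^ k) (∑' k : ℕ, ((k : ℝ) + 1) * b (k + 1) * u ^ k) u := by
  have hM : 0 ≤ M := by simpa using (abs_nonneg _).trans (hb 0)
  set ρ := (1 + |u|) / 2 with hρ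
  have hρ0 : 0 < ρ := by positivity
  have hρ1 : ρ < 1 := by rw [hρ]; linarith
  have huρ : |u| < ρ := by rw [hρ]; linarith
  have hs : Summable fun k : ℕ => M * ((k : ℝ) + 1) ^ m * (k * ρ ^ (k - 1)) := by
    rw [← summable_nat_add_iff 1]
    refine Summable.of_nonneg_of_le (fun k => by positivity) (fun k => ?_)
      ((summable_succ_pow_mul_geometric (m + 1) hρ0 hρ1).mul_left (M * 2 ^ m))
    have h1 : ((k + 1 : ℕ) : ℝ) + 1 ≤ 2 * ((k : ℝ) + 1) := by push_cast; linarith [k.cast_nonneg (α := ℝ)]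
    rw [Nat.add_sub_cancel]
    calc M * (((k + 1 : ℕ) : ℝ) + 1) ^ m * (((k + 1 : ℕ) : ℝ) * ρ ^ k)
        ≤ M * (2 * ((k : ℝ) + 1)) ^ m * (((k + 1 : ℕ) : ℝ) * ρ ^ k) := by gcongr
      _ = _ := by push_cast; rw [mul_pow]; ring
  have key := hasDerivAt_tsum_of_isPreconnected (𝕜 := ℝ) (t := Ioo (-ρ) ρ)
    (g := fun k x => b k * x ^ k) (g' := fun k x => b k * (k * x ^ (k - 1))) (y₀ := 0) (y := u)
    hs isOpen_Ioo isPreconnected_Ioo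
    (fun k y _ => (hasDerivAt_pow k y).const_mul _) (fun k y hy => by
      rw [norm_mul, norm_mul, norm_pow, Real.norm_eq_abs, Real.norm_eq_abs, Real.norm_eq_abs,
        Nat.abs_cast]
      gcongr
      · exact hb k
      · exact abs_le.2 ⟨hy.1.le, hy.2.le⟩) (by simp [hρ0])
    (by
      refine summable_of_ne_finset_zero (s := {0}) fun k hk => ?_
      simp at hk
      simp [hk]) (abs_lt.1 huρ)
  refine key.congr_deriv ?_
  have hs2 : Summable fun k : ℕ => b k * (k * u ^ (k - 1)) := by
    refine Summable.of_norm_bounded hs fun k => ?_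
    rw [norm_mul, norm_mul, norm_pow, Real.norm_eq_abs, Real.norm_eq_abs, Real.norm_eq_abs,
      Nat.abs_cast]
    gcongr
    exact hb k
  rw [hs2.tsum_eq_zero_add]
  simp only [Nat.cast_zero, zero_mul, mul_zero, zero_add]
  refine tsum_congr fun k => ?_
  rw [Nat.add_sub_cancel]; push_cast; ring

/-- The Taylor coefficients of `u ↦ exp (lam * arcsin u)`. -/
def expArcsinCoeff (lam : ℝ) : ℕ → ℝ
  | 0 => 1
  | 1 => lam
  | k + 2 => expArcsinCoeff lam k * ((k : ℝ) ^ 2 + lam ^ 2) / (((k : ℝ) + 1) * ((k : ℝ) + 2))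

lemma expArcsinCoeff_nonneg {lam : ℝ} (h0 : 0 ≤ lam) : ∀ k, 0 ≤ expArcsinCoeff lam k
  | 0 => by simp [expArcsinCoeff]
  | 1 => by simpa [expArcsinCoeff] using h0
  | k + 2 => by
    have := expArcsinCoeff_nonneg h0 k
    rw [expArcsinCoeff]; positivity

/-- The recurrence multiplies by a ratio at most 1, starting from λ and λ²/2. A bound by λ, and not
only by 1, is what makes the perturbation small. -/
lemma expArcsinCoeff_succ_le {lam : ℝ} (h0 : 0 ≤ lam) (h1 : lam ≤ 1) :
    ∀ k, expArcsinCoeff lam (k + 1) ≤ lam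
  | 0 => by simp [expArcsinCoeff]
  | 1 => by simp [expArcsinCoeff]; nlinarith
  | k + 2 => by
    have ih := expArcsinCoeff_succ_le h0 h1 k
    have hn := expArcsinCoeff_nonneg h0 (k + 1)
    rw [show k + 2 + 1 = (k + 1) + 2 from rfl, expArcsinCoeff, div_le_iff₀ (by positivity)]
    have hk : (0 : ℝ) ≤ ((k + 1 : ℕ) : ℝ) := by positivity
    refine mul_le_mul ih ?_ (by positivity) h0
    nlinarith

lemma expArcsinCoeff_abs_le {lam : ℝ} (h0 : 0 ≤ lam) (h1 : lam ≤ 1) (k : ℕ) :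
    |expArcsinCoeff lam k| ≤ 1 := by
  rw [abs_of_nonneg (expArcsinCoeff_nonneg h0 k)]
  rcases k with _ | k
  · simp [expArcsinCoeff]
  · exact (expArcsinCoeff_succ_le h0 h1 k).trans h1

/-- The recurrence says that the series S solves (1 − x²)S'' − xS' = λ²S, so G(t) = S(sin t) solves
G'' = λ²G with G(0) = 1 and G'(0) = λ. Uniqueness is done in two first-order steps: (G' − λG)e^{λt}
is constant, hence zero, and then G e^{-λt} is constant. -/
lemma tsum_expArcsinCoeff {lam : ℝ} (h0 : 0 ≤ lam) (h1 : lam ≤ 1) {u : ℝ} (hu : |u| < 1) :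
    ∑' k, expArcsinCoeff lam k * u ^ k = Real.exp (lam * Real.arcsin u) := by
  set c := expArcsinCoeff lam with hc
  set S : ℝ → ℝ := fun x => ∑' k, c k * x ^ k with hS
  set S1 : ℝ → ℝ := fun x => ∑' k : ℕ, ((k : ℝ) + 1) * c (k + 1) * x ^ k with hS1
  set S2 : ℝ → ℝ := fun x => ∑' k : ℕ, ((k : ℝ) + 1) * ((((k + 1 : ℕ) : ℝ) + 1) * c (k + 1 + 1)) * x ^ k with hS2
  have hcb := expArcsinCoeff_abs_le h0 h1
  have hd : ∀ {x : ℝ}, |x| < 1 → HasDerivAt S (S1 x) x := fun hx =>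
    hasDerivAt_tsum_powers (M := 1) (m := 0) (fun k => by simpa using hcb k) hx
  have hd1 : ∀ {x : ℝ}, |x| < 1 → HasDerivAt S1 (S2 x) x := fun hx =>
    hasDerivAt_tsum_powers (b := fun k : ℕ => ((k : ℝ) + 1) * c (k + 1)) (M := 1) (m := 1) (fun k => by
      rw [abs_mul, abs_of_nonneg (by positivity : (0 : ℝ) ≤ (k : ℝ) + 1), one_mul, pow_one]
      exact mul_le_of_le_one_right (by positivity) (hcb _)) hx
  have hsum : ∀ (p : ℕ) {b : ℕ → ℝ} {x : ℝ}, |x| < 1 → (∀ k, |b k| ≤ 2 * ((k : ℝ) + 1) ^ p) →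
      Summable fun k => b k * x ^ k := by
    intro p b x hx hb
    have hρ1 : (1 + |x|) / 2 < 1 := by linarith
    refine Summable.of_norm_bounded ((summable_succ_pow_mul_geometric p (r := (1 + |x|) / 2)
      (by positivity) hρ1).mul_left 2) fun k => ?_
    rw [norm_mul, norm_pow, Real.norm_eq_abs, Real.norm_eq_abs, ← mul_assoc]
    gcongr
    · exact hb k
    · linarith
  have hode : ∀ {x : ℝ}, |x| < 1 → (1 - x ^ 2) * S2 x - x * S1 x = lam ^ 2 * S x := by
    intro x hx
    have e2 : S2 x = ∑' k : ℕ, (c k * ((k : ℝ) ^ 2 + lam ^ 2)) * x ^ k := by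
      refine tsum_congr fun k => ?_
      rw [show k + 1 + 1 = k + 2 from rfl, hc, expArcsinCoeff]
      push_cast
      have : (k : ℝ) + 1 ≠ 0 := by positivity
      have : (k : ℝ) + 2 ≠ 0 := by positivity
      field_simp
      ring
    have s1 : Summable fun k : ℕ => ((k : ℝ) * c k) * x ^ k := hsum 1 hx fun k => by
      rw [abs_mul, Nat.abs_cast, pow_one]
      have := hcb k
      nlinarith [abs_nonneg (c k), k.cast_nonneg (α := ℝ)]
    have s2 : Summable fun k : ℕ => ((k : ℝ) * ((k : ℝ) - 1) * c k) * x ^ k := hsum 2 hx fun k => by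
      have := hcb k
      rw [abs_mul, abs_mul, Nat.abs_cast]
      have h3 : |(k : ℝ) - 1| ≤ k + 1 := abs_le.2 ⟨by linarith [k.cast_nonneg (α := ℝ)], by linarith⟩
      calc (k : ℝ) * |(k : ℝ) - 1| * |c k| ≤ (k + 1) * (k + 1) * 1 := by gcongr; linarith
        _ ≤ _ := by nlinarith [k.cast_nonneg (α := ℝ)]
    have s0 : Summable fun k : ℕ => c k * x ^ k := hsum 0 hx fun k => by
      have := hcb k; simp only [pow_zero]; linarith
    have e1 : x * S1 x = ∑' k : ℕ, ((k : ℝ) * c k) * x ^ k := by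
      rw [s1.tsum_eq_zero_add, hS1, ← tsum_mul_left]
      simp only [Nat.cast_zero, zero_mul, zero_add]
      refine tsum_congr fun k => ?_
      push_cast; ring
    have e3 : x ^ 2 * S2 x = ∑' k : ℕ, ((k : ℝ) * ((k : ℝ) - 1) * c k) * x ^ k := by
      rw [s2.tsum_eq_zero_add, ((summable_nat_add_iff 1).2 s2).tsum_eq_zero_add, hS2, ← tsum_mul_left]
      simp only [Nat.cast_zero, zero_mul, zero_add, Nat.cast_one, sub_self, mul_zero]
      refine tsum_congr fun k => ?_
      push_cast; ring
    rw [sub_mul, one_mul, e1, e3, e2, hS]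
    rw [← tsum_mul_left, ← Summable.tsum_sub, ← Summable.tsum_sub]
    · refine tsum_congr fun k => by ring
    · refine ((s2.add s1).add (s0.mul_left (lam ^ 2))).sub s2 |>.congr fun k => by ring
    · exact s1
    · refine ((s2.add s1).add (s0.mul_left (lam ^ 2))).congr fun k => by ring
    · exact s2
  set I := Ioo (-(Real.pi / 2)) (Real.pi / 2) with hI
  have hsin : ∀ {t : ℝ}, t ∈ I → |Real.sin t| < 1 := by
    intro t ht
    have := Real.cos_pos_of_mem_Ioo ht
    rw [abs_lt]
    constructor <;> nlinarith [Real.sin_sq_add_cos_sq t]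
  have hG : ∀ {t : ℝ}, t ∈ I → HasDerivAt (fun t => S (Real.sin t)) (S1 (Real.sin t) * Real.cos t) t :=
    fun ht => (hd (hsin ht)).comp _ (Real.hasDerivAt_sin _)
  have hG1 : ∀ {t : ℝ}, t ∈ I → HasDerivAt (fun t => S1 (Real.sin t) * Real.cos t)
      (lam ^ 2 * S (Real.sin t)) t := by
    intro t ht
    have h := ((hd1 (hsin ht)).comp _ (Real.hasDerivAt_sin _)).mul (Real.hasDerivAt_cos t)
    refine h.congr_deriv ?_
    rw [← hode (hsin ht), ← Real.cos_sq']
    simp only [Function.comp]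
    ring
  have hexp : ∀ (a t : ℝ), HasDerivAt (fun t => Real.exp (a * t)) (a * Real.exp (a * t)) t := by
    intro a t
    have := ((hasDerivAt_id t).const_mul a).exp
    simpa [mul_comm] using this
  have h0I : (0 : ℝ) ∈ I := ⟨by linarith [Real.pi_pos], by linarith [Real.pi_pos]⟩
  have hS0 : S 0 = 1 := by
    rw [hS]; simp only
    rw [tsum_eq_single 0 fun k hk => by simp [hk]]
    simp [hc, expArcsinCoeff]
  have hS10 : S1 0 = lam := by
    rw [hS1]; simp only
    rw [tsum_eq_single 0 fun k hk => by simp [hk]]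
    simp [hc, expArcsinCoeff]
  have hH : ∀ {t : ℝ}, t ∈ I → S1 (Real.sin t) * Real.cos t = lam * S (Real.sin t) := by
    intro t ht
    have hderiv : ∀ s ∈ I, HasDerivAt (fun s => (S1 (Real.sin s) * Real.cos s - lam * S (Real.sin s)) *
        Real.exp (lam * s)) 0 s := by
      intro s hs
      refine (((hG1 hs).sub ((hG hs).const_mul lam)).mul (hexp lam s)).congr_deriv ?_
      simp only [Pi.sub_apply]
      ring
    have := isOpen_Ioo.is_const_of_deriv_eq_zero isPreconnected_Ioo
      (fun s hs => (hderiv s hs).differentiableAt.differentiableWithinAt)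
      (fun s hs => (hderiv s hs).deriv) ht h0I
    simp only [Real.sin_zero, Real.cos_zero, hS0, hS10, mul_one, sub_self, zero_mul,
      mul_eq_zero, Real.exp_ne_zero, or_false] at this
    linarith
  have hfin : ∀ {t : ℝ}, t ∈ I → S (Real.sin t) = Real.exp (lam * t) := by
    intro t ht
    have hderiv : ∀ s ∈ I, HasDerivAt (fun s => S (Real.sin s) * Real.exp (-lam * s)) 0 s := by
      intro s hs
      refine ((hG hs).mul (hexp (-lam) s)).congr_deriv ?_
      rw [hH hs]; ring
    have := isOpen_Ioo.is_const_of_deriv_eq_zero isPreconnected_Ioo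
      (fun s hs => (hderiv s hs).differentiableAt.differentiableWithinAt)
      (fun s hs => (hderiv s hs).deriv) ht h0I
    simp only [Real.sin_zero, hS0, mul_zero, Real.exp_zero, mul_one] at this
    rw [neg_mul, Real.exp_neg] at this
    field_simp at this
    exact this
  obtain ⟨hu1, hu2⟩ := abs_lt.1 hu
  have hmem : Real.arcsin u ∈ I := ⟨Real.neg_pi_div_two_lt_arcsin.2 hu1, Real.arcsin_lt_pi_div_two.2 hu2⟩
  have := hfin hmem
  rwa [Real.sin_arcsin hu1.le hu2.le] at this

end ExpArcsin

section Cap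

open FourierTransform SchwartzMap

/-! ### Equivalence of the X-ray energy with the H^{-1/2} norm. -/

section Comparison

variable {V : Type*} [NormedAddCommGroup V] [InnerProductSpace ℝ V] [FiniteDimensional ℝ V]
  [MeasurableSpace V] [BorelSpace V]

/-- Immediate from the energy identity, since 1/(1+|ξ|) ≤ 1/|ξ|. -/
lemma negHalfNorm_le_xrayEnergy (hV : 2 ≤ Module.finrank ℝ V) {g : V → ℂ} (hgm : Measurable g)
    (hg2 : MemLp g 2) {R : ℝ} (hR : ∀ x, R < ‖x‖ → g x = 0) :
    ENNReal.ofReal (2 / rieszConst (Module.finrank ℝ V)) * fourierNegHalfNormSq (hg2.toLp g) ≤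
      ∫⁻ θ, xrayEnergy g θ ∂(sphereMeasure V) := by
  have hg := integrable_of_ae_eq_zero_outside hg2 (ae_of_all _ hR)
  rw [lintegral_xrayEnergy hV hgm hg2 hR]
  gcongr
  refine lintegral_mono_ae ?_
  filter_upwards [fourier_toLp_ae_eq hg hg2] with ξ hξ
  rw [hξ]
  gcongr
  exact le_add_self

/-- The converse depends on the radius of the support, through the control of low frequencies. -/
lemma exists_xrayEnergy_le_negHalfNorm (V : Type*) [NormedAddCommGroup V] [InnerProductSpace ℝ V]
    [FiniteDimensional ℝ V] [MeasurableSpace V] [BorelSpace V] (hV : 2 ≤ Module.finrank ℝ V)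
    (R : ℝ) : ∃ C : ℝ≥0∞, C ≠ ⊤ ∧ ∀ {g : V → ℂ} (_ : Measurable g) (hg2 : MemLp g 2)
      (_ : ∀ x, R < ‖x‖ → g x = 0),
      ∫⁻ θ, xrayEnergy g θ ∂(sphereMeasure V) ≤ C * fourierNegHalfNormSq (hg2.toLp g) := by
  obtain ⟨C, hC, h⟩ := exists_homogeneous_le_negHalfNorm V hV R
  refine ⟨ENNReal.ofReal (2 / rieszConst (Module.finrank ℝ V)) * C, by finiteness,
    fun {g} hgm hg2 hR => ?_⟩
  have hg := integrable_of_ae_eq_zero_outside hg2 (ae_of_all _ hR)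
  rw [lintegral_xrayEnergy hV hgm hg2 hR, mul_assoc]
  gcongr
  refine le_trans (lintegral_mono_ae ?_) (h (hg2.toLp g) ?_)
  · filter_upwards [fourier_toLp_ae_eq hg hg2] with ξ hξ
    rw [hξ]
  · filter_upwards [hg2.coeFn_toLp] with x hx hxR
    rw [hx, hR x hxR]

end Comparison

/-! ### Tensor powers. -/

section Monomials

variable {d : ℕ}

/-- The entries of the tensor power `x^{⊗ k}`. -/
def tensorEntry {k : ℕ} (J : Fin k → Fin d) (x : Euc d) : ℝ := ∏ i, x (J i)

lemma sum_tensorEntry_mul (k : ℕ) (x y : Euc d) :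
    ∑ J : Fin k → Fin d, tensorEntry J x * tensorEntry J y = (inner ℝ x y) ^ k := by
  have h : inner ℝ x y = ∑ i, x i * y i := by
    rw [PiLp.inner_apply]
    exact Finset.sum_congr rfl fun i _ => by simp [mul_comm]
  rw [h, Fintype.sum_pow]
  exact Finset.sum_congr rfl fun J _ => by rw [tensorEntry, tensorEntry, Finset.prod_mul_distrib]

lemma sum_tensorEntry_sq (k : ℕ) (x : Euc d) :
    ∑ J : Fin k → Fin d, tensorEntry J x ^ 2 = (‖x‖ ^ 2) ^ k := by
  rw [← real_inner_self_eq_norm_sq, ← sum_tensorEntry_mul]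
  exact Finset.sum_congr rfl fun J _ => sq _

/-- With m = k + 1, the left side is (|x|^m − |y|^m)² + 2((|x||y|)^m − ⟨x,y⟩^m). Scalar mean value
bounds apply to both terms, and the identity |x−y|² = (|x|−|y|)² + 2(|x||y| − ⟨x,y⟩) reassembles
them. The Lipschitz constant is thus the scalar one, without a factor d^m. -/
lemma sum_tensorEntry_sub_sq_le (k : ℕ) {x y : Euc d} {ρ : ℝ} (hx : ‖x‖ ≤ ρ) (hy : ‖y‖ ≤ ρ) :
    ∑ J : Fin (k + 1) → Fin d, (tensorEntry J x - tensorEntry J y) ^ 2 ≤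
      (((k : ℝ) + 1) * ρ ^ k) ^ 2 * ‖x - y‖ ^ 2 := by
  have hρ : 0 ≤ ρ := (norm_nonneg x).trans hx
  have h1 : ∑ J : Fin (k + 1) → Fin d, (tensorEntry J x - tensorEntry J y) ^ 2 =
      (‖x‖ ^ (k + 1) - ‖y‖ ^ (k + 1)) ^ 2 +
        2 * ((‖x‖ * ‖y‖) ^ (k + 1) - (inner ℝ x y) ^ (k + 1)) := by
    have : ∀ J : Fin (k + 1) → Fin d, (tensorEntry J x - tensorEntry J y) ^ 2 =
        tensorEntry J x ^ 2 + tensorEntry J y ^ 2 - 2 * (tensorEntry J x * tensorEntry J y) :=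
      fun J => by ring
    simp only [this]
    rw [Finset.sum_sub_distrib, Finset.sum_add_distrib, ← Finset.mul_sum, sum_tensorEntry_sq,
      sum_tensorEntry_sq, sum_tensorEntry_mul, mul_pow]
    ring
  have hpow : ∀ (a b τ : ℝ), |a| ≤ τ → |b| ≤ τ → |a ^ (k + 1) - b ^ (k + 1)| ≤
      ((k : ℝ) + 1) * τ ^ k * |a - b| := by
    intro a b τ ha hb
    have h := abs_pow_sub_pow_le a b (k + 1)
    refine h.trans ?_
    rw [Nat.add_sub_cancel]
    calc |a - b| * ((k + 1 : ℕ) : ℝ) * max |a| |b| ^ k ≤ |a - b| * ((k + 1 : ℕ) : ℝ) * τ ^ k := by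
          gcongr
          exact max_le ha hb
      _ = _ := by push_cast; ring
  have h2 : (‖x‖ ^ (k + 1) - ‖y‖ ^ (k + 1)) ^ 2 ≤ (((k : ℝ) + 1) * ρ ^ k) ^ 2 * (‖x‖ - ‖y‖) ^ 2 := by
    rw [← mul_pow, ← sq_abs, ← sq_abs (_ * _), abs_mul, abs_of_nonneg (a := ((k : ℝ) + 1) * ρ ^ k)
      (by positivity)]
    gcongr
    exact hpow _ _ _ (by rwa [abs_norm]) (by rwa [abs_norm])
  have hxy := abs_real_inner_le_norm x y
  have hprod : ‖x‖ * ‖y‖ ≤ ρ ^ 2 := by rw [sq]; gcongr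
  have h3 : (‖x‖ * ‖y‖) ^ (k + 1) - (inner ℝ x y) ^ (k + 1) ≤
      (((k : ℝ) + 1) * ρ ^ k) ^ 2 * (‖x‖ * ‖y‖ - inner ℝ x y) := by
    have h0 : 0 ≤ ‖x‖ * ‖y‖ - inner ℝ x y := by linarith [le_abs_self (inner ℝ x y)]
    refine (le_abs_self _).trans ((hpow _ _ (ρ ^ 2) ?_ (hxy.trans hprod)).trans ?_)
    · rwa [abs_of_nonneg (by positivity)]
    · rw [abs_of_nonneg h0]
      gcongr
      rw [mul_pow, ← pow_mul, ← pow_mul, mul_comm 2 k]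
      gcongr
      nlinarith [k.cast_nonneg (α := ℝ)]
  rw [h1]
  have h4 : ‖x - y‖ ^ 2 = ‖x‖ ^ 2 - 2 * inner ℝ x y + ‖y‖ ^ 2 := norm_sub_sq_real x y
  calc _ ≤ (((k : ℝ) + 1) * ρ ^ k) ^ 2 * (‖x‖ - ‖y‖) ^ 2 +
        2 * ((((k : ℝ) + 1) * ρ ^ k) ^ 2 * (‖x‖ * ‖y‖ - inner ℝ x y)) := by gcongr
    _ = _ := by rw [h4]; ring

lemma continuous_tensorEntry {k : ℕ} (J : Fin k → Fin d) : Continuous (tensorEntry J) := by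
  unfold tensorEntry; fun_prop

end Monomials

/-! ### The horizontal vector field and its truncation. -/

section Chart

variable {V : Type*} [NormedAddCommGroup V] [InnerProductSpace ℝ V] [FiniteDimensional ℝ V]
  [MeasurableSpace V] [BorelSpace V]

/-- The horizontal part of the point of the hemisphere with gnomonic coordinate `y`. -/
def horizontal (y : V) : V := (√(1 + ‖y‖ ^ 2))⁻¹ • y

lemma abs_sqrt_one_add_sub_le (y z : V) :
    |√(1 + ‖y‖ ^ 2) - √(1 + ‖z‖ ^ 2)| ≤ ‖y - z‖ := by
  have h1 := one_le_sqrt_one_add y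
  have h2 := one_le_sqrt_one_add z
  have e1 := Real.sq_sqrt (show 0 ≤ 1 + ‖y‖ ^ 2 by positivity)
  have e2 := Real.sq_sqrt (show 0 ≤ 1 + ‖z‖ ^ 2 by positivity)
  have g1 : ‖y‖ ≤ √(1 + ‖y‖ ^ 2) := Real.le_sqrt_of_sq_le (by linarith)
  have g2 : ‖z‖ ≤ √(1 + ‖z‖ ^ 2) := Real.le_sqrt_of_sq_le (by linarith)
  refine le_trans ?_ (abs_norm_sub_norm_le y z)
  have h3 : |√(1 + ‖y‖ ^ 2) - √(1 + ‖z‖ ^ 2)| * (√(1 + ‖y‖ ^ 2) + √(1 + ‖z‖ ^ 2)) =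
      |‖y‖ - ‖z‖| * (‖y‖ + ‖z‖) := by
    rw [← abs_of_nonneg (show 0 ≤ √(1 + ‖y‖ ^ 2) + √(1 + ‖z‖ ^ 2) by positivity), ← abs_mul,
      ← abs_of_nonneg (show 0 ≤ ‖y‖ + ‖z‖ by positivity), ← abs_mul]
    congr 1
    nlinarith
  have h4 : 0 < √(1 + ‖y‖ ^ 2) + √(1 + ‖z‖ ^ 2) := by positivity
  refine le_of_mul_le_mul_right ?_ h4
  rw [h3]
  gcongr

lemma norm_div_sub_div_le {D : V → ℝ} {l : ℝ} (hD1 : ∀ y, 1 ≤ D y) (hDn : ∀ y, ‖y‖ ≤ D y)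
    (hDl : ∀ y z, |D y - D z| ≤ l * ‖y - z‖) (y z : V) :
    ‖(D y)⁻¹ • y - (D z)⁻¹ • z‖ ≤ (1 + l) * ‖y - z‖ := by
  have hy : 0 < D y := zero_lt_one.trans_le (hD1 y)
  have hz : 0 < D z := zero_lt_one.trans_le (hD1 z)
  have h : (D y)⁻¹ • y - (D z)⁻¹ • z = (D y)⁻¹ • (y - z) + ((D y)⁻¹ * (D z)⁻¹ * (D z - D y)) • z := by
    have : (D y)⁻¹ * (D z)⁻¹ * (D z - D y) = (D y)⁻¹ - (D z)⁻¹ := by field_simp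
    rw [this, smul_sub, sub_smul]; abel
  rw [h]
  refine (norm_add_le _ _).trans ?_
  rw [norm_smul, norm_smul, norm_mul, norm_mul, Real.norm_of_nonneg (by positivity),
    Real.norm_of_nonneg (inv_pos.2 hz).le, Real.norm_eq_abs, abs_sub_comm]
  have h1 : (D y)⁻¹ ≤ 1 := inv_le_one_of_one_le₀ (hD1 y)
  have h2 : (D z)⁻¹ * ‖z‖ ≤ 1 := by
    rw [inv_mul_le_iff₀ hz, mul_one]; exact hDn z
  have h3 : 0 ≤ l * ‖y - z‖ := (abs_nonneg _).trans (hDl y z)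
  calc (D y)⁻¹ * ‖y - z‖ + (D y)⁻¹ * (D z)⁻¹ * |D y - D z| * ‖z‖
      = (D y)⁻¹ * ‖y - z‖ + (D y)⁻¹ * ((D z)⁻¹ * ‖z‖) * |D y - D z| := by ring
    _ ≤ 1 * ‖y - z‖ + 1 * 1 * (l * ‖y - z‖) := by
      gcongr
      exact hDl y z
    _ = _ := by ring

/-- The norm bound of the horizontal part on the ball of radius `R`. -/
def capRadius (R : ℝ) : ℝ := R / √(1 + R ^ 2)

lemma capRadius_pos {R : ℝ} (hR : 0 < R) : 0 < capRadius R := by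
  unfold capRadius; positivity

lemma capRadius_lt_one (R : ℝ) : capRadius R < 1 := by
  unfold capRadius
  rw [div_lt_one (by positivity)]
  exact Real.lt_sqrt_of_sq_lt (by linarith)

/-- The horizontal part, truncated outside the ball of radius `R`. -/
def truncatedHorizontal (R : ℝ) (y : V) : V :=
  (max (√(1 + ‖y‖ ^ 2)) (‖y‖ / capRadius R))⁻¹ • y

/-- The ratio |y|/√(1+|y|²) increases with |y|, so inside the ball the first entry of the maximum
wins. Outside, the second entry caps the norm at `capRadius R`. The multiplier theorem asks for
global bounds, and `horizontal` itself is only bounded by 1, which would give no geometric decay. -/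
lemma truncatedHorizontal_eq {R : ℝ} (hR : 0 < R) {y : V} (hy : ‖y‖ ≤ R) :
    truncatedHorizontal R y = horizontal y := by
  rw [truncatedHorizontal, horizontal, max_eq_left]
  rw [capRadius, div_div_eq_mul_div, div_le_iff₀ hR]
  refine abs_le_of_sq_le_sq' ?_ (by positivity) |>.2
  rw [mul_pow, mul_pow, Real.sq_sqrt (by positivity), Real.sq_sqrt (by positivity)]
  have : ‖y‖ ^ 2 ≤ R ^ 2 := by gcongr
  nlinarith

lemma norm_truncatedHorizontal_le {R : ℝ} (hR : 0 < R) (y : V) :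
    ‖truncatedHorizontal R y‖ ≤ capRadius R := by
  have hr := capRadius_pos hR
  have h1 := one_le_sqrt_one_add y
  have h2 : 0 < max (√(1 + ‖y‖ ^ 2)) (‖y‖ / capRadius R) :=
    zero_lt_one.trans_le (h1.trans (le_max_left _ _))
  rw [truncatedHorizontal, norm_smul, Real.norm_of_nonneg (inv_pos.2 h2).le, inv_mul_le_iff₀ h2,
    ← div_le_iff₀ hr]
  exact le_max_right _ _

lemma norm_truncatedHorizontal_sub_le {R : ℝ} (hR : 0 < R) (y z : V) :
    ‖truncatedHorizontal R y - truncatedHorizontal R z‖ ≤ (1 + (capRadius R)⁻¹) * ‖y - z‖ := by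
  have hr := capRadius_pos hR
  have hr1 := (capRadius_lt_one R).le
  refine norm_div_sub_div_le (D := fun y : V => max (√(1 + ‖y‖ ^ 2)) (‖y‖ / capRadius R))
    (fun y => (one_le_sqrt_one_add y).trans (le_max_left _ _)) (fun y => ?_) (fun y z => ?_) y z
  · refine le_trans ?_ (le_max_right _ _)
    rw [le_div_iff₀ hr]
    exact mul_le_of_le_one_right (norm_nonneg _) hr1
  · refine (abs_max_sub_max_le_max _ _ _ _).trans (max_le ?_ ?_)
    · refine (abs_sqrt_one_add_sub_le y z).trans (le_mul_of_one_le_left (norm_nonneg _) ?_)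
      exact (one_le_inv₀ hr).2 hr1
    · rw [← sub_div, abs_div, abs_of_pos hr, div_eq_inv_mul]
      gcongr
      exact abs_norm_sub_norm_le y z

lemma continuous_truncatedHorizontal {R : ℝ} (hR : 0 < R) :
    Continuous (truncatedHorizontal R : V → V) := by
  refine (LipschitzWith.of_dist_le_mul (K := ⟨1 + (capRadius R)⁻¹, ?_⟩) fun y z => ?_).continuous
  · have := capRadius_pos hR; positivity
  · rw [dist_eq_norm, dist_eq_norm]; exact norm_truncatedHorizontal_sub_le hR y z

end Chart

end Cap

/-! ### Attenuation as a small perturbation of the X-ray transform. -/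

section Perturbation

open FourierTransform SchwartzMap

lemma tsum_sq_le_weighted {v a : ℕ → ℝ≥0∞} (h0 : ∀ k, v k ≠ 0) (ht : ∀ k, v k ≠ ⊤) :
    (∑' k, a k) ^ 2 ≤ (∑' k, v k ^ 2) * ∑' k, (v k)⁻¹ ^ 2 * a k ^ 2 := by
  have h := lintegral_mul_sq_le (μ := Measure.count) (f := v) (g := fun k => (v k)⁻¹ * a k)
    (measurable_of_countable _).aemeasurable (measurable_of_countable _).aemeasurable
  simp only [lintegral_count, mul_pow] at h
  refine le_trans (le_of_eq ?_) h
  congr 1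
  refine tsum_congr fun k => ?_
  rw [← mul_assoc, ENNReal.mul_inv_cancel (h0 k) (ht k), one_mul]

lemma enorm_sum_mul_sq_le {ι : Type*} [Fintype ι] (b : ι → ℝ) (z : ι → ℂ)
    (hb : ∑ j, b j ^ 2 = 1) : ‖∑ j, (b j : ℂ) * z j‖ₑ ^ 2 ≤ ∑ j, ‖z j‖ₑ ^ 2 := by
  have h := norm_sum_mul_sq_le (fun j => (b j : ℂ)) z
  simp only [Complex.norm_real, Real.norm_eq_abs, sq_abs, hb, one_mul] at h
  simp only [enorm_sq_eq_ofReal]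
  rw [← ENNReal.ofReal_sum_of_nonneg fun j _ => by positivity]
  exact ENNReal.ofReal_le_ofReal h

variable {d : ℕ}

/-- Taylor expansion with coefficients at most λ, summed by a weighted Cauchy–Schwarz inequality
with weights √r^{k+1}. Their squares are summable, and their inverse squares r^{-(k+1)} are
outweighed by the size r^{2(k+1)} of the squared moments. On the right θ enters no integrand except
through the curve u, which later allows integration over all θ. -/
lemma integral_mul_exp_arcsin_sub {lam r : ℝ} (hl0 : 0 ≤ lam) (hl1 : lam ≤ 1) (hr0 : 0 < r)
    (hr1 : r < 1) {h : ℝ → ℂ} (hh : Integrable h) {u : ℝ → Euc d} (hum : Measurable u)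
    (hu : ∀ s, ‖u s‖ ≤ r) {θ : Euc d} (hθ : ‖θ‖ = 1) :
    ‖(∫ s, h s * (Real.exp (lam * Real.arcsin (inner ℝ (u s) θ)) : ℂ)) - ∫ s, h s‖ₑ ^ 2 ≤
      ENNReal.ofReal lam ^ 2 * ((∑' k : ℕ, ENNReal.ofReal (√r ^ (k + 1)) ^ 2) *
        ∑' k : ℕ, (ENNReal.ofReal (√r ^ (k + 1)))⁻¹ ^ 2 *
          ∑ J : Fin (k + 1) → Fin d, ‖∫ s, h s * (tensorEntry J (u s) : ℂ)‖ₑ ^ 2) := by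
  have hx : ∀ s, |inner ℝ (u s) θ| ≤ r := fun s => by
    refine (abs_real_inner_le_norm _ _).trans ?_
    rw [hθ, mul_one]; exact hu s
  have hxm : Measurable fun s => inner ℝ (u s) θ := by fun_prop
  have hcs := fun k => expArcsinCoeff_succ_le hl0 hl1 k
  have hcn := fun k => expArcsinCoeff_nonneg hl0 (lam := lam) k
  set c := expArcsinCoeff lam with hc
  have hser : ∀ s, h s * (Real.exp (lam * Real.arcsin (inner ℝ (u s) θ)) : ℂ) - h s =
      ∑' k : ℕ, h s * ((c (k + 1) * (inner ℝ (u s) θ) ^ (k + 1) : ℝ) : ℂ) := by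
    intro s
    have hx1 : |inner ℝ (u s) θ| < 1 := (hx s).trans_lt hr1
    have hsum : Summable fun k => c k * (inner ℝ (u s) θ) ^ k := by
      refine Summable.of_norm_bounded (summable_geometric_of_lt_one (abs_nonneg _) hx1) fun k => ?_
      rw [norm_mul, norm_pow, Real.norm_eq_abs, Real.norm_eq_abs]
      exact mul_le_of_le_one_left (by positivity) (expArcsinCoeff_abs_le hl0 hl1 k)
    have hc0 : c 0 = 1 := by
      have := tsum_expArcsinCoeff hl0 hl1 (u := 0) (by simp)
      rw [tsum_eq_single 0 (fun k hk => by simp [hk])] at this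
      simpa using this
    rw [← tsum_expArcsinCoeff hl0 hl1 hx1, hsum.tsum_eq_zero_add, tsum_mul_left]
    rw [hc0, ← Complex.ofReal_tsum]
    push_cast
    ring
  have hint1 : Integrable fun s => h s * (Real.exp (lam * Real.arcsin (inner ℝ (u s) θ)) : ℂ) := by
    refine hh.mul_bdd (c := Real.exp (lam * (Real.pi / 2))) (by
      have := Real.continuous_arcsin.measurable
      fun_prop) (ae_of_all _ fun s => ?_)
    rw [Complex.norm_real, Real.norm_of_nonneg (Real.exp_pos _).le]
    gcongr
    exact Real.arcsin_le_pi_div_two _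
  have hk_int : ∀ k, Integrable fun s => h s * ((c (k + 1) * (inner ℝ (u s) θ) ^ (k + 1) : ℝ) : ℂ) := by
    intro k
    refine hh.mul_bdd (c := c (k + 1) * r ^ (k + 1)) (by fun_prop) (ae_of_all _ fun s => ?_)
    rw [Complex.norm_real, norm_mul, norm_pow, Real.norm_of_nonneg (hcn _), Real.norm_eq_abs]
    gcongr
    · exact hcn _
    · exact hx s
  have hk_bd : ∀ k s, ‖h s * ((c (k + 1) * (inner ℝ (u s) θ) ^ (k + 1) : ℝ) : ℂ)‖ ≤
      ‖h s‖ * r ^ (k + 1) := by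
    intro k s
    rw [norm_mul, Complex.norm_real, norm_mul, norm_pow, Real.norm_of_nonneg (hcn _), Real.norm_eq_abs]
    gcongr
    calc c (k + 1) * |inner ℝ (u s) θ| ^ (k + 1) ≤ 1 * r ^ (k + 1) := by
          gcongr
          · exact (hcs k).trans hl1
          · exact hx s
      _ = _ := one_mul _
  have hsumm : Summable fun k : ℕ => ∫ s, ‖h s * ((c (k + 1) * (inner ℝ (u s) θ) ^ (k + 1) : ℝ) : ℂ)‖ := by
    refine Summable.of_nonneg_of_le (fun k => by positivity) (fun k => ?_)
      ((summable_nat_add_iff 1).2 ((summable_geometric_of_lt_one hr0.le hr1).mul_left (∫ s, ‖h s‖)))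
    rw [← integral_mul_const]
    exact integral_mono (hk_int k).norm (hh.norm.mul_const _) (hk_bd k)
  have hmain : (∫ s, h s * (Real.exp (lam * Real.arcsin (inner ℝ (u s) θ)) : ℂ)) - ∫ s, h s =
      ∑' k : ℕ, (c (k + 1) : ℂ) * ∫ s, h s * ((inner ℝ (u s) θ ^ (k + 1) : ℝ) : ℂ) := by
    rw [← integral_sub hint1 hh]
    simp only [hser]
    rw [← integral_tsum_of_summable_integral_norm hk_int hsumm]
    refine tsum_congr fun k => ?_
    rw [← integral_const_mul]
    congr 1; funext s; push_cast; ring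
  have hpow : ∀ k : ℕ, ‖∫ s, h s * ((inner ℝ (u s) θ ^ (k + 1) : ℝ) : ℂ)‖ₑ ^ 2 ≤
      ∑ J : Fin (k + 1) → Fin d, ‖∫ s, h s * (tensorEntry J (u s) : ℂ)‖ₑ ^ 2 := by
    intro k
    have hti : ∀ J : Fin (k + 1) → Fin d, Integrable fun s => h s * (tensorEntry J (u s) : ℂ) := by
      intro J
      have hm : Measurable fun s => tensorEntry J (u s) :=
        (continuous_tensorEntry J).measurable.comp hum
      refine hh.mul_bdd (c := 1) (Complex.measurable_ofReal.comp hm).aestronglyMeasurable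
        (ae_of_all _ fun s => ?_)
      rw [Complex.norm_real, Real.norm_eq_abs, ← sq_le_one_iff_abs_le_one]
      calc tensorEntry J (u s) ^ 2 ≤ ∑ J : Fin (k + 1) → Fin d, tensorEntry J (u s) ^ 2 :=
            Finset.single_le_sum (f := fun J => tensorEntry J (u s) ^ 2) (fun i _ => by positivity)
              (Finset.mem_univ J)
        _ = (‖u s‖ ^ 2) ^ (k + 1) := sum_tensorEntry_sq _ _
        _ ≤ 1 := pow_le_one₀ (by positivity) (pow_le_one₀ (norm_nonneg _) ((hu s).trans hr1.le))
    -- The power of the inner product is the pairing of the tensor powers of u and θ. As the tensor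
    -- power of θ has norm 1, Cauchy–Schwarz over J costs no constant.
    have : ∫ s, h s * ((inner ℝ (u s) θ ^ (k + 1) : ℝ) : ℂ) =
        ∑ J : Fin (k + 1) → Fin d, (tensorEntry J θ : ℂ) * ∫ s, h s * (tensorEntry J (u s) : ℂ) := by
      simp only [← integral_const_mul]
      rw [← integral_finsetSum _ fun J _ => (hti J).const_mul _]
      congr 1; funext s
      rw [← sum_tensorEntry_mul]
      push_cast
      rw [Finset.mul_sum]
      exact Finset.sum_congr rfl fun J _ => by ring
    rw [this]
    refine enorm_sum_mul_sq_le _ _ ?_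
    rw [sum_tensorEntry_sq, hθ]; simp
  have hsr : 0 < √r := Real.sqrt_pos.2 hr0
  rw [hmain]
  calc _ ≤ (∑' k : ℕ, ENNReal.ofReal lam * ‖∫ s, h s * ((inner ℝ (u s) θ ^ (k + 1) : ℝ) : ℂ)‖ₑ) ^ 2 := by
        gcongr
        refine enorm_tsum_le_tsum_enorm.trans (ENNReal.tsum_le_tsum fun k => ?_)
        rw [enorm_mul]
        gcongr
        rw [← ofReal_norm, Complex.norm_real, Real.norm_of_nonneg (hcn _)]
        exact ENNReal.ofReal_le_ofReal (hcs k)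
    _ = ENNReal.ofReal lam ^ 2 * (∑' k : ℕ, ‖∫ s, h s * ((inner ℝ (u s) θ ^ (k + 1) : ℝ) : ℂ)‖ₑ) ^ 2 := by
        rw [ENNReal.tsum_mul_left, mul_pow]
    _ ≤ _ := by
        gcongr
        refine (tsum_sq_le_weighted (v := fun k => ENNReal.ofReal (√r ^ (k + 1))) (fun k => ?_)
          (fun k => ENNReal.ofReal_ne_top)).trans ?_
        · simp only [ne_eq, ENNReal.ofReal_eq_zero, not_le]; positivity
        · gcongr with k
          exact hpow k

/-- The squared `L²` norm over the lines of direction `θ` of the X-ray transform of `g` with the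
weight that the attenuation of the hemisphere induces in the gnomonic chart. -/
def attenuatedEnergy (lam : ℝ) (g : Euc d → ℂ) (θ : Euc d) : ℝ≥0∞ :=
  ∫⁻ p : (Submodule.span ℝ {θ})ᗮ, ‖∫ s : ℝ, g (p + s • θ) *
    (Real.exp (lam * Real.arcsin (inner ℝ (horizontal (p + s • θ)) θ)) : ℂ)‖ₑ ^ 2

lemma measurable_xray {g : Euc d → ℂ} (hgm : Measurable g) (θ : Euc d) :
    Measurable fun p : (Submodule.span ℝ {θ})ᗮ => ∫ s : ℝ, g (p + s • θ) := by
  have : StronglyMeasurable fun z : (Submodule.span ℝ {θ})ᗮ × ℝ => g (z.1 + z.2 • θ) :=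
    (hgm.comp (by fun_prop)).stronglyMeasurable
  exact this.integral_prod_right.measurable

lemma ae_integrable_line {g : Euc d → ℂ} (hg : Integrable g) {θ : Euc d} (hθ : ‖θ‖ = 1) :
    ∀ᵐ p : (Submodule.span ℝ {θ})ᗮ, Integrable fun s : ℝ => g (p + s • θ) :=
  ((measurePreserving_line_add hθ).integrable_comp_of_integrable hg).prod_right_ae

lemma add_sq_le_two (a b : ℝ≥0∞) : (a + b) ^ 2 ≤ 2 * a ^ 2 + 2 * b ^ 2 := by
  have h := ENNReal.rpow_add_le_mul_rpow_add_rpow a b (p := 2) (by norm_num)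
  norm_num at h
  rw [← mul_add]
  exact_mod_cast h

/-- The weighted energies of the moments of `g` along lines. -/
def momentEnergy (R : ℝ) (g : Euc d → ℂ) (θ : Euc d) : ℝ≥0∞ :=
  ∑' k : ℕ, (ENNReal.ofReal (√(capRadius R) ^ (k + 1)))⁻¹ ^ 2 * ∑ J : Fin (k + 1) → Fin d,
    xrayEnergy (fun y => (tensorEntry J (truncatedHorizontal R y) : ℂ) * g y) θ

lemma norm_tensorEntry_truncatedHorizontal_le {R : ℝ} (hR : 0 < R) {k : ℕ} (J : Fin k → Fin d)
    (y : Euc d) : ‖(tensorEntry J (truncatedHorizontal R y) : ℂ)‖ ≤ 1 := by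
  rw [Complex.norm_real, Real.norm_eq_abs, ← sq_le_one_iff_abs_le_one]
  calc tensorEntry J (truncatedHorizontal R y) ^ 2
      ≤ ∑ J : Fin k → Fin d, tensorEntry J (truncatedHorizontal R y) ^ 2 :=
        Finset.single_le_sum (f := fun J => tensorEntry J (truncatedHorizontal R y) ^ 2)
          (fun i _ => by positivity) (Finset.mem_univ J)
    _ = (‖truncatedHorizontal R y‖ ^ 2) ^ k := sum_tensorEntry_sq _ _
    _ ≤ 1 := pow_le_one₀ (by positivity) (pow_le_one₀ (norm_nonneg _)
      ((norm_truncatedHorizontal_le hR y).trans (capRadius_lt_one R).le))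

lemma measurable_tensorEntry_truncatedHorizontal {R : ℝ} (hR : 0 < R) {k : ℕ} (J : Fin k → Fin d) :
    Measurable fun y : Euc d => (tensorEntry J (truncatedHorizontal R y) : ℂ) :=
  Complex.measurable_ofReal.comp
    ((continuous_tensorEntry J).comp (continuous_truncatedHorizontal hR)).measurable

lemma memLp_tensorEntry_mul {R : ℝ} (hR : 0 < R) {g : Euc d → ℂ}
    (hg2 : MemLp g 2) {k : ℕ} (J : Fin k → Fin d) :
    MemLp (fun y => (tensorEntry J (truncatedHorizontal R y) : ℂ) * g y) 2 := by
  refine MemLp.of_le hg2 ((measurable_tensorEntry_truncatedHorizontal hR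
    J).aestronglyMeasurable.mul hg2.1) (ae_of_all _ fun y => ?_)
  rw [norm_mul]
  exact mul_le_of_le_one_left (norm_nonneg _) (norm_tensorEntry_truncatedHorizontal_le hR J y)

/-- On each line the unattenuated integral is the attenuated one minus their difference, and the
Taylor estimate bounds the difference by the moments. Truncating the field changes nothing, since g
vanishes outside the ball. -/
lemma xrayEnergy_le_attenuatedEnergy {R : ℝ} (hR : 0 < R) {lam : ℝ} (hl0 : 0 ≤ lam) (hl1 : lam ≤ 1)
    {g : Euc d → ℂ} (hgm : Measurable g) (hg2 : MemLp g 2) (hgR : ∀ x, R < ‖x‖ → g x = 0)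
    {θ : Euc d} (hθ : ‖θ‖ = 1) :
    xrayEnergy g θ ≤ 2 * attenuatedEnergy lam g θ + 2 * (ENNReal.ofReal lam ^ 2 *
      ((∑' k : ℕ, ENNReal.ofReal (√(capRadius R) ^ (k + 1)) ^ 2) * momentEnergy R g θ)) := by
  have hg := integrable_of_ae_eq_zero_outside hg2 (ae_of_all _ hgR)
  have hline := ae_integrable_line hg hθ
  have hmo : momentEnergy R g θ = ∫⁻ p : (Submodule.span ℝ {θ})ᗮ, ∑' k : ℕ,
      (ENNReal.ofReal (√(capRadius R) ^ (k + 1)))⁻¹ ^ 2 * ∑ J : Fin (k + 1) → Fin d,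
        ‖∫ s : ℝ, (tensorEntry J (truncatedHorizontal R (p + s • θ)) : ℂ) * g (p + s • θ)‖ₑ ^ 2 := by
    have hm : ∀ (k : ℕ) (J : Fin (k + 1) → Fin d), Measurable fun p : (Submodule.span ℝ {θ})ᗮ =>
        ‖∫ s : ℝ, (tensorEntry J (truncatedHorizontal R (p + s • θ)) : ℂ) * g (p + s • θ)‖ₑ ^ 2 :=
      fun k J => (measurable_xray ((measurable_tensorEntry_truncatedHorizontal hR J).mul hgm)
        θ).enorm.pow_const 2
    rw [lintegral_tsum fun k => ((Finset.measurable_sum _ fun J _ => hm k J).const_mul _).aemeasurable]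
    refine tsum_congr fun k => ?_
    rw [lintegral_const_mul _ (Finset.measurable_sum _ fun J _ => hm k J),
      lintegral_finsetSum _ fun J _ => hm k J]
    congr 1
    refine Finset.sum_congr rfl fun J _ => ?_
    refine (lintegral_xray_sq ((measurable_tensorEntry_truncatedHorizontal hR J).mul hgm)
      (memLp_tensorEntry_mul hR hg2 J) (R := R) (fun x hx => ?_) hθ).2.symm
    simp [hgR x hx]
  rw [← (lintegral_xray_sq hgm hg2 hgR hθ).2, hmo, attenuatedEnergy]
  have hmm : Measurable fun p : (Submodule.span ℝ {θ})ᗮ => ∑' k : ℕ,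
      (ENNReal.ofReal (√(capRadius R) ^ (k + 1)))⁻¹ ^ 2 * ∑ J : Fin (k + 1) → Fin d,
        ‖∫ s : ℝ, (tensorEntry J (truncatedHorizontal R (p + s • θ)) : ℂ) * g (p + s • θ)‖ₑ ^ 2 := by
    refine Measurable.tsum fun k => (Finset.measurable_sum _ fun J _ => ?_).const_mul _
    exact (measurable_xray ((measurable_tensorEntry_truncatedHorizontal hR J).mul hgm)
        θ).enorm.pow_const 2
  rw [← lintegral_const_mul _ hmm, ← lintegral_const_mul _ (hmm.const_mul _),
    ← lintegral_const_mul _ ((hmm.const_mul _).const_mul _), ← lintegral_const_mul' _ _ (by simp),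
    ← lintegral_add_right _ (((hmm.const_mul _).const_mul _).const_mul _)]
  refine lintegral_mono_ae ?_
  filter_upwards [hline] with p hp
  have hcap := capRadius_pos hR
  have key := integral_mul_exp_arcsin_sub hl0 hl1 hcap (capRadius_lt_one R) hp
    (u := fun s => truncatedHorizontal R ((p : Euc d) + s • θ))
    ((continuous_truncatedHorizontal hR).measurable.comp (by fun_prop))
    (fun s => norm_truncatedHorizontal_le hR _) hθ
  have heq : ∀ s : ℝ, g (p + s • θ) *
      (Real.exp (lam * Real.arcsin (inner ℝ (truncatedHorizontal R ((p : Euc d) + s • θ)) θ)) : ℂ) =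
      g (p + s • θ) *
      (Real.exp (lam * Real.arcsin (inner ℝ (horizontal ((p : Euc d) + s • θ)) θ)) : ℂ) := by
    intro s
    rcases lt_or_ge R ‖(p : Euc d) + s • θ‖ with h | h
    · rw [hgR _ h, zero_mul, zero_mul]
    · rw [truncatedHorizontal_eq hR h]
  simp only [heq] at key
  simp only [mul_comm (g _) ((tensorEntry _ _ : ℝ) : ℂ)] at key
  set A := ∫ s : ℝ, g (p + s • θ) *
      (Real.exp (lam * Real.arcsin (inner ℝ (horizontal ((p : Euc d) + s • θ)) θ)) : ℂ)
  set B := ∫ s : ℝ, g (p + s • θ)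
  calc ‖B‖ₑ ^ 2 = ‖A - (A - B)‖ₑ ^ 2 := by rw [sub_sub_cancel]
    _ ≤ (‖A‖ₑ + ‖A - B‖ₑ) ^ 2 := by gcongr; exact enorm_sub_le
    _ ≤ 2 * ‖A‖ₑ ^ 2 + 2 * ‖A - B‖ₑ ^ 2 := add_sq_le_two _ _
    _ ≤ _ := by gcongr

/-- The moments of `g` have energy bounded by that of `g`. -/
lemma exists_momentEnergy_le (hd : 2 ≤ d) {R : ℝ} (hR : 0 < R) : ∃ C : ℝ≥0∞, C ≠ ⊤ ∧
    ∀ {g : Euc d → ℂ} (_ : Measurable g) (_ : MemLp g 2) (_ : ∀ x, R < ‖x‖ → g x = 0),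
      ∫⁻ θ, momentEnergy R g θ ∂(sphereMeasure (Euc d)) ≤
        C * ∫⁻ θ, xrayEnergy g θ ∂(sphereMeasure (Euc d)) := by
  have hfin : 2 ≤ Module.finrank ℝ (Euc d) := by simpa using hd
  have : Nontrivial (Euc d) := Module.nontrivial_of_finrank_pos (R := ℝ) (by omega)
  obtain ⟨K, hK, hmul⟩ := exists_negHalfNorm_multiplier (Euc d)
  obtain ⟨C, hC, hup⟩ := exists_xrayEnergy_le_negHalfNorm (Euc d) hfin R
  have hcpos := rieszConst_pos hfin
  set c := ENNReal.ofReal (2 / rieszConst (Module.finrank ℝ (Euc d))) with hc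
  have hc0 : c ≠ 0 := by
    simp only [hc, ne_eq, ENNReal.ofReal_eq_zero, not_le]; positivity
  have hct : c ≠ ⊤ := ENNReal.ofReal_ne_top
  set r := capRadius R with hr
  have hr0 : 0 < r := capRadius_pos hR
  have hr1 : r < 1 := capRadius_lt_one R
  set l := 1 + r⁻¹ with hl
  have hl0 : 0 < l := by positivity
  -- Inverse weight times A² + L² for the tensors of degree k + 1, where A = r^{k+1} and L =
  -- (k+1)r^k l. It is of order (k+1)² r^k, hence summable.
  set w : ℕ → ℝ := fun k => (r ^ (k + 1))⁻¹ * ((r ^ (k + 1)) ^ 2 + (((k : ℝ) + 1) * r ^ k * l) ^ 2) with hw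
  have hws : Summable w := by
    refine Summable.of_nonneg_of_le (fun k => by positivity) (fun k => ?_)
      ((summable_succ_pow_mul_geometric 2 hr0 hr1).mul_left (r + r⁻¹ * l ^ 2))
    have h1 : w k = r * r ^ k + r⁻¹ * l ^ 2 * (((k : ℝ) + 1) ^ 2 * r ^ k) := by
      simp only [hw]; rw [pow_succ]; field_simp
    rw [h1, add_mul]
    gcongr
    exact le_mul_of_one_le_left (by positivity) (one_le_pow₀ (by linarith [k.cast_nonneg (α := ℝ)]))
  refine ⟨(∑' k, ENNReal.ofReal (w k)) * (C * K * c⁻¹), ?_, ?_⟩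
  · have := hws.tsum_ofReal_ne_top
    finiteness
  intro g hgm hg2 hgR
  have hlow := negHalfNorm_le_xrayEnergy hfin hgm hg2 hgR
  rw [← hc] at hlow
  have hlow' : fourierNegHalfNormSq (hg2.toLp g) ≤
      c⁻¹ * ∫⁻ θ, xrayEnergy g θ ∂(sphereMeasure (Euc d)) := by
    rw [← ENNReal.div_eq_inv_mul]
    rw [ENNReal.le_div_iff_mul_le (Or.inl hc0) (Or.inl hct), mul_comm]
    exact hlow
  have hGR : ∀ (k : ℕ) (J : Fin (k + 1) → Fin d) (x : Euc d), R < ‖x‖ →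
      (tensorEntry J (truncatedHorizontal R x) : ℂ) * g x = 0 := fun k J x hx => by simp [hgR x hx]
  have hxm : ∀ (k : ℕ) (J : Fin (k + 1) → Fin d), Measurable (xrayEnergy
      fun y => (tensorEntry J (truncatedHorizontal R y) : ℂ) * g y) := fun k J =>
    measurable_xrayEnergy (memLp_tensorEntry_mul hR hg2 J) (hGR k J)
  simp only [momentEnergy]
  rw [lintegral_tsum fun k => ((Finset.measurable_sum _ fun J _ => hxm k J).const_mul _).aemeasurable]
  rw [mul_assoc, ← ENNReal.tsum_mul_right]
  refine ENNReal.tsum_le_tsum fun k => ?_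
  rw [lintegral_const_mul _ (Finset.measurable_sum _ fun J _ => hxm k J),
      lintegral_finsetSum _ fun J _ => hxm k J]
  have h1 : ∑ J : Fin (k + 1) → Fin d, fourierNegHalfNormSq ((memLp_tensorEntry_mul hR hg2 J).toLp
      (fun y => (tensorEntry J (truncatedHorizontal R y) : ℂ) * g y)) ≤
      K * ENNReal.ofReal ((r ^ (k + 1)) ^ 2 + (((k : ℝ) + 1) * r ^ k * l) ^ 2) *
        fourierNegHalfNormSq (hg2.toLp g) := by
    refine hmul (fun (J : Fin (k + 1) → Fin d) y => (tensorEntry J (truncatedHorizontal R y) : ℂ))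
      (r ^ (k + 1)) (((k : ℝ) + 1) * r ^ k * l)
      (fun J => measurable_tensorEntry_truncatedHorizontal hR J) (fun y => ?_) (fun y z => ?_)
      (hg2.toLp g) _ (fun J => ?_)
    · simp only [Complex.norm_real, Real.norm_eq_abs, sq_abs]
      rw [sum_tensorEntry_sq, ← pow_mul, ← pow_mul, mul_comm 2]
      gcongr
      exact norm_truncatedHorizontal_le hR y
    · simp only [← Complex.ofReal_sub, Complex.norm_real, Real.norm_eq_abs, sq_abs]
      refine (sum_tensorEntry_sub_sq_le k (norm_truncatedHorizontal_le hR y)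
        (norm_truncatedHorizontal_le hR z)).trans ?_
      rw [mul_pow _ l, mul_assoc _ (l ^ 2), ← mul_pow l]
      gcongr
      exact norm_truncatedHorizontal_sub_le hR y z
    · filter_upwards [MemLp.coeFn_toLp (memLp_tensorEntry_mul hR hg2 J), hg2.coeFn_toLp]
        with y hy hy2
      rw [hy, hy2]
  have hv : (ENNReal.ofReal (√r ^ (k + 1)))⁻¹ ^ 2 = ENNReal.ofReal ((r ^ (k + 1))⁻¹) := by
    have : 0 < √r := Real.sqrt_pos.2 hr0
    rw [← ENNReal.ofReal_inv_of_pos (by positivity), ← ENNReal.ofReal_pow (by positivity), inv_pow,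
      ← pow_mul, mul_comm (k + 1), pow_mul, Real.sq_sqrt hr0.le]
  rw [hv]
  calc _ ≤ ENNReal.ofReal ((r ^ (k + 1))⁻¹) * ∑ J : Fin (k + 1) → Fin d, C * fourierNegHalfNormSq
        ((memLp_tensorEntry_mul hR hg2 J).toLp
          (fun y => (tensorEntry J (truncatedHorizontal R y) : ℂ) * g y)) := by
        gcongr with J
        exact hup ((measurable_tensorEntry_truncatedHorizontal hR J).mul hgm)
          (memLp_tensorEntry_mul hR hg2 J) (hGR k J)
    _ ≤ ENNReal.ofReal ((r ^ (k + 1))⁻¹) * (C * (K *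
          ENNReal.ofReal ((r ^ (k + 1)) ^ 2 + (((k : ℝ) + 1) * r ^ k * l) ^ 2) *
        (c⁻¹ * ∫⁻ θ, xrayEnergy g θ ∂(sphereMeasure (Euc d))))) := by
        rw [← Finset.mul_sum]
        gcongr
        exact h1.trans (by gcongr)
    _ = _ := by
        simp only [hw]
        rw [ENNReal.ofReal_mul (by positivity)]
        ring

/-- A small attenuation is a small perturbation of the X-ray transform. -/
lemma exists_xrayEnergy_le_attenuatedEnergy (hd : 2 ≤ d) {R : ℝ} (hR : 0 < R) :
    ∃ lam₀ : ℝ, 0 < lam₀ ∧ ∀ lam, 0 ≤ lam → lam ≤ lam₀ →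
    ∀ {g : Euc d → ℂ} (_ : Measurable g) (_ : MemLp g 2) (_ : ∀ x, R < ‖x‖ → g x = 0),
      ∫⁻ θ, xrayEnergy g θ ∂(sphereMeasure (Euc d)) ≤
        4 * ∫⁻ θ, attenuatedEnergy lam g θ ∂(sphereMeasure (Euc d)) := by
  have hfin : 2 ≤ Module.finrank ℝ (Euc d) := by simpa using hd
  obtain ⟨C, hC, hmom⟩ := exists_momentEnergy_le hd hR
  obtain ⟨C', hC', hup⟩ := exists_xrayEnergy_le_negHalfNorm (Euc d) hfin R
  have hr0 := capRadius_pos hR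
  have hr1 := capRadius_lt_one R
  set W := ∑' k : ℕ, ENNReal.ofReal (√(capRadius R) ^ (k + 1)) ^ 2 with hW
  have hWt : W ≠ ⊤ := by
    have : ∀ k : ℕ, ENNReal.ofReal (√(capRadius R) ^ (k + 1)) ^ 2 =
        ENNReal.ofReal (capRadius R ^ (k + 1)) := fun k => by
      rw [← ENNReal.ofReal_pow (by positivity), ← pow_mul, mul_comm (k + 1), pow_mul,
        Real.sq_sqrt hr0.le]
    simp only [hW, this]
    exact ((summable_nat_add_iff 1).2 (summable_geometric_of_lt_one hr0.le hr1)).tsum_ofReal_ne_top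
  set D := (2 * (W * C)).toReal with hD
  have hDt : 2 * (W * C) ≠ ⊤ := by finiteness
  have hD0 : 0 ≤ D := ENNReal.toReal_nonneg
  -- As λ² ≤ λ ≤ 1/(2(D+1)), the error coefficient λ²D is at most 1/2.
  refine ⟨min 1 (1 / (2 * (D + 1))), by positivity, fun lam h0 h1 {g} hgm hg2 hgR => ?_⟩
  have hl1 : lam ≤ 1 := h1.trans (min_le_left _ _)
  set X := ∫⁻ θ, xrayEnergy g θ ∂(sphereMeasure (Euc d)) with hX
  -- Absorbing X/2 into the left side needs X finite, which the upper bound by the H^{-1/2} norm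
  -- provides.
  have hXt : X ≠ ⊤ := by
    have := hup hgm hg2 hgR
    refine ne_top_of_le_ne_top ?_ this
    have := fourierNegHalfNormSq_ne_top (hg2.toLp g)
    finiteness
  have hmomm : Measurable (momentEnergy R g) := by
    unfold momentEnergy
    refine Measurable.tsum fun k => (Finset.measurable_sum _ fun J _ => ?_).const_mul _
    exact measurable_xrayEnergy (memLp_tensorEntry_mul hR hg2 J) (R := R)
      (fun x hx => by simp [hgR x hx])
  have hle : X ≤ 2 * ∫⁻ θ, attenuatedEnergy lam g θ ∂(sphereMeasure (Euc d)) + X / 2 := by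
    calc X ≤ ∫⁻ θ, (2 * attenuatedEnergy lam g θ + 2 * (ENNReal.ofReal lam ^ 2 *
        (W * momentEnergy R g θ))) ∂(sphereMeasure (Euc d)) := by
          refine lintegral_mono_ae ?_
          filter_upwards [ae_norm_eq_one_sphereMeasure] with θ hθ
          exact xrayEnergy_le_attenuatedEnergy hR h0 hl1 hgm hg2 hgR hθ
      _ = 2 * ∫⁻ θ, attenuatedEnergy lam g θ ∂(sphereMeasure (Euc d)) + 2 * (ENNReal.ofReal lam ^ 2 *
        (W * ∫⁻ θ, momentEnergy R g θ ∂(sphereMeasure (Euc d)))) := by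
          rw [lintegral_add_right _ (((hmomm.const_mul _).const_mul _).const_mul _),
            lintegral_const_mul' _ _ (by simp),
            lintegral_const_mul _ ((hmomm.const_mul _).const_mul _),
            lintegral_const_mul _ (hmomm.const_mul _), lintegral_const_mul _ hmomm]
      _ ≤ 2 * ∫⁻ θ, attenuatedEnergy lam g θ ∂(sphereMeasure (Euc d)) +
          2 * (ENNReal.ofReal lam ^ 2 * (W * (C * X))) := by
          gcongr
          exact hmom hgm hg2 hgR
      _ ≤ _ := by
          gcongr
          have h2 : 2 * (ENNReal.ofReal lam ^ 2 * (W * (C * X))) =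
              (ENNReal.ofReal lam ^ 2 * (2 * (W * C))) * X := by ring
          rw [h2, div_eq_mul_inv, mul_comm X]
          gcongr
          rw [← ENNReal.ofReal_toReal hDt, ← hD, ← ENNReal.ofReal_pow h0, ← ENNReal.ofReal_mul
            (by positivity)]
          refine ENNReal.ofReal_le_of_le_toReal ?_
          rw [ENNReal.toReal_inv]
          have h3 : lam ≤ 1 / (2 * (D + 1)) := h1.trans (min_le_right _ _)
          have h4 : lam ^ 2 ≤ lam := by nlinarith
          have h5 : lam * (2 * (D + 1)) ≤ 1 := by rwa [le_div_iff₀ (by positivity)] at h3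
          simp only [ENNReal.toReal_ofNat]
          nlinarith
  have h6 : X / 2 ≤ 2 * ∫⁻ θ, attenuatedEnergy lam g θ ∂(sphereMeasure (Euc d)) := by
    have h7 : X / 2 + X / 2 ≤ 2 * ∫⁻ θ, attenuatedEnergy lam g θ ∂(sphereMeasure (Euc d)) + X / 2 := by
      rwa [ENNReal.add_halves]
    exact (ENNReal.add_le_add_iff_right (ENNReal.div_ne_top hXt two_ne_zero)).1 h7
  calc X = X / 2 + X / 2 := (ENNReal.add_halves X).symm
    _ ≤ _ := add_le_add h6 h6
    _ = _ := by ring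

end Perturbation

/-! ### The hemispherical transform in the gnomonic chart. -/

section Chart

open FourierTransform SchwartzMap

variable {d : ℕ}

@[simp] lemma equatorPoint_castSucc (x : Euc d) (i : Fin d) : equatorPoint x i.castSucc = x i := by
  simp [equatorPoint]

@[simp] lemma equatorPoint_last (x : Euc d) : equatorPoint x (Fin.last d) = 0 := by
  simp [equatorPoint]

/-- The inclusion of the equatorial hyperplane. -/
def equatorIsometry (d : ℕ) : Euc d →ₗᵢ[ℝ] Euc (d + 1) where
  toFun := equatorPoint
  map_add' x y := by
    ext i
    refine Fin.lastCases ?_ (fun i => ?_) i <;> simp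
  map_smul' c x := by
    ext i
    refine Fin.lastCases ?_ (fun i => ?_) i <;> simp
  norm_map' x := by
    simp [EuclideanSpace.norm_eq, Fin.sum_univ_castSucc]

lemma equatorIsometry_apply (x : Euc d) : equatorIsometry d x = equatorPoint x := rfl

/-- The north pole. -/
def pole (d : ℕ) : Euc (d + 1) := EuclideanSpace.single (Fin.last d) 1

lemma norm_pole : ‖pole d‖ = 1 := by simp [pole]

lemma inner_pole (x : Euc (d + 1)) : inner ℝ x (pole d) = height x := by
  simp [pole, height, EuclideanSpace.inner_single_right]

@[simp] lemma height_equatorPoint (x : Euc d) : height (equatorPoint x) = 0 := equatorPoint_last x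

@[simp] lemma height_pole : height (pole d) = 1 := by simp [height, pole]

lemma height_add (x y : Euc (d + 1)) : height (x + y) = height x + height y := rfl

lemma height_smul (c : ℝ) (x : Euc (d + 1)) : height (c • x) = c * height x := rfl

lemma continuous_height : Continuous (height : Euc (d + 1) → ℝ) := by
  unfold height; fun_prop

lemma inner_equatorPoint (x y : Euc d) : inner ℝ (equatorPoint x) (equatorPoint y) = inner ℝ x y :=
  (equatorIsometry d).inner_map_map x y

lemma inner_equatorPoint_pole (x : Euc d) : inner ℝ (equatorPoint x) (pole d) = 0 := by
  rw [inner_pole, height_equatorPoint]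

lemma continuous_equatorPoint : Continuous (equatorPoint : Euc d → Euc (d + 1)) :=
  (equatorIsometry d).continuous

/-- The point of the open hemisphere with gnomonic coordinate `y`. -/
def gnomonic (y : Euc d) : Euc (d + 1) := (√(1 + ‖y‖ ^ 2))⁻¹ • (equatorPoint y + pole d)

lemma height_gnomonic (y : Euc d) : height (gnomonic y) = (√(1 + ‖y‖ ^ 2))⁻¹ := by
  simp [gnomonic, height_smul, height_add]

lemma continuous_gnomonic : Continuous (gnomonic : Euc d → Euc (d + 1)) := by
  unfold gnomonic
  have := continuous_equatorPoint (d := d)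
  have h : Continuous fun y : Euc d => (√(1 + ‖y‖ ^ 2))⁻¹ :=
    Continuous.inv₀ (by fun_prop) fun y => by positivity
  exact h.smul (by fun_prop)

lemma lintegral_hemisphere {Φ : Euc (d + 1) → ℝ≥0∞} (hΦ : Measurable Φ) :
    ∫⁻ x, Φ x ∂(hemisphereMeasure d) =
      ∫⁻ y : Euc d, ENNReal.ofReal ((√(1 + ‖y‖ ^ 2))⁻¹ ^ (d + 1)) * Φ (gnomonic y) := by
  have h := lintegral_halfSphere_gnomonic (equatorIsometry d) (norm_pole (d := d))
    (fun p => inner_equatorPoint_pole p) (by simp) hΦ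
  simp only [inner_pole, finrank_euclideanSpace_fin, equatorIsometry_apply] at h
  exact h

/-- The directions at (θ,0) form a half sphere of the hyperplane orthogonal to it, whose equatorial
part is θ^⊥ in ℝ^d. The chart formula applies there, one dimension lower, hence the exponent d. -/
lemma lintegral_direction {θ : Euc d} (hθ : ‖θ‖ = 1) {Φ : Euc (d + 1) → ℝ≥0∞}
    (hΦ : Measurable Φ) :
    ∫⁻ ξ, Φ ξ ∂(directionMeasure θ) = ∫⁻ p : (Submodule.span ℝ {θ})ᗮ,
      ENNReal.ofReal ((√(1 + ‖(p : Euc d)‖ ^ 2))⁻¹ ^ d) * Φ (gnomonic (p : Euc d)) := by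
  have hθ' : ‖equatorPoint θ‖ = 1 := by rw [← hθ]; exact (equatorIsometry d).norm_map θ
  have hmem : ∀ p : (Submodule.span ℝ {θ})ᗮ,
      equatorPoint (p : Euc d) ∈ (Submodule.span ℝ {equatorPoint θ})ᗮ := fun p => by
    rw [Submodule.mem_orthogonal_singleton_iff_inner_left, inner_equatorPoint]
    exact inner_orthogonal_singleton θ p
  have hpole : pole d ∈ (Submodule.span ℝ {equatorPoint θ})ᗮ := by
    rw [Submodule.mem_orthogonal_singleton_iff_inner_right, inner_equatorPoint_pole]
  let ι : (Submodule.span ℝ {θ})ᗮ →ₗᵢ[ℝ] (Submodule.span ℝ {equatorPoint θ})ᗮ :=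
    { toLinearMap := LinearMap.codRestrict _
        ((equatorIsometry d).toLinearMap ∘ₗ (Submodule.span ℝ {θ})ᗮ.subtype) hmem
      norm_map' := fun p => (equatorIsometry d).norm_map (p : Euc d) }
  have hd1 := finrank_orthogonal_unit hθ
  have hd2 := finrank_orthogonal_unit hθ'
  simp only [finrank_euclideanSpace_fin] at hd1 hd2
  have hΦ' : Measurable fun ξ : (Submodule.span ℝ {equatorPoint θ})ᗮ => Φ (ξ : Euc (d + 1)) :=
    hΦ.comp measurable_subtype_coe
  have h := lintegral_halfSphere_gnomonic ι
    (e := (⟨pole d, hpole⟩ : (Submodule.span ℝ {equatorPoint θ})ᗮ)) norm_pole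
    (fun p => inner_equatorPoint_pole (p : Euc d)) (by omega) hΦ'
  rw [← hd1] at h
  have hs : MeasurableSet {ξ : Euc (d + 1) | 0 < height ξ} :=
    measurableSet_lt measurable_const continuous_height.measurable
  rw [directionMeasure, Measure.restrict_map measurable_subtype_coe hs,
    lintegral_map hΦ measurable_subtype_coe]
  refine Eq.trans ?_ h
  congr 2
  ext ξ
  change 0 < height (ξ : Euc (d + 1)) ↔ 0 < inner ℝ (ξ : Euc (d + 1)) (pole d)
  rw [inner_pole]

section GreatCircle

variable {θ : Euc d} (p : (Submodule.span ℝ {θ})ᗮ)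

lemma norm_sq_line (hθ : ‖θ‖ = 1) (s : ℝ) :
    ‖(p : Euc d) + s • θ‖ ^ 2 = ‖(p : Euc d)‖ ^ 2 + s ^ 2 := by
  rw [norm_add_sq_real, inner_smul_right, inner_orthogonal_singleton, norm_smul, hθ]
  simp

/-- The angle on the half great circle of the point with gnomonic coordinate `p + s θ`. -/
def circleAngle (q s : ℝ) : ℝ := Real.pi / 2 - Real.arctan (s / q)

lemma hasDerivAt_circleAngle {q : ℝ} (hq : 0 < q) (s : ℝ) :
    HasDerivAt (circleAngle q) (-(q / (q ^ 2 + s ^ 2))) s := by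
  have h := ((hasDerivAt_id s).div_const q).arctan.const_sub (Real.pi / 2)
  refine h.congr_deriv ?_
  simp only [id]
  field_simp

lemma injective_circleAngle {q : ℝ} (hq : 0 < q) : Function.Injective (circleAngle q) := by
  intro s t h
  have h1 : Real.arctan (s / q) = Real.arctan (t / q) := by unfold circleAngle at h; linarith
  have h2 := Real.arctan_injective h1
  field_simp at h2
  exact h2

lemma image_circleAngle {q : ℝ} (hq : 0 < q) : circleAngle q '' univ = Ioo 0 Real.pi := by
  ext t
  constructor
  · rintro ⟨s, -, rfl⟩
    have h1 := Real.arctan_lt_pi_div_two (s / q)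
    have h2 := Real.neg_pi_div_two_lt_arctan (s / q)
    unfold circleAngle
    constructor <;> linarith
  · rintro ⟨h1, h2⟩
    refine ⟨q * Real.tan (Real.pi / 2 - t), mem_univ _, ?_⟩
    rw [circleAngle, mul_div_cancel_left₀ _ hq.ne', Real.arctan_tan (by linarith) (by linarith)]
    ring

lemma sqrt_one_add_div_sq {q : ℝ} (hq : 0 < q) (s : ℝ) :
    √(1 + (s / q) ^ 2) = √(q ^ 2 + s ^ 2) / q := by
  rw [eq_div_iff hq.ne']
  conv_lhs => rw [← Real.sqrt_sq hq.le, ← Real.sqrt_mul (by positivity)]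
  congr 1
  rw [Real.sqrt_sq hq.le]
  field_simp

lemma one_add_norm_sq_line (hθ : ‖θ‖ = 1) (s : ℝ) :
    1 + ‖(p : Euc d) + s • θ‖ ^ 2 = √(1 + ‖(p : Euc d)‖ ^ 2) ^ 2 + s ^ 2 := by
  rw [norm_sq_line p hθ, Real.sq_sqrt (by positivity)]
  ring

/-- The plane spanned by (θ,0) and the point over p meets the tangent hyperplane in the line p + ℝθ.
The parameters are related by cot t = s/q with q = √(1+|p|²). -/
lemma halfCircle_gnomonic (hθ : ‖θ‖ = 1) (s : ℝ) :
    halfCircle θ (gnomonic (p : Euc d)) (circleAngle (√(1 + ‖(p : Euc d)‖ ^ 2)) s) =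
      gnomonic ((p : Euc d) + s • θ) := by
  have hq : 0 < √(1 + ‖(p : Euc d)‖ ^ 2) := by positivity
  rw [halfCircle, gnomonic, gnomonic, one_add_norm_sq_line p hθ]
  have hadd : equatorPoint ((p : Euc d) + s • θ) = equatorPoint (p : Euc d) + s • equatorPoint θ := by
    simp only [← equatorIsometry_apply, map_add, map_smul]
  set q := √(1 + ‖(p : Euc d)‖ ^ 2)
  have hw : 0 < √(q ^ 2 + s ^ 2) := by positivity
  rw [circleAngle, Real.cos_pi_div_two_sub, Real.sin_pi_div_two_sub, Real.sin_arctan,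
    Real.cos_arctan, sqrt_one_add_div_sq hq, hadd, smul_smul]
  have h1 : s / q / (√(q ^ 2 + s ^ 2) / q) = (√(q ^ 2 + s ^ 2))⁻¹ * s := by field_simp
  have h2 : 1 / (√(q ^ 2 + s ^ 2) / q) * q⁻¹ = (√(q ^ 2 + s ^ 2))⁻¹ := by field_simp
  rw [h1, h2]
  module

/-- The attenuation exponent depends on θ only through the inner product with a field independent of
θ. This makes the tensor expansion possible. -/
lemma arcsin_inner_horizontal (hθ : ‖θ‖ = 1) (s : ℝ) :
    Real.arcsin (inner ℝ (horizontal ((p : Euc d) + s • θ)) θ) =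
      Real.arctan (s / √(1 + ‖(p : Euc d)‖ ^ 2)) := by
  have hq : 0 < √(1 + ‖(p : Euc d)‖ ^ 2) := by positivity
  rw [Real.arctan_eq_arcsin, sqrt_one_add_div_sq hq, horizontal, inner_smul_left, inner_add_left,
    inner_orthogonal_singleton, inner_smul_left, real_inner_self_eq_norm_sq, hθ,
    one_add_norm_sq_line p hθ]
  congr 1
  simp only [map_inv₀, RCLike.conj_to_real, one_pow, mul_one, zero_add]
  field_simp

lemma lintegral_halfCircle (hθ : ‖θ‖ = 1) (Φ : Euc (d + 1) → ℝ≥0∞) :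
    ∫⁻ t in Ioo 0 Real.pi, Φ (halfCircle θ (gnomonic (p : Euc d)) t) =
      ∫⁻ s : ℝ, ENNReal.ofReal (√(1 + ‖(p : Euc d)‖ ^ 2) / (1 + ‖(p : Euc d) + s • θ‖ ^ 2)) *
        Φ (gnomonic ((p : Euc d) + s • θ)) := by
  have hq : 0 < √(1 + ‖(p : Euc d)‖ ^ 2) := by positivity
  rw [← image_circleAngle hq, lintegral_image_eq_lintegral_abs_deriv_mul MeasurableSet.univ
    (fun s _ => (hasDerivAt_circleAngle hq s).hasDerivWithinAt) (injective_circleAngle hq).injOn,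
    setLIntegral_univ]
  refine lintegral_congr fun s => ?_
  rw [halfCircle_gnomonic p hθ, one_add_norm_sq_line p hθ, abs_neg, abs_of_nonneg (by positivity)]

/-- The function on the tangent plane with the same ray transform. -/
def planar (f : Euc (d + 1) → ℂ) (y : Euc d) : ℂ := ((1 + ‖y‖ ^ 2)⁻¹ : ℝ) * f (gnomonic y)

/-- Of the Jacobian q/(1+|y|²), the denominator goes into `planar` and q, constant along the line,
comes out. The exponential splits as e^{-λπ/2} e^{λ arctan(s/q)}. -/
lemma attenuatedXray_gnomonic (hθ : ‖θ‖ = 1) (lam : ℝ) (f : Euc (d + 1) → ℂ) :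
    attenuatedXray lam f θ (gnomonic (p : Euc d)) =
      ((√(1 + ‖(p : Euc d)‖ ^ 2) * Real.exp (-(lam * (Real.pi / 2))) : ℝ) : ℂ) *
        ∫ s : ℝ, planar f (p + s • θ) *
          (Real.exp (lam * Real.arcsin (inner ℝ (horizontal (p + s • θ)) θ)) : ℂ) := by
  have hq : 0 < √(1 + ‖(p : Euc d)‖ ^ 2) := by positivity
  rw [attenuatedXray, intervalIntegral.integral_of_le Real.pi_pos.le, integral_Ioc_eq_integral_Ioo,
    ← image_circleAngle hq, integral_image_eq_integral_abs_deriv_smul MeasurableSet.univ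
    (fun s _ => (hasDerivAt_circleAngle hq s).hasDerivWithinAt) (injective_circleAngle hq).injOn,
    setIntegral_univ, ← integral_const_mul]
  refine integral_congr_ae (ae_of_all _ fun s => ?_)
  simp only
  rw [halfCircle_gnomonic p hθ, arcsin_inner_horizontal p hθ, abs_neg,
    abs_of_nonneg (by positivity), planar, one_add_norm_sq_line p hθ, circleAngle]
  set q := √(1 + ‖(p : Euc d)‖ ^ 2)
  have he : Real.exp (-lam * (Real.pi / 2 - Real.arctan (s / q))) =
      Real.exp (-(lam * (Real.pi / 2))) * Real.exp (lam * Real.arctan (s / q)) := by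
    rw [← Real.exp_add]; congr 1; ring
  rw [he, Complex.real_smul, div_eq_mul_inv]
  push_cast
  ring

end GreatCircle

lemma measurable_planar {f : Euc (d + 1) → ℂ} (hf : Measurable f) : Measurable (planar f) :=
  (Complex.measurable_ofReal.comp (by fun_prop)).mul (hf.comp continuous_gnomonic.measurable)

lemma measurable_attenuatedXray {f : Euc (d + 1) → ℂ} (hf : Measurable f) (lam : ℝ) (θ : Euc d) :
    Measurable (attenuatedXray lam f θ) := by
  have h : StronglyMeasurable fun z : Euc (d + 1) × ℝ =>
      f (halfCircle θ z.1 z.2) * (Real.exp (-lam * z.2) : ℂ) := by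
    refine Measurable.stronglyMeasurable ((hf.comp ?_).mul (by fun_prop))
    unfold halfCircle
    have : Continuous fun z : Euc (d + 1) × ℝ =>
      Real.cos z.2 • equatorPoint θ + Real.sin z.2 • z.1 := by fun_prop
    exact this.measurable
  have h2 := (h.integral_prod_right' (ν := volume.restrict (Ioc 0 Real.pi))).measurable
  have e : attenuatedXray lam f θ = fun ξ => ∫ t in Ioc 0 Real.pi,
      f (halfCircle θ ξ t) * (Real.exp (-lam * t) : ℂ) := by
    funext ξ
    rw [attenuatedXray, intervalIntegral.integral_of_le Real.pi_pos.le]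
  rw [e]
  exact h2

lemma ae_gnomonic {P : Euc (d + 1) → Prop} (h : ∀ᵐ x ∂(hemisphereMeasure d), P x) :
    ∀ᵐ y : Euc d, P (gnomonic y) := by
  obtain ⟨N, hN, hNm, hN0⟩ := exists_measurable_superset_of_null h
  have h1 := lintegral_hemisphere (measurable_one.indicator hNm : Measurable (N.indicator 1))
  rw [lintegral_indicator_one hNm, hN0] at h1
  have hm : Measurable fun y : Euc d => ENNReal.ofReal ((√(1 + ‖y‖ ^ 2))⁻¹ ^ (d + 1)) *
      N.indicator (1 : Euc (d + 1) → ℝ≥0∞) (gnomonic y) :=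
    Measurable.mul (by fun_prop)
      ((measurable_one.indicator hNm).comp continuous_gnomonic.measurable)
  have h2 := (lintegral_eq_zero_iff hm).1 h1.symm
  filter_upwards [h2] with y hy
  by_contra hP
  have : gnomonic y ∈ N := hN hP
  simp only [this, indicator_of_mem, Pi.one_apply, mul_one, Pi.zero_apply,
    ENNReal.ofReal_eq_zero] at hy
  have : 0 < (√(1 + ‖y‖ ^ 2))⁻¹ ^ (d + 1) := by positivity
  linarith

/-- Curves are null sets, so changing the representative of f has to be justified. By Fubini in the
chart, for fixed θ almost every line of direction θ meets the exceptional set in a null set of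
parameters. -/
lemma attenuatedXray_congr_ae {f g : Euc (d + 1) → ℂ} (h : f =ᵐ[hemisphereMeasure d] g) (lam : ℝ)
    {θ : Euc d} (hθ : ‖θ‖ = 1) :
    attenuatedXray lam f θ =ᵐ[directionMeasure θ] attenuatedXray lam g θ := by
  obtain ⟨N, hN, hNm, hN0⟩ := exists_measurable_superset_of_null h
  have hind : Measurable (N.indicator (1 : Euc (d + 1) → ℝ≥0∞)) := measurable_one.indicator hNm
  have hcont : Continuous fun z : Euc (d + 1) × ℝ => halfCircle θ z.1 z.2 := by
    unfold halfCircle; fun_prop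
  have hBm : Measurable fun ξ => ∫⁻ t in Ioo 0 Real.pi,
      N.indicator (1 : Euc (d + 1) → ℝ≥0∞) (halfCircle θ ξ t) :=
    (hind.comp hcont.measurable).lintegral_prod_right'
  have hNae : ∀ᵐ y : Euc d, gnomonic y ∉ N := ae_gnomonic (measure_eq_zero_iff_ae_notMem.1 hN0)
  have hline := Measure.ae_ae_of_ae_prod ((measurePreserving_line_add hθ).quasiMeasurePreserving.ae hNae)
  have h0 : ∫⁻ ξ, (∫⁻ t in Ioo 0 Real.pi,
      N.indicator (1 : Euc (d + 1) → ℝ≥0∞) (halfCircle θ ξ t)) ∂(directionMeasure θ) = 0 := by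
    rw [lintegral_direction hθ hBm]
    refine (lintegral_congr_ae ?_).trans lintegral_zero
    filter_upwards [hline] with p hp
    rw [lintegral_halfCircle p hθ]
    refine mul_eq_zero_of_right _ ((lintegral_congr_ae ?_).trans lintegral_zero)
    filter_upwards [hp] with s hs
    rw [indicator_of_notMem hs, mul_zero]
  filter_upwards [(lintegral_eq_zero_iff hBm).1 h0] with ξ hξ
  have h1 := (lintegral_eq_zero_iff (hind.comp (hcont.measurable.comp
    (measurable_prodMk_left (x := ξ))))).1 hξ
  rw [attenuatedXray, attenuatedXray, intervalIntegral.integral_of_le Real.pi_pos.le,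
    intervalIntegral.integral_of_le Real.pi_pos.le, integral_Ioc_eq_integral_Ioo,
    integral_Ioc_eq_integral_Ioo]
  refine integral_congr_ae ?_
  filter_upwards [h1] with t ht
  have hnot : halfCircle θ ξ t ∉ N := fun hmem => by
    have ht' : N.indicator (1 : Euc (d + 1) → ℝ≥0∞) (halfCircle θ ξ t) = 0 := ht
    rw [indicator_of_mem hmem] at ht'
    exact one_ne_zero ht'
  have : f (halfCircle θ ξ t) = g (halfCircle θ ξ t) := by
    by_contra hne
    exact hnot (hN hne)
  rw [this]

/-- The attenuated transform on the hemisphere controls the one in the gnomonic chart. -/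
lemma attenuatedEnergy_le {R lam : ℝ} (hd : 1 ≤ d) (hl1 : lam ≤ 1)
    {f : Euc (d + 1) → ℂ} (hf : Measurable f) (hfR : ∀ y, R < ‖y‖ → planar f y = 0)
    {θ : Euc d} (hθ : ‖θ‖ = 1) :
    attenuatedEnergy lam (planar f) θ ≤ ENNReal.ofReal (√(1 + R ^ 2) ^ (d - 1) * Real.exp Real.pi) *
      ∫⁻ ξ, ‖attenuatedXray lam f θ ξ‖ₑ ^ 2 * ENNReal.ofReal (height ξ) ∂(directionMeasure θ) := by
  have hm : Measurable fun ξ => ‖attenuatedXray lam f θ ξ‖ₑ ^ 2 * ENNReal.ofReal (height ξ) :=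
    ((measurable_attenuatedXray hf lam θ).enorm.pow_const 2).mul
      (ENNReal.measurable_ofReal.comp continuous_height.measurable)
  rw [lintegral_direction hθ hm, attenuatedEnergy, ← lintegral_const_mul' _ _ ENNReal.ofReal_ne_top]
  refine lintegral_mono fun p => ?_
  rw [attenuatedXray_gnomonic p hθ, height_gnomonic]
  set I := ∫ s : ℝ, planar f (p + s • θ) *
          (Real.exp (lam * Real.arcsin (inner ℝ (horizontal (p + s • θ)) θ)) : ℂ) with hI
  -- A line at distance more than R from the origin misses the support. On the others q ≤ √(1+R²).
  rcases lt_or_ge R ‖(p : Euc d)‖ with hp | hp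
  · have : I = 0 := by
      rw [hI]
      refine (integral_congr_ae (ae_of_all _ fun s => ?_)).trans (integral_zero _ _)
      rw [hfR _ (hp.trans_le ?_), zero_mul]
      refine abs_le_of_sq_le_sq' ?_ (norm_nonneg _) |>.2
      rw [norm_sq_line p hθ]
      nlinarith
    simp [this]
  · set q := √(1 + ‖(p : Euc d)‖ ^ 2) with hq
    have hq1 : 1 ≤ q := one_le_sqrt_one_add _
    have hq0 : 0 < q := by positivity
    have hqQ : q ≤ √(1 + R ^ 2) := by
      refine Real.sqrt_le_sqrt ?_
      have : ‖(p : Euc d)‖ ^ 2 ≤ R ^ 2 := by gcongr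
      linarith
    rw [enorm_mul, ← ofReal_norm ((_ : ℝ) : ℂ), Complex.norm_real,
      Real.norm_of_nonneg (by positivity), mul_pow, ← ENNReal.ofReal_pow (by positivity)]
    have e : ∀ a b c e x : ℝ≥0∞, a * (b * (c * x * e)) = (a * (b * (c * e))) * x := by intros; ring
    rw [e, ← ENNReal.ofReal_mul (by positivity), ← ENNReal.ofReal_mul (by positivity),
      ← ENNReal.ofReal_mul (by positivity)]
    refine le_mul_of_one_le_left zero_le ?_
    rw [ENNReal.one_le_ofReal]
    obtain ⟨m, rfl⟩ : ∃ m, d = m + 1 := ⟨d - 1, by omega⟩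
    -- The chart Jacobian q^{-d}, the square of the factor q and the height q⁻¹ combine to q^{1-d}.
    have h1 : q⁻¹ ^ (m + 1) * ((q * Real.exp (-(lam * (Real.pi / 2)))) ^ 2 * q⁻¹) =
        (q ^ m)⁻¹ * Real.exp (-(lam * Real.pi)) := by
      rw [mul_pow, ← Real.exp_nat_mul]
      have : ((2 : ℕ) : ℝ) * -(lam * (Real.pi / 2)) = -(lam * Real.pi) := by push_cast; ring
      rw [this, inv_pow, pow_succ]
      field_simp
    rw [h1, Nat.add_sub_cancel]
    calc (1 : ℝ) = (q ^ m * (q ^ m)⁻¹) * (Real.exp Real.pi * Real.exp (-Real.pi)) := by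
          rw [mul_inv_cancel₀ (by positivity), ← Real.exp_add]; simp
      _ ≤ (√(1 + R ^ 2) ^ m * (q ^ m)⁻¹) * (Real.exp Real.pi * Real.exp (-(lam * Real.pi))) := by
          gcongr
          nlinarith [Real.pi_pos]
      _ = _ := by ring

lemma memLp_planar {f : Euc (d + 1) → ℂ} (hf : Measurable f) (hf2 : MemLp f 2 (hemisphereMeasure d))
    {R : ℝ} (hfR : ∀ y, R < ‖y‖ → planar f y = 0) : MemLp (planar f) 2 := by
  have hm := measurable_planar hf
  refine (memLp_two_iff_integrable_sq_norm hm.aestronglyMeasurable).2 ⟨by fun_prop, ?_⟩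
  have h2 : ∫⁻ x, ‖f x‖ₑ ^ 2 ∂(hemisphereMeasure d) < ⊤ := by
    have := (hf2.integrable_norm_pow two_ne_zero).lintegral_lt_top
    simpa only [enorm_sq_eq_ofReal] using this
  rw [lintegral_hemisphere (by fun_prop)] at h2
  rw [HasFiniteIntegral]
  refine lt_of_le_of_lt (b := ENNReal.ofReal (√(1 + R ^ 2) ^ (d + 1)) * ∫⁻ y : Euc d,
    ENNReal.ofReal ((√(1 + ‖y‖ ^ 2))⁻¹ ^ (d + 1)) * ‖f (gnomonic y)‖ₑ ^ 2) ?_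
    (ENNReal.mul_lt_top ENNReal.ofReal_lt_top h2)
  rw [← lintegral_const_mul' _ _ ENNReal.ofReal_ne_top]
  refine lintegral_mono fun y => ?_
  have e1 : ‖‖planar f y‖ ^ 2‖ₑ = ‖planar f y‖ₑ ^ 2 := by
    rw [enorm_sq_eq_ofReal, Real.enorm_of_nonneg (by positivity)]
  rw [e1]
  rcases lt_or_ge R ‖y‖ with hy | hy
  · simp [hfR y hy]
  · rw [← mul_assoc, ← ENNReal.ofReal_mul (by positivity), planar, enorm_mul, mul_pow]
    gcongr
    have hq1 : 1 ≤ √(1 + ‖y‖ ^ 2) := one_le_sqrt_one_add _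
    have hqQ : √(1 + ‖y‖ ^ 2) ≤ √(1 + R ^ 2) := by
      refine Real.sqrt_le_sqrt ?_
      have : ‖y‖ ^ 2 ≤ R ^ 2 := by gcongr
      linarith
    have h3 : ‖(((1 + ‖y‖ ^ 2)⁻¹ : ℝ) : ℂ)‖ₑ ^ 2 ≤ 1 := by
      rw [enorm_sq_eq_ofReal, ENNReal.ofReal_le_one, Complex.norm_real,
        Real.norm_of_nonneg (by positivity)]
      refine pow_le_one₀ (by positivity) (inv_le_one_of_one_le₀ ?_)
      linarith [sq_nonneg ‖y‖]
    refine h3.trans ?_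
    rw [ENNReal.one_le_ofReal, ← mul_pow]
    refine one_le_pow₀ ?_
    rw [← div_eq_mul_inv, one_le_div (by positivity)]
    exact hqQ

end Chart

/-! ### Transport of the H^{1/2} norm and of the pairing to the chart. -/

section Pairing

open FourierTransform SchwartzMap

section Localized

variable {V : Type*} [NormedAddCommGroup V] [InnerProductSpace ℝ V] [FiniteDimensional ℝ V]
  [MeasurableSpace V] [BorelSpace V]

/-- Multiplication by a Lipschitz cutoff extends `H^{1/2}` functions from a set to the space. -/
lemma halfNormSq_cutoff_mul_le {a : V → ℝ} {B : Set V} (hB : MeasurableSet B) {L : ℝ} (hL1 : 1 ≤ L)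
    (ha1 : ∀ x, |a x| ≤ 1) (haL : ∀ x y, |a x - a y| ≤ L * ‖x - y‖) (haB : ∀ x, x ∉ B → a x = 0)
    {φ : V → ℂ} (hφ : Measurable φ) :
    halfNormSq (fun x => (a x : ℂ) * φ x) ≤
      (1 + 16 * ENNReal.ofReal (L ^ 2) * truncatedKernelMass V) * (∫⁻ x in B, ‖φ x‖ₑ ^ 2) +
        2 * ∫⁻ x in B, ∫⁻ y in B, ‖φ x - φ y‖ₑ ^ 2 / ‖x - y‖ₑ ^ (Module.finrank ℝ V + 1) := by
  set n := Module.finrank ℝ V with hn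
  set M := truncatedKernelMass V with hM
  set F : V → ℝ≥0∞ := B.indicator fun x => ‖φ x‖ₑ ^ 2 with hF
  have hFm : Measurable F := Measurable.indicator (by fun_prop) hB
  set k : V → ℝ≥0∞ := fun h => ENNReal.ofReal (min 1 (‖h‖ ^ 2)) / ‖h‖ₑ ^ (n + 1) with hk
  have hkm : Measurable k := by simp only [hk]; fun_prop
  set G : V → V → ℝ≥0∞ := fun x y => B.indicator (fun x => B.indicator (fun y =>
    ‖φ x - φ y‖ₑ ^ 2 / ‖x - y‖ₑ ^ (n + 1)) y) x with hG
  have hGm : Measurable (Function.uncurry G) := by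
    have : Function.uncurry G = (B ×ˢ B).indicator fun z =>
        ‖φ z.1 - φ z.2‖ₑ ^ 2 / ‖z.1 - z.2‖ₑ ^ (n + 1) := by
      ext ⟨x, y⟩
      by_cases hx : x ∈ B <;> by_cases hy : y ∈ B <;> simp [hG, hx, hy]
    rw [this]
    exact Measurable.indicator (by fun_prop) (hB.prod hB)
  have hdiff : ∀ x y, |a x - a y| ^ 2 ≤ 4 * L ^ 2 * min 1 (‖x - y‖ ^ 2) := by
    intro x y
    rw [mul_min_of_nonneg _ _ (by positivity), le_min_iff]
    constructor
    · have h1 : |a x - a y| ≤ 2 := (abs_sub _ _).trans (by linarith [ha1 x, ha1 y])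
      have h2 : |a x - a y| ^ 2 ≤ 2 ^ 2 := by gcongr
      nlinarith
    · have h2 : |a x - a y| ^ 2 ≤ (L * ‖x - y‖) ^ 2 := by gcongr; exact haL x y
      nlinarith [mul_nonneg (sq_nonneg L) (sq_nonneg ‖x - y‖)]
  have hpt : ∀ x y, ‖(a x : ℂ) * φ x - (a y : ℂ) * φ y‖ₑ ^ 2 / ‖x - y‖ₑ ^ (n + 1) ≤
      2 * G x y + 8 * ENNReal.ofReal (L ^ 2) * (k (x - y) * F x + k (x - y) * F y) := by
    intro x y
    have hc : 8 * ENNReal.ofReal (L ^ 2) * (k (x - y) * F x + k (x - y) * F y) =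
        (2 * (ENNReal.ofReal (4 * L ^ 2 * min 1 (‖x - y‖ ^ 2)) * (F x + F y))) /
          ‖x - y‖ₑ ^ (n + 1) := by
      have e4 : ENNReal.ofReal 4 = 4 := by simp
      simp only [hk, div_eq_mul_inv]
      rw [ENNReal.ofReal_mul (by positivity), ENNReal.ofReal_mul (by positivity), e4]
      ring
    have hd2 : ‖((a x - a y : ℝ) : ℂ)‖ₑ ^ 2 ≤ ENNReal.ofReal (4 * L ^ 2 * min 1 (‖x - y‖ ^ 2)) := by
      rw [enorm_sq_eq_ofReal, Complex.norm_real, Real.norm_eq_abs]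
      exact ENNReal.ofReal_le_ofReal (hdiff x y)
    rw [hc]
    -- If only one point lies in B, the cutoff vanishes at the other, so the difference reduces to a
    -- difference of cutoffs times φ. The Slobodeckij kernel of φ is thus needed only on B × B.
    by_cases hx : x ∈ B <;> by_cases hy : y ∈ B
    · have hGv : G x y = ‖φ x - φ y‖ₑ ^ 2 / ‖x - y‖ₑ ^ (n + 1) := by simp [hG, hx, hy]
      rw [hGv, ← mul_div_assoc, ← ENNReal.add_div]
      refine ENNReal.div_le_div_right ?_ _
      have e : (a x : ℂ) * φ x - (a y : ℂ) * φ y =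
          (a x : ℂ) * (φ x - φ y) + ((a x - a y : ℝ) : ℂ) * φ y := by push_cast; ring
      have hax : ‖(a x : ℂ)‖ₑ ≤ 1 := by
        rw [← ofReal_norm, ENNReal.ofReal_le_one, Complex.norm_real]; exact ha1 x
      have hFy : F y = ‖φ y‖ₑ ^ 2 := by simp [hF, hy]
      rw [e]
      calc _ ≤ (‖(a x : ℂ) * (φ x - φ y)‖ₑ + ‖((a x - a y : ℝ) : ℂ) * φ y‖ₑ) ^ 2 := by
            gcongr; exact enorm_add_le _ _
        _ ≤ 2 * ‖(a x : ℂ) * (φ x - φ y)‖ₑ ^ 2 + 2 * ‖((a x - a y : ℝ) : ℂ) * φ y‖ₑ ^ 2 :=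
            add_sq_le_two _ _
        _ ≤ _ := by
          rw [enorm_mul, enorm_mul, mul_pow _ ‖φ y‖ₑ]
          gcongr
          · exact mul_le_of_le_one_left zero_le hax
          · rw [← hFy]; exact le_add_self
    · refine le_trans ?_ le_add_self
      refine ENNReal.div_le_div_right ?_ _
      have hFx : F x = ‖φ x‖ₑ ^ 2 := by simp [hF, hx]
      have e : (a x : ℂ) * φ x - (a y : ℂ) * φ y = ((a x - a y : ℝ) : ℂ) * φ x := by
        simp [haB y hy]
      rw [e, enorm_mul, mul_pow]
      refine le_trans ?_ (le_mul_of_one_le_left' one_le_two)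
      gcongr
      rw [← hFx]; exact le_self_add
    · refine le_trans ?_ le_add_self
      refine ENNReal.div_le_div_right ?_ _
      have hFy : F y = ‖φ y‖ₑ ^ 2 := by simp [hF, hy]
      have e : (a x : ℂ) * φ x - (a y : ℂ) * φ y = ((a x - a y : ℝ) : ℂ) * φ y := by
        simp [haB x hx]
      rw [e, enorm_mul, mul_pow]
      refine le_trans ?_ (le_mul_of_one_le_left' one_le_two)
      gcongr
      rw [← hFy]; exact le_add_self
    · simp [haB x hx, haB y hy]
  have hN : ∫⁻ x, ‖(a x : ℂ) * φ x‖ₑ ^ 2 ≤ ∫⁻ x, F x := by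
    refine lintegral_mono fun x => ?_
    by_cases hx : x ∈ B
    · have hax : ‖(a x : ℂ)‖ₑ ≤ 1 := by
        rw [← ofReal_norm, ENNReal.ofReal_le_one, Complex.norm_real]; exact ha1 x
      simp only [hF, indicator_of_mem hx]
      rw [enorm_mul]
      gcongr
      exact mul_le_of_le_one_left zero_le hax
    · simp [haB x hx]
  have hkx : Measurable fun z : V × V => k (z.1 - z.2) * F z.1 := by fun_prop
  have hky : Measurable fun z : V × V => k (z.1 - z.2) * F z.2 := by fun_prop
  have h1 : ∫⁻ x, ∫⁻ y, k (x - y) * F x = M * ∫⁻ x, F x := by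
    rw [← lintegral_const_mul _ hFm]
    refine lintegral_congr fun x => ?_
    rw [lintegral_mul_const _ (by fun_prop)]
    congr 1
    exact lintegral_sub_left_eq_self (μ := (volume : Measure V)) k x
  have h2 : ∫⁻ x, ∫⁻ y, k (x - y) * F y = M * ∫⁻ x, F x := by
    rw [lintegral_lintegral_swap hky.aemeasurable, ← lintegral_const_mul _ hFm]
    refine lintegral_congr fun y => ?_
    rw [lintegral_mul_const _ (by fun_prop)]
    congr 1
    exact lintegral_sub_right_eq_self (μ := (volume : Measure V)) k y
  have hS : slobodeckij (fun x => (a x : ℂ) * φ x) ≤ 2 * (∫⁻ x, ∫⁻ y, G x y) +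
      8 * ENNReal.ofReal (L ^ 2) * (M * (∫⁻ x, F x) + M * ∫⁻ x, F x) := by
    have hGx : ∀ x, Measurable (G x) := fun x => hGm.comp measurable_prodMk_left
    have hGi : Measurable fun x => ∫⁻ y, G x y := hGm.lintegral_prod_right'
    calc _ ≤ ∫⁻ x, ∫⁻ y, (2 * G x y +
          8 * ENNReal.ofReal (L ^ 2) * (k (x - y) * F x + k (x - y) * F y)) :=
          lintegral_mono fun x => lintegral_mono fun y => hpt x y
      _ = ∫⁻ x, (2 * (∫⁻ y, G x y) + 8 * ENNReal.ofReal (L ^ 2) *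
          ((∫⁻ y, k (x - y) * F x) + ∫⁻ y, k (x - y) * F y)) := by
          refine lintegral_congr fun x => ?_
          rw [lintegral_add_left ((hGx x).const_mul _), lintegral_const_mul _ (hGx x),
            lintegral_const_mul _ (by fun_prop), lintegral_add_left (by fun_prop)]
      _ = _ := by
          have hix : Measurable fun x => ∫⁻ y, k (x - y) * F x := hkx.lintegral_prod_right'
          have hiy : Measurable fun x => ∫⁻ y, k (x - y) * F y := hky.lintegral_prod_right'
          rw [lintegral_add_left (hGi.const_mul _), lintegral_const_mul _ hGi,
            lintegral_const_mul _ (by fun_prop), lintegral_add_left hix, h1, h2]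
  have hFi : ∫⁻ x, F x = ∫⁻ x in B, ‖φ x‖ₑ ^ 2 := lintegral_indicator hB _
  have hGi : ∫⁻ x, ∫⁻ y, G x y =
      ∫⁻ x in B, ∫⁻ y in B, ‖φ x - φ y‖ₑ ^ 2 / ‖x - y‖ₑ ^ (n + 1) := by
    rw [← lintegral_indicator hB]
    refine lintegral_congr fun x => ?_
    by_cases hx : x ∈ B
    · simp only [hG, indicator_of_mem hx]
      rw [← lintegral_indicator hB]
    · simp [hG, hx]
  rw [halfNormSq, ← hFi, ← hGi]
  calc _ ≤ (∫⁻ x, F x) + (2 * (∫⁻ x, ∫⁻ y, G x y) +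
      8 * ENNReal.ofReal (L ^ 2) * (M * (∫⁻ x, F x) + M * ∫⁻ x, F x)) := add_le_add hN hS
    _ = _ := by ring

end Localized

variable {d : ℕ}

lemma norm_equatorPoint_add_pole (y : Euc d) : ‖equatorPoint y + pole d‖ = √(1 + ‖y‖ ^ 2) := by
  rw [← Real.sqrt_sq (norm_nonneg (equatorPoint y + pole d)), norm_add_sq_real,
    inner_equatorPoint_pole, norm_pole, ← equatorIsometry_apply, LinearIsometry.norm_map]
  congr 1; ring

lemma norm_gnomonic_sub_le (y z : Euc d) : ‖gnomonic y - gnomonic z‖ ≤ 2 * ‖y - z‖ := by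
  have hq := abs_sqrt_one_add_sub_le y z
  have hv := norm_equatorPoint_add_pole z
  have hy := one_le_sqrt_one_add y
  have hz := one_le_sqrt_one_add z
  simp only [gnomonic]
  set p := √(1 + ‖y‖ ^ 2)
  set q := √(1 + ‖z‖ ^ 2)
  have hp0 : 0 < p := by positivity
  have hq0 : 0 < q := by positivity
  have e1 : equatorPoint y = equatorPoint (y - z) + equatorPoint z := by
    rw [← equatorIsometry_apply, ← equatorIsometry_apply, ← equatorIsometry_apply, ← map_add,
      sub_add_cancel]
  have e2 : p⁻¹ * q⁻¹ * (q - p) = p⁻¹ - q⁻¹ := by field_simp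
  have e : p⁻¹ • (equatorPoint y + pole d) - q⁻¹ • (equatorPoint z + pole d) =
      p⁻¹ • equatorPoint (y - z) + (p⁻¹ * q⁻¹ * (q - p)) • (equatorPoint z + pole d) := by
    rw [e1, e2]; module
  have hn : ‖equatorPoint (y - z)‖ = ‖y - z‖ := (equatorIsometry d).norm_map _
  have hp1 : p⁻¹ ≤ 1 := inv_le_one_of_one_le₀ hy
  rw [e]
  refine (norm_add_le _ _).trans ?_
  rw [norm_smul, norm_smul, hn, hv, norm_mul, norm_mul, Real.norm_of_nonneg (by positivity),
    Real.norm_of_nonneg (by positivity), Real.norm_eq_abs, abs_sub_comm]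
  calc p⁻¹ * ‖y - z‖ + p⁻¹ * q⁻¹ * |p - q| * q = p⁻¹ * ‖y - z‖ + p⁻¹ * |p - q| := by field_simp
    _ ≤ 1 * ‖y - z‖ + 1 * ‖y - z‖ := by gcongr
    _ = _ := by ring

/-- The Jacobian of the chart, for the pairing, with a Lipschitz cutoff. -/
def cutoffWeight (R : ℝ) (y : Euc d) : ℝ :=
  max 0 (min 1 (R + 1 - ‖y‖)) * (√(1 + ‖y‖ ^ 2))⁻¹ ^ (d - 1)

lemma inv_sqrt_mem (y : Euc d) : 0 < (√(1 + ‖y‖ ^ 2))⁻¹ ∧ (√(1 + ‖y‖ ^ 2))⁻¹ ≤ 1 :=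
  ⟨by positivity, inv_le_one_of_one_le₀ (one_le_sqrt_one_add y)⟩

lemma abs_inv_sqrt_pow_sub_le (k : ℕ) (y z : Euc d) :
    |(√(1 + ‖y‖ ^ 2))⁻¹ ^ k - (√(1 + ‖z‖ ^ 2))⁻¹ ^ k| ≤ k * ‖y - z‖ := by
  have hq := abs_sqrt_one_add_sub_le y z
  have hy := one_le_sqrt_one_add y
  have hz := one_le_sqrt_one_add z
  obtain ⟨hy0, hy1⟩ := inv_sqrt_mem y
  obtain ⟨hz0, hz1⟩ := inv_sqrt_mem z
  refine (abs_pow_sub_pow_le _ _ k).trans ?_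
  have hm : max |(√(1 + ‖y‖ ^ 2))⁻¹| |(√(1 + ‖z‖ ^ 2))⁻¹| ^ (k - 1) ≤ 1 := by
    rw [abs_of_pos hy0, abs_of_pos hz0]
    exact pow_le_one₀ (le_max_of_le_left hy0.le) (max_le hy1 hz1)
  set p := √(1 + ‖y‖ ^ 2)
  set q := √(1 + ‖z‖ ^ 2)
  have hp0 : 0 < p := by positivity
  have hq0 : 0 < q := by positivity
  have h1 : |p⁻¹ - q⁻¹| ≤ ‖y - z‖ := by
    have : p⁻¹ - q⁻¹ = p⁻¹ * q⁻¹ * (q - p) := by field_simp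
    rw [this, abs_mul, abs_of_pos (by positivity), abs_sub_comm]
    calc p⁻¹ * q⁻¹ * |p - q| ≤ 1 * 1 * ‖y - z‖ := by gcongr
      _ = _ := by ring
  calc |p⁻¹ - q⁻¹| * k * max |p⁻¹| |q⁻¹| ^ (k - 1) ≤ ‖y - z‖ * k * 1 := by gcongr
    _ = _ := by ring

lemma cutoffWeight_abs_le (R : ℝ) (y : Euc d) : |cutoffWeight R y| ≤ 1 := by
  obtain ⟨hy0, hy1⟩ := inv_sqrt_mem y
  rw [cutoffWeight, abs_of_nonneg (by positivity)]
  exact mul_le_one₀ (max_le zero_le_one (min_le_left _ _)) (by positivity) (pow_le_one₀ hy0.le hy1)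

lemma cutoffWeight_lipschitz (hd : 1 ≤ d) (R : ℝ) (y z : Euc d) :
    |cutoffWeight R y - cutoffWeight R z| ≤ d * ‖y - z‖ := by
  obtain ⟨hy0, hy1⟩ := inv_sqrt_mem y
  obtain ⟨hz0, hz1⟩ := inv_sqrt_mem z
  have h1 := abs_inv_sqrt_pow_sub_le (d - 1) y z
  have hd' : ((d - 1 : ℕ) : ℝ) = d - 1 := by push_cast [hd]; ring
  rw [hd'] at h1
  rw [cutoffWeight, cutoffWeight]
  set u := (√(1 + ‖y‖ ^ 2))⁻¹ ^ (d - 1)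
  set v := (√(1 + ‖z‖ ^ 2))⁻¹ ^ (d - 1)
  have hu0 : 0 ≤ u := by positivity
  have hu1 : u ≤ 1 := pow_le_one₀ hy0.le hy1
  have hs : |max 0 (min 1 (R + 1 - ‖y‖)) - max 0 (min 1 (R + 1 - ‖z‖))| ≤ ‖y - z‖ := by
    refine (abs_max_sub_max_le_max _ _ _ _).trans (max_le (by simp) ?_)
    refine (abs_min_sub_min_le_max _ _ _ _).trans (max_le (by simp) ?_)
    rw [sub_sub_sub_cancel_left, abs_sub_comm]
    exact abs_norm_sub_norm_le y z
  have ht0 : 0 ≤ max 0 (min 1 (R + 1 - ‖z‖)) := le_max_left _ _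
  have ht1 : max 0 (min 1 (R + 1 - ‖z‖)) ≤ 1 := max_le zero_le_one (min_le_left _ _)
  set s := max 0 (min 1 (R + 1 - ‖y‖))
  set t := max 0 (min 1 (R + 1 - ‖z‖))
  have e : s * u - t * v = (s - t) * u + t * (u - v) := by ring
  rw [e]
  refine (abs_add_le _ _).trans ?_
  rw [abs_mul, abs_mul, abs_of_nonneg hu0, abs_of_nonneg ht0]
  calc |s - t| * u + t * |u - v| ≤ ‖y - z‖ * 1 + 1 * (((d : ℝ) - 1) * ‖y - z‖) := by gcongr
    _ = _ := by ring

lemma cutoffWeight_eq_zero {R : ℝ} {y : Euc d} (hy : y ∉ closedBall 0 (R + 1)) :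
    cutoffWeight R y = 0 := by
  rw [mem_closedBall_zero_iff, not_le] at hy
  rw [cutoffWeight, max_eq_left, zero_mul]
  exact (min_le_right _ _).trans (by linarith)

lemma cutoffWeight_eq {R : ℝ} {y : Euc d} (hy : ‖y‖ ≤ R) :
    cutoffWeight R y = (√(1 + ‖y‖ ^ 2))⁻¹ ^ (d - 1) := by
  rw [cutoffWeight, min_eq_left (by linarith), max_eq_right zero_le_one, one_mul]

lemma continuous_cutoffWeight (R : ℝ) : Continuous (cutoffWeight R : Euc d → ℝ) := by
  unfold cutoffWeight
  have h : Continuous fun y : Euc d => (√(1 + ‖y‖ ^ 2))⁻¹ :=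
    Continuous.inv₀ (by fun_prop) fun y => by positivity
  fun_prop

/-- On the ball the density of the surface measure is at least (1+R²)^{-(d+1)/2}. -/
lemma setLIntegral_gnomonic_le (R : ℝ) {Φ : Euc (d + 1) → ℝ≥0∞} (hΦ : Measurable Φ) :
    ∫⁻ y in closedBall (0 : Euc d) R, Φ (gnomonic y) ≤
      ENNReal.ofReal (√(1 + R ^ 2) ^ (d + 1)) * ∫⁻ x, Φ x ∂(hemisphereMeasure d) := by
  rw [lintegral_hemisphere hΦ, ← lintegral_const_mul' _ _ ENNReal.ofReal_ne_top]
  refine le_trans ?_ (setLIntegral_le_lintegral (closedBall (0 : Euc d) R) _)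
  refine setLIntegral_mono' measurableSet_closedBall fun y hy => ?_
  rw [mem_closedBall_zero_iff] at hy
  rw [← mul_assoc, ← ENNReal.ofReal_mul (by positivity)]
  refine le_mul_of_one_le_left zero_le ?_
  rw [ENNReal.one_le_ofReal, ← mul_pow]
  refine one_le_pow₀ ?_
  rw [← div_eq_mul_inv, one_le_div (by positivity)]
  refine Real.sqrt_le_sqrt ?_
  have : ‖y‖ ^ 2 ≤ R ^ 2 := by gcongr
  linarith

/-- The chart transports the `H^{1/2}` norm of the hemisphere to that of the plane. -/
lemma exists_halfNormSq_cutoff_le (hd : 2 ≤ d) (R : ℝ) : ∃ C : ℝ≥0∞, C ≠ ⊤ ∧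
    ∀ {φ : Euc (d + 1) → ℂ}, Measurable φ → sobolevHalfNorm φ ≤ 1 →
      halfNormSq (fun y : Euc d => (cutoffWeight R y : ℂ) * φ (gnomonic y)) ≤ C := by
  have hfin : 2 ≤ Module.finrank ℝ (Euc d) := by simpa using hd
  have : Nontrivial (Euc d) := Module.nontrivial_of_finrank_pos (R := ℝ) (by omega)
  set Q := ENNReal.ofReal (√(1 + (R + 1) ^ 2) ^ (d + 1)) with hQ
  refine ⟨(1 + 16 * ENNReal.ofReal ((d : ℝ) ^ 2) * truncatedKernelMass (Euc d)) * Q +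
    2 * (2 ^ (d + 1) * (Q * Q)), ?_, fun {φ} hφ hn => ?_⟩
  · have := truncatedKernelMass_ne_top (V := Euc d)
    finiteness
  rw [sobolevHalfNorm, ← ENNReal.one_rpow (1 / 2 : ℝ),
    ENNReal.rpow_le_rpow_iff (by norm_num)] at hn
  have hN := le_self_add.trans hn
  have hS := le_add_self.trans hn
  refine (halfNormSq_cutoff_mul_le (B := closedBall 0 (R + 1)) measurableSet_closedBall
    (L := d) (by exact_mod_cast (by omega : 1 ≤ d)) (cutoffWeight_abs_le R)
    (cutoffWeight_lipschitz (by omega) R) (fun x hx => cutoffWeight_eq_zero hx)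
    (hφ.comp continuous_gnomonic.measurable)).trans ?_
  rw [finrank_euclideanSpace_fin]
  have hGm : Measurable fun z : Euc (d + 1) × Euc (d + 1) =>
      ‖φ z.1 - φ z.2‖ₑ ^ 2 / ‖z.1 - z.2‖ₑ ^ (d + 1) := by fun_prop
  gcongr
  · calc _ ≤ Q * ∫⁻ x, ‖φ x‖ₑ ^ 2 ∂(hemisphereMeasure d) :=
          setLIntegral_gnomonic_le (R + 1) (Φ := fun x => ‖φ x‖ₑ ^ 2) (by fun_prop)
      _ ≤ Q * 1 := by gcongr
      _ = Q := mul_one _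
  -- Only the upper Lipschitz bound of the chart is needed: chordal distances are at most 2|x−y|,
  -- and a smaller denominator increases the kernel.
  · have hpt : ∀ x y : Euc d, ‖φ (gnomonic x) - φ (gnomonic y)‖ₑ ^ 2 / ‖x - y‖ₑ ^ (d + 1) ≤
        2 ^ (d + 1) * (‖φ (gnomonic x) - φ (gnomonic y)‖ₑ ^ 2 /
          ‖gnomonic x - gnomonic y‖ₑ ^ (d + 1)) := by
      intro x y
      have h1 : ‖gnomonic x - gnomonic y‖ₑ ≤ 2 * ‖x - y‖ₑ := by
        have h0 := ENNReal.ofReal_le_ofReal (norm_gnomonic_sub_le x y)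
        rwa [ENNReal.ofReal_mul zero_le_two, ofReal_norm, ofReal_norm, ENNReal.ofReal_ofNat] at h0
      have h2 : ‖gnomonic x - gnomonic y‖ₑ ^ (d + 1) ≤ 2 ^ (d + 1) * ‖x - y‖ₑ ^ (d + 1) := by
        rw [← mul_pow]; gcongr
      have h3 : (‖x - y‖ₑ ^ (d + 1))⁻¹ ≤ 2 ^ (d + 1) * (‖gnomonic x - gnomonic y‖ₑ ^ (d + 1))⁻¹ := by
        have h4 := ENNReal.inv_le_inv.2 h2
        rw [ENNReal.mul_inv (Or.inl (by positivity)) (Or.inl (by finiteness))] at h4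
        calc (‖x - y‖ₑ ^ (d + 1))⁻¹ = 2 ^ (d + 1) * ((2 ^ (d + 1))⁻¹ * (‖x - y‖ₑ ^ (d + 1))⁻¹) := by
              rw [← mul_assoc, ENNReal.mul_inv_cancel (by positivity) (by finiteness), one_mul]
          _ ≤ _ := by gcongr
      rw [div_eq_mul_inv, div_eq_mul_inv, mul_left_comm]
      gcongr
    have hin : Measurable fun x => ∫⁻ y, ‖φ x - φ y‖ₑ ^ 2 / ‖x - y‖ₑ ^ (d + 1)
        ∂(hemisphereMeasure d) := by
      have : SFinite (hemisphereMeasure d) := by unfold hemisphereMeasure; infer_instance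
      exact hGm.lintegral_prod_right'
    calc _ ≤ ∫⁻ x in closedBall (0 : Euc d) (R + 1), ∫⁻ y in closedBall (0 : Euc d) (R + 1),
          2 ^ (d + 1) * (‖φ (gnomonic x) - φ (gnomonic y)‖ₑ ^ 2 /
          ‖gnomonic x - gnomonic y‖ₑ ^ (d + 1)) :=
          lintegral_mono fun x => lintegral_mono fun y => hpt x y
      _ ≤ ∫⁻ x in closedBall (0 : Euc d) (R + 1), 2 ^ (d + 1) * (Q *
          ∫⁻ y, ‖φ (gnomonic x) - φ y‖ₑ ^ 2 / ‖gnomonic x - y‖ₑ ^ (d + 1)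
            ∂(hemisphereMeasure d)) := by
          refine lintegral_mono fun x => ?_
          rw [lintegral_const_mul' _ _ (by finiteness)]
          gcongr
          exact setLIntegral_gnomonic_le (R + 1) (Φ := fun y => ‖φ (gnomonic x) - φ y‖ₑ ^ 2 /
            ‖gnomonic x - y‖ₑ ^ (d + 1)) (by fun_prop)
      _ ≤ 2 ^ (d + 1) * (Q * (Q * ∫⁻ x, ∫⁻ y, ‖φ x - φ y‖ₑ ^ 2 / ‖x - y‖ₑ ^ (d + 1)
            ∂(hemisphereMeasure d) ∂(hemisphereMeasure d))) := by
          rw [lintegral_const_mul' _ _ (by finiteness),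
            lintegral_const_mul' _ _ ENNReal.ofReal_ne_top]
          gcongr
          exact setLIntegral_gnomonic_le (R + 1) hin
      _ ≤ 2 ^ (d + 1) * (Q * (Q * 1)) := by gcongr
      _ = _ := by rw [mul_one]

lemma hemisphereMeasure_eq_map : hemisphereMeasure d = (volume.withDensity fun y : Euc d =>
    ENNReal.ofReal ((√(1 + ‖y‖ ^ 2))⁻¹ ^ (d + 1))).map gnomonic := by
  have hg := (continuous_gnomonic (d := d)).measurable
  ext s hs
  rw [Measure.map_apply hg hs, withDensity_apply _ (hg hs), ← lintegral_indicator_one hs,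
    lintegral_hemisphere (measurable_one.indicator hs), ← lintegral_indicator (hg hs)]
  refine lintegral_congr fun y => ?_
  by_cases h : gnomonic y ∈ s
  · rw [indicator_of_mem h, indicator_of_mem (by exact h), Pi.one_apply, mul_one]
  · rw [indicator_of_notMem h, indicator_of_notMem (by exact h), mul_zero]

lemma integral_hemisphere {F : Euc (d + 1) → ℂ} (hF : Measurable F) :
    ∫ x, F x ∂(hemisphereMeasure d) =
      ∫ y : Euc d, (((√(1 + ‖y‖ ^ 2))⁻¹ ^ (d + 1) : ℝ) : ℂ) * F (gnomonic y) := by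
  rw [hemisphereMeasure_eq_map, integral_map continuous_gnomonic.measurable.aemeasurable
    hF.aestronglyMeasurable, integral_withDensity_eq_integral_toReal_smul (by fun_prop)
    (ae_of_all _ fun _ => ENNReal.ofReal_lt_top)]
  refine integral_congr_ae (ae_of_all _ fun y => ?_)
  simp only
  rw [ENNReal.toReal_ofReal (by positivity), Complex.real_smul]

/-- Of the density (1+|y|²)^{-(d+1)/2}, one power (1+|y|²)⁻¹ is in `planar`. The rest has exponent
−(d−1)/2 and equals `cutoffWeight` where `planar f` can be nonzero. -/
lemma integral_mul_hemisphere (hd : 1 ≤ d) {f φ : Euc (d + 1) → ℂ} (hf : Measurable f)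
    (hφ : Measurable φ) {R : ℝ} (hfR : ∀ y, R < ‖y‖ → planar f y = 0) :
    ∫ x, f x * φ x ∂(hemisphereMeasure d) =
      ∫ y : Euc d, planar f y * ((cutoffWeight R y : ℂ) * φ (gnomonic y)) := by
  refine (integral_hemisphere (hf.mul hφ)).trans (integral_congr_ae (ae_of_all _ fun y => ?_))
  simp only [Pi.mul_apply]
  have hq : (1 + ‖y‖ ^ 2)⁻¹ = (√(1 + ‖y‖ ^ 2))⁻¹ ^ 2 := by
    rw [inv_pow, Real.sq_sqrt (by positivity)]
  rcases lt_or_ge R ‖y‖ with hy | hy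
  · have h0 := hfR y hy
    have h1 : f (gnomonic y) = 0 := by
      rw [planar, mul_eq_zero, Complex.ofReal_eq_zero] at h0
      exact h0.resolve_left (by positivity)
    simp [h0, h1]
  · rw [cutoffWeight_eq hy, planar, hq]
    obtain ⟨m, rfl⟩ : ∃ m, d = m + 1 := ⟨d - 1, by omega⟩
    rw [Nat.add_sub_cancel]
    push_cast
    ring

/-- The dual norm on the hemisphere is bounded by the one in the chart. -/
lemma exists_enorm_integral_mul_sq_le (hd : 2 ≤ d) (R : ℝ) : ∃ C : ℝ≥0∞, C ≠ ⊤ ∧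
    ∀ {f : Euc (d + 1) → ℂ} (_ : Measurable f) (hf2 : MemLp (planar f) 2)
      (_ : ∀ y, R < ‖y‖ → planar f y = 0) {φ : Euc (d + 1) → ℂ}, Measurable φ →
      sobolevHalfNorm φ ≤ 1 → ‖∫ x, f x * φ x ∂(hemisphereMeasure d)‖ₑ ^ 2 ≤
        C * fourierNegHalfNormSq (hf2.toLp (planar f)) := by
  have hfin : 2 ≤ Module.finrank ℝ (Euc d) := by simpa using hd
  have : Nontrivial (Euc d) := Module.nontrivial_of_finrank_pos (R := ℝ) (by omega)
  obtain ⟨K, hK, hequiv⟩ := exists_halfNormSq_equiv (Euc d)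
  obtain ⟨C, hC, hcut⟩ := exists_halfNormSq_cutoff_le hd R
  refine ⟨K * C, by finiteness, fun {f} hf hf2 hfR {φ} hφ hn => ?_⟩
  -- The conjugate turns the bilinear pairing into the sesquilinear inner product, with unchanged
  -- H^{1/2} norm.
  set ψ : Euc d → ℂ := fun y => (starRingEnd ℂ) ((cutoffWeight R y : ℂ) * φ (gnomonic y)) with hψ
  have hψm : Measurable ψ := Complex.continuous_conj.measurable.comp
    ((Complex.measurable_ofReal.comp (continuous_cutoffWeight R).measurable).mul
      (hφ.comp continuous_gnomonic.measurable))
  have hψC : halfNormSq ψ ≤ C := by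
    refine le_trans (le_of_eq ?_) (hcut hφ hn)
    have hnc : ∀ z : ℂ, ‖(starRingEnd ℂ) z‖ₑ = ‖z‖ₑ := fun z => by
      rw [← ofReal_norm, ← ofReal_norm, RCLike.norm_conj]
    simp only [halfNormSq, slobodeckij, hψ, ← map_sub, hnc]
  have hψ2 : MemLp ψ 2 := by
    refine (memLp_two_iff_integrable_sq_norm hψm.aestronglyMeasurable).2 ⟨by fun_prop, ?_⟩
    rw [HasFiniteIntegral]
    have e1 : ∀ y, ‖‖ψ y‖ ^ 2‖ₑ = ‖ψ y‖ₑ ^ 2 := fun y => by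
      rw [enorm_sq_eq_ofReal, Real.enorm_of_nonneg (by positivity)]
    simp only [e1]
    exact (le_self_add.trans hψC).trans_lt hC.lt_top
  have hinner : ∫ x, f x * φ x ∂(hemisphereMeasure d) =
      inner ℂ (hψ2.toLp ψ) (hf2.toLp (planar f)) := by
    rw [integral_mul_hemisphere (by omega) hf hφ hfR, L2.inner_def]
    refine integral_congr_ae ?_
    filter_upwards [hψ2.coeFn_toLp, hf2.coeFn_toLp] with y h1 h2
    rw [h1, h2, RCLike.inner_apply]
    simp only [hψ, RCLike.conj_conj]
  rw [hinner]
  refine (enorm_inner_sq_le _ _).trans ?_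
  rw [mul_comm]
  gcongr
  refine (hequiv _).1.trans ?_
  gcongr
  rw [halfNormSq_congr hψ2.coeFn_toLp]
  exact hψC

end Pairing

end HemisphereXray

end

/-! ### Assembly of the estimate. -/

open HemisphereXray in
theorem theorem2p3 (d : ℕ) (hd : 2 ≤ d) (α₀ : ℝ) (hα₀ : 0 < α₀) (hα₁ : α₀ < 1) :
    ∃ lam₀ : ℝ, 0 < lam₀ ∧ ∃ C : ℝ, 0 < C ∧
      ∀ lam : ℝ, 0 ≤ lam → lam ≤ lam₀ →
        ∀ f : HemisphereXray.Euc (d + 1) → ℂ,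
          MemLp f 2 (HemisphereXray.hemisphereMeasure d) →
          (∀ᵐ x ∂(HemisphereXray.hemisphereMeasure d), HemisphereXray.height x ≤ α₀ → f x = 0) →
            HemisphereXray.sobolevNegHalfNorm f ≤
              ENNReal.ofReal C *
                HemisphereXray.boundaryL2Norm (HemisphereXray.attenuatedXray lam f) := by
  have hfin : 2 ≤ Module.finrank ℝ (Euc d) := by simpa using hd
  have hα : 0 < (α₀ ^ 2)⁻¹ - 1 := by
    rw [sub_pos]
    exact (one_lt_inv₀ (by positivity)).2 (pow_lt_one₀ hα₀.le hα₁ two_ne_zero)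
  -- The point over y has height (1+|y|²)^{-1/2}, which exceeds α₀ exactly when |y| < R.
  set R := √((α₀ ^ 2)⁻¹ - 1) with hRdef
  have hR : 0 < R := Real.sqrt_pos.2 hα
  obtain ⟨l, hl, hpert⟩ := exists_xrayEnergy_le_attenuatedEnergy hd hR
  obtain ⟨C₁, hC₁, hpair⟩ := exists_enorm_integral_mul_sq_le hd R
  have hcpos := rieszConst_pos hfin
  set c := ENNReal.ofReal (2 / rieszConst (Module.finrank ℝ (Euc d))) with hc
  have hc0 : c ≠ 0 := by
    simp only [hc, ne_eq, ENNReal.ofReal_eq_zero, not_le]; positivity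
  have hct : c ≠ ⊤ := ENNReal.ofReal_ne_top
  set Q := ENNReal.ofReal (√(1 + R ^ 2) ^ (d - 1) * Real.exp Real.pi) with hQ
  set T := C₁ * (c⁻¹ * (4 * Q)) with hT
  have hTt : T ^ (1 / 2 : ℝ) ≠ ⊤ := ENNReal.rpow_ne_top_of_nonneg (by norm_num) (by finiteness)
  -- The added 1 only makes the constant positive.
  refine ⟨min 1 l, by positivity, (T ^ (1 / 2 : ℝ)).toReal + 1, by positivity,
    fun lam h0 h1 f hf hsupp => ?_⟩
  have hl1 : lam ≤ 1 := h1.trans (min_le_left _ _)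
  -- A Borel representative of f vanishing everywhere outside the cap, since the chart lemmas need
  -- measurability and pointwise vanishing.
  set g : Euc (d + 1) → ℂ := {x | α₀ < height x}.indicator (hf.1.mk f) with hg
  have hgm : Measurable g := hf.1.stronglyMeasurable_mk.measurable.indicator
    (measurableSet_lt measurable_const continuous_height.measurable)
  have hfg : f =ᵐ[hemisphereMeasure d] g := by
    filter_upwards [hf.1.ae_eq_mk, hsupp] with x hx hx2
    by_cases h : α₀ < height x
    · rw [hx, hg, indicator_of_mem (by exact h)]
    · rw [hx2 (not_lt.1 h), hg, indicator_of_notMem (by exact h)]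
  have hg2 : MemLp g 2 (hemisphereMeasure d) := hf.ae_eq hfg
  have hgR : ∀ y, R < ‖y‖ → planar g y = 0 := by
    intro y hy
    have h2 : ¬ α₀ < height (gnomonic y) := by
      rw [height_gnomonic, not_lt]
      have h3 : (α₀ ^ 2)⁻¹ < 1 + ‖y‖ ^ 2 := by
        have : R ^ 2 < ‖y‖ ^ 2 := by gcongr
        rw [hRdef, Real.sq_sqrt hα.le] at this
        linarith
      have h4 : α₀⁻¹ ≤ √(1 + ‖y‖ ^ 2) := Real.le_sqrt_of_sq_le (by rw [inv_pow]; exact h3.le)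
      calc (√(1 + ‖y‖ ^ 2))⁻¹ ≤ (α₀⁻¹)⁻¹ := inv_anti₀ (by positivity) h4
        _ = α₀ := inv_inv _
    rw [planar, hg, indicator_of_notMem (by exact h2), mul_zero]
  have hp2 := memLp_planar hgm hg2 hgR
  have hpm := measurable_planar hgm
  set I : Euc d → ℝ≥0∞ := fun θ => ∫⁻ ξ, ‖attenuatedXray lam f θ ξ‖ₑ ^ 2 *
    ENNReal.ofReal (height ξ) ∂(directionMeasure θ) with hI
  have hneg : fourierNegHalfNormSq (hp2.toLp (planar g)) ≤
      c⁻¹ * (4 * Q) * ∫⁻ θ, I θ ∂(sphereMeasure (Euc d)) := by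
    have h2 : fourierNegHalfNormSq (hp2.toLp (planar g)) ≤
        c⁻¹ * ∫⁻ θ, xrayEnergy (planar g) θ ∂(sphereMeasure (Euc d)) := by
      rw [← ENNReal.div_eq_inv_mul, ENNReal.le_div_iff_mul_le (Or.inl hc0) (Or.inl hct), mul_comm]
      exact negHalfNorm_le_xrayEnergy hfin hpm hp2 hgR
    have h3 : ∫⁻ θ, attenuatedEnergy lam (planar g) θ ∂(sphereMeasure (Euc d)) ≤
        Q * ∫⁻ θ, I θ ∂(sphereMeasure (Euc d)) := by
      rw [← lintegral_const_mul' _ _ ENNReal.ofReal_ne_top]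
      refine lintegral_mono_ae ?_
      filter_upwards [ae_norm_eq_one_sphereMeasure] with θ hθ
      refine (attenuatedEnergy_le (by omega) hl1 hgm hgR hθ).trans (le_of_eq ?_)
      rw [← hQ, hI]
      congr 1
      refine lintegral_congr_ae ?_
      filter_upwards [attenuatedXray_congr_ae hfg lam hθ] with ξ hξ
      rw [hξ]
    calc _ ≤ c⁻¹ * (4 * (Q * ∫⁻ θ, I θ ∂(sphereMeasure (Euc d)))) := by
          refine h2.trans ?_
          gcongr
          refine (hpert lam h0 (h1.trans (min_le_right _ _)) hpm hp2 hgR).trans ?_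
          gcongr
      _ = _ := by ring
  refine iSup_le fun φ => iSup_le fun hφ => iSup_le fun hn => ?_
  have hsq : ‖∫ x, f x * φ x ∂(hemisphereMeasure d)‖ₑ ^ 2 ≤
      T * ∫⁻ θ, I θ ∂(sphereMeasure (Euc d)) := by
    have he : ∫ x, f x * φ x ∂(hemisphereMeasure d) = ∫ x, g x * φ x ∂(hemisphereMeasure d) := by
      refine integral_congr_ae ?_
      filter_upwards [hfg] with x hx
      rw [hx]
    rw [he, hT, mul_assoc C₁]
    exact (hpair hgm hp2 hgR hφ.smooth.continuous.measurable hn).trans (by gcongr)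
  calc ‖∫ x, f x * φ x ∂(hemisphereMeasure d)‖ₑ
      = (‖∫ x, f x * φ x ∂(hemisphereMeasure d)‖ₑ ^ 2) ^ (1 / 2 : ℝ) := by
        rw [← ENNReal.rpow_natCast, ← ENNReal.rpow_mul]; norm_num
    _ ≤ (T * ∫⁻ θ, I θ ∂(sphereMeasure (Euc d))) ^ (1 / 2 : ℝ) := by gcongr
    _ = T ^ (1 / 2 : ℝ) * boundaryL2Norm (attenuatedXray lam f) := by
        rw [ENNReal.mul_rpow_of_nonneg _ _ (by norm_num), boundaryL2Norm]
    _ ≤ _ := by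
        gcongr
        rw [← ENNReal.ofReal_toReal hTt]
        refine ENNReal.ofReal_le_ofReal ?_
        rw [ENNReal.ofReal_toReal hTt]
        linarith
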